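/- Let $1\le n\le N$, $m=N-n$, $r\ge 1$, $s\ge 2r$, and let $X$ be a smooth manifold of dimension $N$. Let $\mathrm{Imm}\,T^r_nX$ be the manifold of regular $(r,n)$-velocities, i.e. of $r$-jets $j^r_0\gamma$ at $0\in\mathbb R^n$ of immersions $\gamma$ of neighbourhoods of $0\in\mathbb R^n$ into $X$. The differential group $L^r_n$ of invertible $r$-jets $a=j^r_0\alpha$, $\alpha(0)=0$, acts on it by $j^r_0\gamma\cdot a=j^r_0(\gamma\circ\alpha)$. Put $a^i_{j_1\dots j_k}=\partial_{j_1}\cdots\partial_{j_k}\alpha^i(0)$ and $\det(a)=\det(a^i_j)$. Let $\rho^r_n$ be the projection onto the quotient $P^r_nX=\mathrm{Imm}\,T^r_nX/L^r_n$. *Coordinates.* Let $(V,\psi)$, $\psi=(x^A)_{1\le A\le N}=(x^i,x^\sigma)$ with $1\le i\le n$, $1\le\sigma\le m$, $x^\sigma=x^{n+\sigma}$, be a chart of $X$. Let $x^A_{j_1\dots j_k}=\partial_{j_1}\cdots\partial_{j_k}(x^A\circ\gamma)(0)$, $0\le k\le s$, be the associated coordinates of $j^s_0\gamma$, and let $W^s=\{j^s_0\gamma:\gamma(0)\in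 V,\ \det(x^i_j)\neq0\}$. A multi-index $I=(i_1,\dots,i_q)$ is a sequence in $\{1,\dots,n\}$, $|I|=q$, $IJ$ is the juxtaposition, and sums over multi-indices are over all sequences; repeated indices are summed. Let $\mathbf x=(x^i_I)_{1\le|I|\le s}$, an element of $L^s_n$, let $\mathbf z=(z^i_I)_{1\le|I|\le s}$ be its inverse, and $\det(\mathbf x)=\det(x^i_j)$. Put $$\partial_A^{j_1\dots j_k}=\frac{r_1!\cdots r_n!}{k!}\frac{\partial}{\partial x^A_{j_1\dots j_k}},\qquad d_i=\sum_{k=0}^{s-1}x^A_{ij_1\dots j_k}\partial_A^{j_1\dots j_k},$$ where $r_l$ is the number of times $l$ occurs in $j_1,\dots,j_k$. Define $y^\sigma=x^\sigma$ and $y^\sigma_{i_1\dots i_k}=z^j_{i_1}d_jy^\sigma_{i_2\dots i_k}$; these are symmetric in their lower indices, $(x^i,y^\sigma_I)_{|I|\le s}$ are coordinates on $\rho^s_n(W^s)$, and there $\rho^s_n$ is $x\mapsto(x^i,y^\sigma_I)$. On $\rho^s_n(W^s)$ put $$\Delta_\sigma^{j_1\dots j_k}=\frac{r_1!\cdots r_n!}{k!}\frac{\partial}{\partial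 y^\sigma_{j_1\dots j_k}},\qquad D_i=\frac{\partial}{\partial x^i}+\sum_{k=0}^{s-1}y^\sigma_{ij_1\dots j_k}\Delta_\sigma^{j_1\dots j_k}.$$ With $d_J=d_{j_1}\cdots d_{j_l}$ and $D_J=D_{j_1}\cdots D_{j_l}$ for $J=(j_1,\dots,j_l)$, the Lie–Euler expressions of functions $\mathcal L$ and $L$ of order $r$ are $$\mathcal E^I_A(\mathcal L)=\sum_{|J|\le r-|I|}(-1)^{|J|}\binom{|I|+|J|}{|I|}d_J\partial_A^{IJ}\mathcal L,\qquad E^I_\sigma(L)=\sum_{|J|\le r-|I|}(-1)^{|J|}\binom{|I|+|J|}{|I|}D_J\Delta_\sigma^{IJ}L,\qquad |I|\le r;$$ for $I=\emptyset$ they are the Euler–Lagrange expressions $\mathcal E_A(\mathcal L)$ and $E_\sigma(L)$. **Theorem.** Let $\mathcal L$ be a homogeneous Lagrangian on $\mathrm{Imm}\,T^r_nX$, i.e. a smooth function with $\mathcal L(x\cdot a)=\det(a)\,\mathcal L(x)$ for all $a\in L^r_n$, and let $L$ be the associated non-homogeneous Lagrangian in the chart, i.e. the smooth function on $\rho^r_n(W^r)$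 with $\mathcal L=\det(\mathbf x)\,L\circ\rho^r_n$ on $W^r$. Write $$Z^{j_1\dots j_k}_I=\sum_{(I_1,\dots,I_k)}\mathcal S^+_{j_1\dots j_k}\,z^{j_1}_{I_1}\cdots z^{j_k}_{I_k},$$ where the sum is over the partitions of (the positions in) $I$ into $k$ non-empty subsets, partitions differing by a permutation of the subsets being identified, and $\mathcal S^+_{j_1\dots j_k}$ is the mean over all permutations of $j_1,\dots,j_k$. Then on $W^s$, for all $1\le\sigma\le m$ and all $p,j,j_1,\dots,j_k\in\{1,\dots,n\}$ (with $L$, $E_\sigma(L)$, $E^I_\sigma(L)$ on the right evaluated at the image under $\rho^s_n$): $$\mathcal E_\sigma(\mathcal L)=\det(\mathbf x)\,E_\sigma(L)\circ\rho^s_n,$$ $$\mathcal E^{j_1\dots j_k}_\sigma(\mathcal L)=(-1)^k\det(\mathbf x)\sum_{k\le|I|\le r}(-1)^{|I|}Z^{j_1\dots j_k}_I\,E^I_\sigma(L)\circ\rho^s_n\qquad(1\le k\le r),$$ $$\mathcal E_p(\mathcal L)=-\det(\mathbf x)\,y^\sigma_p\,E_\sigma(L)\circ\rho^s_n,$$ $$\mathcal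 E^{j}_p(\mathcal L)=\det(\mathbf x)\Big[z^j_p\,L\circ\rho^s_n+y^\sigma_p\sum_{1\le|I|\le r}(-1)^{|I|}z^j_I\,E^I_\sigma(L)\circ\rho^s_n\Big],$$ $$\mathcal E^{j_1\dots j_k}_p(\mathcal L)=(-1)^{k+1}\det(\mathbf x)\,y^\sigma_p\sum_{k\le|I|\le r}(-1)^{|I|}Z^{j_1\dots j_k}_I\,E^I_\sigma(L)\circ\rho^s_n\qquad(2\le k\le r).$$ -/

import Mathlib

open scoped Manifold ContDiff Topology

noncomputable section

namespace Grassmann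

/-! ### Multi-indices -/

/-- The unordered multi-index `{j₁, …, jₖ}` of a sequence of indices. -/
def ms {n k : ℕ} (j : Fin k → Fin n) : Multiset (Fin n) := Finset.univ.val.map j

/-- Unordered multi-indices `J` with `|J| ≤ s`; they label the independent components
`j₁ ≤ ⋯ ≤ jₖ`, `k ≤ s`. -/
abbrev MultiIndex (n s : ℕ) : Type := {J : Multiset (Fin n) // J.card ≤ s}

instance (n s : ℕ) : Finite (MultiIndex n s) := by
  refine Finite.of_injective
    (fun (J : MultiIndex n s) (i : Fin n) =>
      (⟨J.1.count i, Nat.lt_succ_of_le ((J.1.count_le_card i).trans J.2)⟩ : Fin (s + 1))) ?_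
  intro J K h
  apply Subtype.ext
  ext i
  exact congrArg Fin.val (congrFun h i)

instance (n s : ℕ) : Fintype (MultiIndex n s) := Fintype.ofFinite _

instance (n s : ℕ) : DecidableEq (MultiIndex n s) := Classical.decEq _

/-- `(r₁! ⋯ rₙ!) / k!`, where `rᵢ` is the number of occurrences of `i` in `J` and `k = |J|`. -/
def weight {n : ℕ} (J : Multiset (Fin n)) : ℝ :=
  (∏ i : Fin n, ((J.count i).factorial : ℝ)) / (J.card.factorial : ℝ)

/-! ### Regular velocities on a manifold -/

/-- The iterated partial derivative `∂_{j₁} ⋯ ∂_{jₖ} g` for the list `[j₁, …, jₖ]`. -/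
def iterPartial {n : ℕ} :
    List (Fin n) → (EuclideanSpace ℝ (Fin n) → ℝ) → EuclideanSpace ℝ (Fin n) → ℝ
  | [], g => g
  | j :: l, g => fun t => fderiv ℝ (iterPartial l g) t (EuclideanSpace.single j 1)

section Velocities

variable (n N : ℕ) (X : Type*) [TopologicalSpace X] [ChartedSpace (EuclideanSpace ℝ (Fin N)) X]

/-- Smooth immersions into `X` of a neighbourhood of `0 ∈ ℝⁿ` (only the values near `0` of the
underlying total function matter). -/
structure ImmersionAtZero where
  toFun : EuclideanSpace ℝ (Fin n) → X
  smooth : ∀ᶠ t in 𝓝 (0 : EuclideanSpace ℝ (Fin n)), ContMDiffAt (𝓡 n) (𝓡 N) ∞ toFun t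
  injective : Function.Injective (mfderiv (𝓡 n) (𝓡 N) toFun 0)

/-- Representatives of elements of the differential group: smooth maps `α` of a neighbourhood of
`0 ∈ ℝⁿ` into `ℝⁿ` with `α(0) = 0` and invertible derivative at `0`. -/
structure LocalDiffeoAtZero where
  toFun : EuclideanSpace ℝ (Fin n) → EuclideanSpace ℝ (Fin n)
  smooth : ∀ᶠ t in 𝓝 (0 : EuclideanSpace ℝ (Fin n)), ContDiffAt ℝ ∞ toFun t
  map_zero : toFun 0 = 0
  det_ne_zero : (fderiv ℝ toFun 0).det ≠ 0

variable {n N X}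

/-- The immersion `γ ∘ α`. -/
def ImmersionAtZero.comp (γ : ImmersionAtZero n N X) (α : LocalDiffeoAtZero n) :
    ImmersionAtZero n N X where
  toFun := γ.toFun ∘ α.toFun
  smooth := by
    have hc : Filter.Tendsto α.toFun (𝓝 0) (𝓝 0) := by
      have := (α.smooth.self_of_nhds).continuousAt
      rw [ContinuousAt, α.map_zero] at this
      exact this
    filter_upwards [α.smooth, hc.eventually γ.smooth] with t h1 h2
    exact ContMDiffAt.comp t h2 h1.contMDiffAt
  injective := by
    have h1 : MDifferentiableAt (𝓡 n) (𝓡 N) γ.toFun (α.toFun 0) := by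
      rw [α.map_zero]
      exact (γ.smooth.self_of_nhds).mdifferentiableAt (by simp)
    have h2 : MDifferentiableAt (𝓡 n) (𝓡 n) α.toFun 0 :=
      (α.smooth.self_of_nhds).contMDiffAt.mdifferentiableAt (by simp)
    rw [mfderiv_comp 0 h1 h2, mfderiv_eq_fderiv]
    have h3 : Function.Injective (mfderiv (𝓡 n) (𝓡 N) γ.toFun (α.toFun 0)) := by
      rw [α.map_zero]
      exact γ.injective
    have h4 : Function.Injective (fderiv ℝ α.toFun 0) := by
      have := (LinearMap.equivOfDetNeZero
        (fderiv ℝ α.toFun 0 : EuclideanSpace ℝ (Fin n) →ₗ[ℝ] EuclideanSpace ℝ (Fin n))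
        α.det_ne_zero).injective
      exact this
    exact h3.comp h4

/-- The partial derivative at `0`, with respect to the multi-index `J`, of the `A`-th component
of `γ` in the chart `ψ`. -/
def ImmersionAtZero.coord (γ : ImmersionAtZero n N X)
    (ψ : OpenPartialHomeomorph X (EuclideanSpace ℝ (Fin N))) (A : Fin N)
    (J : Multiset (Fin n)) : ℝ :=
  iterPartial (J.sort (· ≤ ·)) (fun t => ψ (γ.toFun t) A) 0

variable (n N X) in
/-- Two immersions are equivalent when they have the same value at `0` and, in the charts
around it, the same partial derivatives at `0` up to order `r`. (The condition does not depend on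
the chart, so asking for it in one chart or in all charts is the same.) -/
def velocitySetoid (r : ℕ) : Setoid (ImmersionAtZero n N X) where
  r γ δ := γ.toFun 0 = δ.toFun 0 ∧
    ∀ ψ ∈ IsManifold.maximalAtlas (𝓡 N) ∞ X, γ.toFun 0 ∈ ψ.source →
      ∀ (A : Fin N) (J : Multiset (Fin n)), J.card ≤ r → γ.coord ψ A J = δ.coord ψ A J
  iseqv :=
    { refl := fun _ => ⟨rfl, fun _ _ _ _ _ _ => rfl⟩
      symm := fun h => ⟨h.1.symm, fun ψ hψ hs A J hJ =>
        (h.2 ψ hψ (by rw [h.1]; exact hs) A J hJ).symm⟩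
      trans := fun h h' => ⟨h.1.trans h'.1, fun ψ hψ hs A J hJ =>
        (h.2 ψ hψ hs A J hJ).trans (h'.2 ψ hψ (by rw [← h.1]; exact hs) A J hJ)⟩ }

variable (n N X) in
/-- The set `Imm Tʳₙ X` of regular `(r,n)`-velocities. -/
def RegularVelocity (r : ℕ) : Type _ := Quotient (velocitySetoid n N X r)

/-- The regular velocity `jʳ₀ γ`. -/
def jet (r : ℕ) (γ : ImmersionAtZero n N X) : RegularVelocity n N X r :=
  Quotient.mk (velocitySetoid n N X r) γ

end Velocities

/-! ### Coordinates on velocities, formal derivatives, Lie–Euler operators -/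

/-- The space of the coordinates `x^A_J`, `|J| ≤ s`, of the chart of `Tˢₙ X` associated with a
chart of an `N`-dimensional manifold `X`. -/
abbrev JetSpace (N n s : ℕ) : Type := Fin N × MultiIndex n s → ℝ

section Velocity

variable {N n s : ℕ}

/-- The coordinate `x^A_J` (it is used for `|J| ≤ s` only). -/
def JetSpace.get (x : JetSpace N n s) (A : Fin N) (J : Multiset (Fin n)) : ℝ :=
  if h : J.card ≤ s then x (A, ⟨J, h⟩) else 0

/-- The canonical projection `τ^{s,r}`, `r ≤ s`, in coordinates. -/
def JetSpace.trunc (r : ℕ) (x : JetSpace N n s) : JetSpace N n r := fun p => x.get p.1 p.2.1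

/-- `∂_A^{j₁⋯jₖ} = (r₁! ⋯ rₙ! / k!) ∂/∂x^A_{j₁⋯jₖ}`, where `J = {j₁, …, jₖ}`. -/
def partialJ (A : Fin N) (J : Multiset (Fin n)) (f : JetSpace N n s → ℝ) (x : JetSpace N n s) :
    ℝ :=
  if h : J.card ≤ s then weight J * fderiv ℝ f x (Pi.single (A, ⟨J, h⟩) 1) else 0

/-- The formal derivative
`d_i = ∑_{k=0}^{s-1} ∑_{j₁,…,jₖ} ∑_A x^A_{i j₁⋯jₖ} ∂_A^{j₁⋯jₖ}`. -/
def formalD (i : Fin n) (f : JetSpace N n s → ℝ) (x : JetSpace N n s) : ℝ :=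
  ∑ k ∈ Finset.range s, ∑ j : Fin k → Fin n, ∑ A : Fin N,
    x.get A (i ::ₘ ms j) * partialJ A (ms j) f x

/-- `d_{j₁} ⋯ d_{jₖ}` for the list `[j₁, …, jₖ]`. -/
def formalDs (l : List (Fin n)) (f : JetSpace N n s → ℝ) : JetSpace N n s → ℝ :=
  l.foldr formalD f

/-- The Lie–Euler expression `𝓔_A^{i₁⋯iₖ}(F)` of a Lagrangian `F` of order `r`,
`∑_{l=0}^{r-k} ∑_{j₁,…,j_l} (-1)^l (k+l choose k) d_{j₁} ⋯ d_{j_l} ∂_A^{i₁⋯iₖ j₁⋯j_l} F`,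
as a function on velocities of order `s ≥ 2r` (the function `F` depends on the coordinates of order
at most `r` only). For `k = 0` this is the Euler–Lagrange expression `𝓔_A(F)`. -/
def lieEuler (r : ℕ) (A : Fin N) {k : ℕ} (i : Fin k → Fin n) (F : JetSpace N n s → ℝ)
    (x : JetSpace N n s) : ℝ :=
  ∑ l ∈ Finset.range (r - k + 1), ∑ j : Fin l → Fin n,
    (-1 : ℝ) ^ l * ((k + l).choose k : ℝ) *
      formalDs (List.ofFn j) (partialJ A (ms i + ms j) F) x

end Velocity

/-! ### The same on the Grassmann side -/

/-- The space of the coordinates `x^i` and `y^σ_J`, `|J| ≤ s`, of an adapted chart of `Pˢₙ X`. -/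
abbrev GrSpace (n m s : ℕ) : Type := Fin n ⊕ (Fin m × MultiIndex n s) → ℝ

section Gr

variable {n m s : ℕ}

/-- The coordinate `y^σ_J` (it is used for `|J| ≤ s` only). -/
def GrSpace.get (u : GrSpace n m s) (σ : Fin m) (J : Multiset (Fin n)) : ℝ :=
  if h : J.card ≤ s then u (Sum.inr (σ, ⟨J, h⟩)) else 0

/-- The canonical projection of `Pˢₙ X` onto `Pʳₙ X`, `r ≤ s`, in coordinates. -/
def GrSpace.trunc (r : ℕ) (u : GrSpace n m s) : GrSpace n m r
  | Sum.inl i => u (Sum.inl i)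
  | Sum.inr p => u.get p.1 p.2.1

/-- `Δ_σ^{j₁⋯jₖ} = (r₁! ⋯ rₙ! / k!) ∂/∂y^σ_{j₁⋯jₖ}`, where `J = {j₁, …, jₖ}`. -/
def deltaJ (σ : Fin m) (J : Multiset (Fin n)) (f : GrSpace n m s → ℝ) (u : GrSpace n m s) : ℝ :=
  if h : J.card ≤ s then weight J * fderiv ℝ f u (Pi.single (Sum.inr (σ, ⟨J, h⟩)) 1) else 0

/-- The total derivative
`D_i = ∂/∂x^i + ∑_{k=0}^{s-1} ∑_{j₁,…,jₖ} ∑_σ y^σ_{i j₁⋯jₖ} Δ_σ^{j₁⋯jₖ}`. -/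
def totalD (i : Fin n) (f : GrSpace n m s → ℝ) (u : GrSpace n m s) : ℝ :=
  fderiv ℝ f u (Pi.single (Sum.inl i) 1) +
    ∑ k ∈ Finset.range s, ∑ j : Fin k → Fin n, ∑ σ : Fin m,
      u.get σ (i ::ₘ ms j) * deltaJ σ (ms j) f u

/-- `D_{j₁} ⋯ D_{jₖ}` for the list `[j₁, …, jₖ]`. -/
def totalDs (l : List (Fin n)) (f : GrSpace n m s → ℝ) : GrSpace n m s → ℝ :=
  l.foldr totalD f

/-- The Lie–Euler expression `E_σ^{i₁⋯iₖ}(F)` of a non-homogeneous Lagrangian `F` of order `r`,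
`∑_{l=0}^{r-k} ∑_{j₁,…,j_l} (-1)^l (k+l choose k) D_{j₁} ⋯ D_{j_l} Δ_σ^{i₁⋯iₖ j₁⋯j_l} F`.
For `k = 0` this is the Euler–Lagrange expression `E_σ(F)`. -/
def grLieEuler (r : ℕ) (σ : Fin m) {k : ℕ} (i : Fin k → Fin n) (F : GrSpace n m s → ℝ)
    (u : GrSpace n m s) : ℝ :=
  ∑ l ∈ Finset.range (r - k + 1), ∑ j : Fin l → Fin n,
    (-1 : ℝ) ^ l * ((k + l).choose k : ℝ) *
      totalDs (List.ofFn j) (deltaJ σ (ms i + ms j) F) u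

end Gr

/-! ### The differential group element `𝐱`, its inverse `𝐳`, and the invariants `y^σ_I`

The coordinates `x^A_J` with `A` among the first `n` indices are the `x^i_J`, the others are the
`x^σ_J`. -/

section Regular

variable {n m s : ℕ}

/-- The matrix `(x^i_j)`, with row index `i` and column index `j`. -/
def xMat (x : JetSpace (n + m) n s) : Matrix (Fin n) (Fin n) ℝ :=
  Matrix.of fun i j => x.get (Fin.castAdd m i) {j}

/-- The coordinates `(a · b)^i_I` of the product in the differential group, for a sequence
`I = (i₁, …, i_q)`:
`∑_p ∑_{(I₁,…,I_p)} b^{j₁}_{I₁} ⋯ b^{j_p}_{I_p} a^i_{j₁⋯j_p}`,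
where the second sum runs over the partitions of `I` into `p` non-empty subsets, partitions that
differ by a permutation of the subsets being identified (`OrderedFinpartition` lists the blocks of
a partition in one definite order). -/
def groupMul (a b : Fin n → Multiset (Fin n) → ℝ) (i : Fin n) {q : ℕ} (I : Fin q → Fin n) : ℝ :=
  ∑ c : OrderedFinpartition q, ∑ j : Fin c.length → Fin n,
    (∏ l, b (j l) (ms (I ∘ c.emb l))) * a i (ms j)

/-- The coordinates `e^i_I` of the identity of the differential group. -/
def groupOne (i : Fin n) {q : ℕ} (I : Fin q → Fin n) : ℝ := if ms I = {i} then 1 else 0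

/-- The group element `𝐳 = (z^i_I)`, `1 ≤ |I| ≤ s`, inverse to `𝐱 = (x^i_I)`: it is the one with
`𝐳 · 𝐱 = e`. -/
def zInv (x : JetSpace (n + m) n s) : Fin n → Multiset (Fin n) → ℝ :=
  Classical.epsilon fun z : Fin n → Multiset (Fin n) → ℝ =>
    ∀ (i : Fin n) (q : ℕ) (I : Fin q → Fin n), 1 ≤ q → q ≤ s →
      groupMul z (fun j J => x.get (Fin.castAdd m j) J) i I = groupOne i I

/-- The functions `y^σ_{i₁⋯iₖ}`, for the list `[i₁, …, iₖ]`, defined recurringly by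
`y^σ = x^σ` and `y^σ_{i₁⋯iₖ} = z^j_{i₁} d_j y^σ_{i₂⋯iₖ}`; here `(z^j_i)` is the inverse of the
matrix `(x^i_j)`. -/
def yFun (σ : Fin m) : List (Fin n) → JetSpace (n + m) n s → ℝ
  | [] => fun x => x.get (Fin.natAdd n σ) 0
  | i :: l => fun x => ∑ j : Fin n, (xMat x)⁻¹ j i * formalD j (yFun σ l) x

/-- The canonical projection `ρˢₙ : Wˢ → Pˢₙ X` in coordinates, `x ↦ (x^i, y^σ_J)`. The functions
`y^σ_{i₁⋯iₖ}` are symmetric on `Wˢ`, and the representative with `i₁ ≤ ⋯ ≤ iₖ` is used. -/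
def rho (x : JetSpace (n + m) n s) : GrSpace n m s
  | Sum.inl i => x.get (Fin.castAdd m i) 0
  | Sum.inr p => yFun p.1 (p.2.1.sort (· ≤ ·)) x

/-- The symmetrized partition sum
`∑_{(I₁,…,Iₖ)} 𝓢⁺_{j₁⋯jₖ} z^{j₁}_{I₁} ⋯ z^{jₖ}_{Iₖ}` over the partitions of the sequence `I` into
`k` non-empty subsets, up to permutation of the subsets; `𝓢⁺` is the mean over the permutations of
`j₁, …, jₖ`. -/
def zSum (z : Fin n → Multiset (Fin n) → ℝ) {k q : ℕ} (j : Fin k → Fin n) (I : Fin q → Fin n) :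
    ℝ :=
  ∑ c : OrderedFinpartition q,
    if h : c.length = k then
      (1 / (k.factorial : ℝ)) * ∑ π : Equiv.Perm (Fin k),
        ∏ l : Fin c.length, z (j (π (Fin.cast h l))) (ms (I ∘ c.emb l))
    else 0

end Regular

/-! ### Homogeneous Lagrangians and the associated non-homogeneous Lagrangians -/

section Lagrangians

variable {n m : ℕ} {X : Type*} [TopologicalSpace X]
  [ChartedSpace (EuclideanSpace ℝ (Fin (n + m))) X]

/-- The open set of the coordinates of the points of
`Wˢ = {jˢ₀γ | γ(0) ∈ V, det (x^i_j) ≠ 0}`, where `(V, ψ)` is a chart of `X`. -/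
def chartW (ψ : OpenPartialHomeomorph X (EuclideanSpace ℝ (Fin (n + m)))) (s : ℕ) :
    Set (JetSpace (n + m) n s) :=
  {x | WithLp.toLp 2 (fun A => x.get A 0) ∈ ψ.target ∧ (xMat x).det ≠ 0}

/-- The open set of the coordinates `(x^i, y^σ_J)` of the points of `ρʳₙ(Wʳ)`. -/
def chartRhoW (ψ : OpenPartialHomeomorph X (EuclideanSpace ℝ (Fin (n + m)))) (r : ℕ) :
    Set (GrSpace n m r) :=
  {u | WithLp.toLp 2 (Fin.append (fun i : Fin n => u (Sum.inl i)) fun σ : Fin m => u.get σ 0)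
    ∈ ψ.target}

open scoped Classical in
/-- The expression of a function on regular velocities in the chart associated with `ψ`: its
value at `x` is the value of the function at the velocity with coordinates `x^A_J`, `|J| ≤ r`. -/
def coordExpr {r : ℕ} (ψ : OpenPartialHomeomorph X (EuclideanSpace ℝ (Fin (n + m))))
    (𝓛 : RegularVelocity n (n + m) X r → ℝ) (x : JetSpace (n + m) n r) : ℝ :=
  if h : ∃ γ : ImmersionAtZero n (n + m) X, γ.toFun 0 ∈ ψ.source ∧
      ∀ (A : Fin (n + m)) (J : Multiset (Fin n)), J.card ≤ r → γ.coord ψ A J = x.get A J then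
    𝓛 (jet r h.choose)
  else 0

/-- A homogeneous Lagrangian: a smooth function `𝓛` on `Imm Tʳₙ X` with
`𝓛(x · a) = det(a) 𝓛(x)` for all `a` in the differential group. The charts `Wʳ` of all charts of
the maximal atlas cover `Imm Tʳₙ X`. -/
structure IsHomogeneousLagrangian {r : ℕ} (𝓛 : RegularVelocity n (n + m) X r → ℝ) : Prop where
  smooth : ∀ ψ ∈ IsManifold.maximalAtlas (𝓡 (n + m)) ∞ X,
    ContDiffOn ℝ ∞ (coordExpr ψ 𝓛) (chartW ψ r)
  homogeneous : ∀ (γ : ImmersionAtZero n (n + m) X) (α : LocalDiffeoAtZero n),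
    𝓛 (jet r (γ.comp α)) = (fderiv ℝ α.toFun 0).det * 𝓛 (jet r γ)

/-- `L` is the non-homogeneous Lagrangian associated with `𝓛` in the chart `ψ`: a smooth function
on `ρʳₙ(Wʳ)` with `𝓛 = det(𝐱) L ∘ ρʳₙ` on `Wʳ`. -/
structure IsAssociated {r : ℕ} (𝓛 : RegularVelocity n (n + m) X r → ℝ)
    (ψ : OpenPartialHomeomorph X (EuclideanSpace ℝ (Fin (n + m)))) (L : GrSpace n m r → ℝ) :
    Prop where
  smooth : ContDiffOn ℝ ∞ L (chartRhoW ψ r)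
  eq : ∀ x ∈ chartW ψ r, coordExpr ψ 𝓛 x = (xMat x).det * L (rho x)

/-- The Lie–Euler expressions `𝓔_A^I(𝓛)` on `Wˢ`, in the chart associated with `ψ`. -/
def lagLieEuler {r s : ℕ} (ψ : OpenPartialHomeomorph X (EuclideanSpace ℝ (Fin (n + m))))
    (𝓛 : RegularVelocity n (n + m) X r → ℝ) (A : Fin (n + m)) {k : ℕ} (I : Fin k → Fin n) :
    JetSpace (n + m) n s → ℝ :=
  lieEuler r A I fun x => coordExpr ψ 𝓛 (x.trunc r)

/-- The Lie–Euler expressions `E_σ^I(L)` on `ρˢₙ(Wˢ)`. -/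
def nonhomLieEuler {r s : ℕ} (L : GrSpace n m r → ℝ) (σ : Fin m) {k : ℕ} (I : Fin k → Fin n) :
    GrSpace n m s → ℝ :=
  grLieEuler r σ I fun u => L (u.trunc r)

end Lagrangians

end Grassmann

end

/-! A differential operator `∑ P^J d_J` with coefficients in an algebra of functions is encoded by
the polynomial `∑ P^J ξ_J` (`Symbol`), its left symbol. Writing the same operator as `∑ d_J ∘ S^J`
defines `transpose`. For `P^J = ∂F/∂x^A_J` the coefficients `S^J`, multiplied by `weight J`, are
exactly the Lie–Euler expressions of `F` (`weight_smul_transpose_apply`), so the theorem amounts to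
transposing the linearization of `F = det(𝐱) g`, where `g` is a function of `x^i` and `y^σ_J`.

For a characteristic `Q` the linearization `∑ ∂F/∂x^A_J d_J ∘ Q^A` has the left symbol `variation Q
F`. Its transpose is `∑ Q^A` times the Lie–Euler symbols of `F` (`transpose_variation`). Since
`variation Q` is a derivation that turns `d_i` into `d_i + ξ_i` (`variation_d`), it can also be
computed directly from `F = det(𝐱) g`. Comparing the two results for two choices of `Q` gives
everything.

Vertical choice, `Q` the unit vector of `x^σ`: the functions `z^i_j` and `det(𝐱)` do not vary, and
`y^σ_J` varies by the symbol of `δ_J`, where `δ_i = z^j_i d_j`. The operator is therefore `det(𝐱) ∑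
∂g/∂y^σ_J δ_J`. The `δ_i` commute, and the Piola identity `∑_j d_j(det(𝐱) z^j_i) = 0` makes `-δ_i`
the adjoint of `δ_i` for the density `det(𝐱)`. Integration by parts (`transpose_sum_frameNabla`)
leaves the Lie–Euler sums of `g` for the frame `δ`, multiplied by the symbols of the `δ_I`. The
latter are partition sums in `z^j_I` by the formula of Faà di Bruno (`iter_δξ`), and `ρ` intertwines
`δ_i` with `D_i` (`δ_pullback_rho`).

Horizontal choice, `Q^A = δ_p x^A`, an infinitesimal reparametrization: `g` is merely transported
along `δ_p`, and `det(𝐱) g` varies by the divergence `∑_b d_b ∘ (det(𝐱) z^b_p g)`, whose transpose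
is homogeneous of degree one in `ξ`. Here `Q^i` is the Kronecker delta of `i` and `p`, while `Q^σ =
y^σ_p`. Hence `𝓔_p + y^σ_p 𝓔_σ` vanishes in every order except the first, where the term with `z^j_p
L` appears (`ChainRule.transpose_symbol_castAdd`).

All of this takes place in an abstract `RegularAlgebra`. The smooth functions on `Wˢ` form one, and
the element `𝐳` of the statement is identified with the elements `zz` by cancellation in the
differential group. -/

noncomputable section

namespace Grassmann

open TopologicalSpace (Opens)

/-! ### Combinatorics of multi-indices -/

section MultiIndices

variable {n : ℕ}

@[simp] theorem ms_card {k : ℕ} (j : Fin k → Fin n) : (ms j).card = k := by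
  simp [ms]

@[simp] theorem ms_zero (j : Fin 0 → Fin n) : ms j = 0 := by
  simp [ms]

@[simp] theorem ms_cons {k : ℕ} (a : Fin n) (j : Fin k → Fin n) :
    ms (Fin.cons a j : Fin (k + 1) → Fin n) = a ::ₘ ms j := by
  simp [ms]

theorem ms_comp_equiv {k l : ℕ} (j : Fin k → Fin n) (e : Fin l ≃ Fin k) : ms (j ∘ e) = ms j := by
  have hc : Multiset.map e Finset.univ.val = (Finset.univ : Finset (Fin k)).val := by
    simp
  unfold ms
  rw [← Multiset.map_map, hc]

theorem ms_eq_coe_ofFn {k : ℕ} (j : Fin k → Fin n) : ms j = (List.ofFn j : Multiset (Fin n)) := by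
  simp [ms]

theorem exists_ms_eq (J : Multiset (Fin n)) : ∃ j : Fin J.card → Fin n, ms j = J := by
  induction J using Quotient.inductionOn with
  | h l => exact ⟨fun i => l.get i, by rw [ms_eq_coe_ofFn]; simp⟩

theorem exists_perm_of_ms_eq {k : ℕ} {j t : Fin k → Fin n} (h : ms t = ms j) :
    ∃ π : Equiv.Perm (Fin k), t = j ∘ π := by
  rw [ms_eq_coe_ofFn, ms_eq_coe_ofFn, Multiset.coe_eq_coe] at h
  have hs : t ∘ Tuple.sort t = j ∘ Tuple.sort j :=
    List.ofFn_injective ((((Tuple.sort t).ofFn_comp_perm t).trans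
      (h.trans ((Tuple.sort j).ofFn_comp_perm j).symm)).eq_of_pairwise'
        (Tuple.monotone_sort t).sortedLE_ofFn.pairwise
          (Tuple.monotone_sort j).sortedLE_ofFn.pairwise)
  refine ⟨(Tuple.sort t).symm.trans (Tuple.sort j), ?_⟩
  funext a
  simpa using congrFun hs ((Tuple.sort t).symm a)

@[simp] theorem weight_zero : weight (0 : Multiset (Fin n)) = 1 := by
  simp [weight]

/-- The recursion of inverse multinomial coefficients, in a form without division. -/
theorem weight_cons (a : Fin n) (J : Multiset (Fin n)) :
    weight (a ::ₘ J) * ((J.card : ℝ) + 1) = weight J * ((J.count a : ℝ) + 1) := by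
  have h : ∀ i, (((a ::ₘ J).count i).factorial : ℝ) =
      ((J.count i).factorial : ℝ) * if i = a then ((J.count a : ℝ) + 1) else 1 := by
    intro i
    rw [Multiset.count_cons]
    split_ifs with hi
    · subst hi
      rw [Nat.factorial_succ]
      push_cast
      ring
    · simp
  unfold weight
  simp_rw [h]
  rw [Finset.prod_mul_distrib, Finset.prod_ite_eq' Finset.univ a, Multiset.card_cons,
    Nat.factorial_succ]
  have : (J.card.factorial : ℝ) ≠ 0 := by positivity
  have : ((J.card : ℝ) + 1) ≠ 0 := by positivity
  push_cast
  simp only [Finset.mem_univ, if_true]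
  field_simp

@[simp] theorem weight_singleton (a : Fin n) : weight ({a} : Multiset (Fin n)) = 1 := by
  have := weight_cons a 0
  simpa using this

theorem sum_cons {k : ℕ} {M : Type*} [AddCommMonoid M] (f : (Fin (k + 1) → Fin n) → M) :
    ∑ j, f j = ∑ a, ∑ j : Fin k → Fin n, f (Fin.cons a j) := by
  rw [← (Fin.consEquiv fun _ => Fin n).sum_comp, Fintype.sum_prod_type]
  rfl

/-- The number of sequences with a given unordered multi-index, weighted. -/
theorem weight_mul_sum_ite {k : ℕ} (J : Multiset (Fin n)) (hJ : J.card = k) :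
    weight J * ∑ j : Fin k → Fin n, (if ms j = J then (1 : ℝ) else 0) = 1 := by
  induction k generalizing J with
  | zero =>
    obtain rfl := Multiset.card_eq_zero.1 hJ
    simp
  | succ k ih =>
    -- Among the sequences with the multi-index `J`, those that begin with `a` make up the fraction
    -- `J.count a / (k + 1)`; these fractions add up to one.
    have key : ∀ a : Fin n, weight J * ∑ j : Fin k → Fin n,
        (if ms (Fin.cons a j : Fin (k + 1) → Fin n) = J then (1 : ℝ) else 0) =
          (J.count a : ℝ) / (k + 1) := by
      intro a
      by_cases ha : a ∈ J
      · obtain ⟨K, rfl⟩ := Multiset.exists_cons_of_mem ha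
        have hK : K.card = k := by simpa using hJ
        have h1 := ih K hK
        have h2 := weight_cons a K
        rw [hK] at h2
        have h3 : ((k : ℝ) + 1) ≠ 0 := by positivity
        simp only [ms_cons, Multiset.cons_inj_right, Multiset.count_cons_self]
        rw [eq_div_iff h3, mul_right_comm, h2, mul_right_comm, h1]
        push_cast
        ring
      · have h0 : ∀ j : Fin k → Fin n, ¬ ms (Fin.cons a j : Fin (k + 1) → Fin n) = J := by
          rintro j rfl
          exact ha (by simp)
        simp only [h0, if_false, Multiset.count_eq_zero.2 ha]
        simp
    rw [sum_cons, Finset.mul_sum]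
    simp_rw [key]
    rw [← Finset.sum_div, ← Nat.cast_sum, Multiset.sum_count_eq_card (fun a _ => Finset.mem_univ a),
      hJ]
    push_cast
    exact div_self (by positivity)

/-! ### Passage between unordered multi-indices, sequences and permutations -/

section Module

variable {M : Type*} [AddCommGroup M] [Module ℝ M]

theorem weight_smul_sum_ite {k : ℕ} (J : Multiset (Fin n)) (hJ : J.card = k)
    (f : Multiset (Fin n) → M) :
    weight J • ∑ j : Fin k → Fin n, (if ms j = J then f (ms j) else 0) = f J := by
  have h : ∀ j : Fin k → Fin n, (if ms j = J then f (ms j) else 0) =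
      (if ms j = J then (1 : ℝ) else 0) • f J := by
    intro j
    split_ifs with h
    · rw [h, one_smul]
    · rw [zero_smul]
  simp_rw [h]
  rw [← Finset.sum_smul, smul_smul, weight_mul_sum_ite J hJ, one_smul]

/-- The weight is the reciprocal of the number of sequences with a given unordered multi-index. This
turns sums over independent components, natural for partial derivatives, into the sums over all
sequences in which the Lie–Euler expressions are written. -/
theorem sum_multiIndex_eq (s : ℕ) (f : Multiset (Fin n) → M) :
    ∑ J : MultiIndex n s, f J.1 =
      ∑ k ∈ Finset.range (s + 1), ∑ j : Fin k → Fin n, weight (ms j) • f (ms j) := by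
  have h : ∀ k ∈ Finset.range (s + 1), ∀ j : Fin k → Fin n, weight (ms j) • f (ms j) =
      ∑ J : MultiIndex n s, if ms j = J.1 then weight (ms j) • f (ms j) else 0 := by
    intro k hk j
    rw [Finset.sum_eq_single (⟨ms j, by simpa [Nat.lt_succ_iff] using hk⟩ : MultiIndex n s)]
    · simp
    · intro J _ hJ
      rw [if_neg]
      intro h
      exact hJ (Subtype.ext h.symm)
    · simp
  rw [Finset.sum_congr rfl fun k hk => Finset.sum_congr rfl fun j _ => h k hk j]
  simp_rw [Finset.sum_comm (t := (Finset.univ : Finset (MultiIndex n s)))]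
  refine Finset.sum_congr rfl fun J _ => ?_
  rw [Finset.sum_eq_single J.1.card]
  · rw [← weight_smul_sum_ite J.1 rfl f, Finset.smul_sum]
    refine Finset.sum_congr rfl fun j _ => ?_
    split_ifs with h
    · rw [h]
    · rw [smul_zero]
  · intro k _ hk
    refine Finset.sum_eq_zero fun j _ => ?_
    rw [if_neg]
    intro h
    exact hk (by rw [← h, ms_card])
  · intro h
    exact absurd (Finset.mem_range.2 (Nat.lt_succ_of_le J.2)) h

/-- The permutations carrying `j` to a given rearrangement form a coset of the stabilizer of `j`, so
all fibres of `π ↦ j ∘ π` have the same size. -/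
theorem sum_perm_ite_eq {k : ℕ} (j : Fin k → Fin n) (τ : Equiv.Perm (Fin k)) :
    (∑ π : Equiv.Perm (Fin k), if j ∘ π = j ∘ τ then (1 : ℝ) else 0) =
      ∑ π : Equiv.Perm (Fin k), if j ∘ π = j then (1 : ℝ) else 0 := by
  refine Fintype.sum_equiv (Equiv.mulRight τ⁻¹) _ _ fun π => ?_
  have : j ∘ π = j ∘ τ ↔ j ∘ ((Equiv.mulRight τ⁻¹) π) = j := by
    constructor
    · intro h
      funext a
      simpa using congrFun h (τ.symm a)
    · intro h
      funext a
      simpa using congrFun h (τ a)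
  simp only [this]

theorem sum_perm_comp {k : ℕ} (j : Fin k → Fin n) (f : (Fin k → Fin n) → M) :
    ∑ π : Equiv.Perm (Fin k), f (j ∘ π) =
      (∑ π : Equiv.Perm (Fin k), if j ∘ π = j then (1 : ℝ) else 0) •
        ∑ t : Fin k → Fin n, (if ms t = ms j then f t else 0) := by
  have h1 : ∀ π : Equiv.Perm (Fin k), f (j ∘ π) =
      ∑ t : Fin k → Fin n, (if j ∘ π = t then (1 : ℝ) else 0) • f t := by
    intro π
    simp [ite_smul]
  simp_rw [h1]
  rw [Finset.sum_comm, Finset.smul_sum]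
  refine Finset.sum_congr rfl fun t _ => ?_
  rw [← Finset.sum_smul]
  split_ifs with ht
  · obtain ⟨τ, rfl⟩ := exists_perm_of_ms_eq ht
    rw [sum_perm_ite_eq]
  · rw [Finset.sum_eq_zero, zero_smul, smul_zero]
    intro π _
    rw [if_neg]
    rintro rfl
    exact ht (ms_comp_equiv j π)

/-- Averaging over the sequences with a given unordered multi-index is averaging over the
permutations. -/
theorem weight_smul_sum_ite_eq_sum_perm {k : ℕ} (j : Fin k → Fin n) (f : (Fin k → Fin n) → M) :
    weight (ms j) • ∑ t : Fin k → Fin n, (if ms t = ms j then f t else 0) =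
      (1 / (k.factorial : ℝ)) • ∑ π : Equiv.Perm (Fin k), f (j ∘ π) := by
  have hk := sum_perm_comp (M := ℝ) j fun _ => (1 : ℝ)
  have hw := weight_mul_sum_ite (ms j) (ms_card j)
  rw [Finset.sum_const, Finset.card_univ, Fintype.card_perm, Fintype.card_fin, nsmul_eq_mul,
    mul_one, smul_eq_mul] at hk
  rw [sum_perm_comp j f, smul_smul]
  congr 1
  have h0 : (k.factorial : ℝ) ≠ 0 := by positivity
  rw [eq_comm, div_mul_eq_mul_div, one_mul, div_eq_iff h0, hk]
  -- `c` is the order of the stabilizer of `j`: by `hk`, `k!` is `c` times the number of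
  -- rearrangements, and by `hw` that number is the reciprocal of the weight.
  set c : ℝ := ∑ π : Equiv.Perm (Fin k), if j ∘ π = j then (1 : ℝ) else 0
  linear_combination (-c) * hw

/-- Splitting multi-indices into two parts and splitting sequences into two sequences. -/
theorem sum_antidiagonal_ms (F : Multiset (Fin n) → Multiset (Fin n) → M) (N : ℕ) :
    ∑ h : Fin N → Fin n, ((ms h).antidiagonal.map fun p => F p.1 p.2).sum =
      ∑ kl ∈ Finset.HasAntidiagonal.antidiagonal N, N.choose kl.1 •
        ∑ i : Fin kl.1 → Fin n, ∑ j : Fin kl.2 → Fin n, F (ms i) (ms j) := by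
  induction N generalizing F with
  | zero => simp
  | succ N ih =>
    -- Pascal's rule on the right mirrors the choice on the left: the first index goes to one part
    -- or to the other.
    rw [Finset.sum_antidiagonal_choose_succ_nsmul
      (fun k l => ∑ i : Fin k → Fin n, ∑ j : Fin l → Fin n, F (ms i) (ms j)), sum_cons]
    simp only [ms_cons, Multiset.antidiagonal_cons, Multiset.map_add, Multiset.map_map,
      Function.comp_def, Prod.map_fst, Prod.map_snd, id_eq, Multiset.sum_add,
      Finset.sum_add_distrib]
    have h1 := fun a => ih fun P Q => F P (a ::ₘ Q)
    have h2 := fun a => ih fun P Q => F (a ::ₘ P) Q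
    simp_rw [h1, h2]
    congr 1
    · rw [Finset.sum_comm]
      refine Finset.sum_congr rfl fun kl _ => ?_
      rw [← Finset.smul_sum, Finset.sum_comm]
      congr 1
      refine Finset.sum_congr rfl fun i _ => ?_
      rw [sum_cons]
      simp
    · rw [Finset.sum_comm]
      refine Finset.sum_congr rfl fun kl hkl => ?_
      rw [← Finset.smul_sum,
        Nat.choose_symm_of_eq_add (Finset.HasAntidiagonal.mem_antidiagonal.1 hkl).symm]
      congr 1
      rw [sum_cons]
      simp

end Module

end MultiIndices

/-! ### Iterates of commuting operators -/

section Iterates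

variable {n : ℕ} {M : Type*} [AddCommGroup M] [Module ℝ M]

/-- The composite of the operators `θ j`, `j ∈ J`. -/
def iter (θ : Fin n → Module.End ℝ M) (J : Multiset (Fin n)) : Module.End ℝ M :=
  ((J.sort (· ≤ ·)).map θ).prod

variable {θ : Fin n → Module.End ℝ M}

@[simp] theorem iter_zero : iter θ 0 = 1 := by
  simp [iter]

/-- `iter` multiplies along the sorted list; commutativity makes every other order equally good. -/
theorem iter_coe (hθ : ∀ i j, Commute (θ i) (θ j)) (l : List (Fin n)) :
    iter θ (l : Multiset (Fin n)) = (l.map θ).prod := by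
  unfold iter
  have hp : ((l : Multiset (Fin n)).sort (· ≤ ·)).Perm l :=
    Multiset.coe_eq_coe.1 (Multiset.sort_eq _ _)
  refine (hp.map θ).prod_eq' ?_
  rw [List.pairwise_map]
  exact List.pairwise_of_forall fun i j => hθ i j

theorem iter_cons (hθ : ∀ i j, Commute (θ i) (θ j)) (i : Fin n) (J : Multiset (Fin n)) :
    iter θ (i ::ₘ J) = θ i * iter θ J := by
  induction J using Quotient.inductionOn with
  | h l =>
    change iter θ (i ::ₘ (l : Multiset (Fin n))) = θ i * iter θ (l : Multiset (Fin n))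
    rw [Multiset.cons_coe, iter_coe hθ, iter_coe hθ, List.map_cons, List.prod_cons]

theorem commute_iter {φ : Module.End ℝ M} (h : ∀ i, Commute φ (θ i)) (J : Multiset (Fin n)) :
    Commute φ (iter θ J) := by
  refine Commute.list_prod_right _ _ fun x hx => ?_
  obtain ⟨i, -, rfl⟩ := List.mem_map.1 hx
  exact h i

theorem iter_ofFn {k : ℕ} (hθ : ∀ i j, Commute (θ i) (θ j)) (j : Fin k → Fin n) :
    iter θ (ms j) = ((List.ofFn j).map θ).prod := by
  rw [ms_eq_coe_ofFn, iter_coe hθ]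

end Iterates

/-! ### Symbols -/

section Symbols

variable {n : ℕ} {A : Type*} [CommRing A] [Algebra ℝ A]

variable (n A) in
/-- Polynomials in commuting variables `ξ₁, …, ξₙ` with coefficients in `A`. -/
abbrev Symbol : Type _ := Multiset (Fin n) →₀ A

/-- The multiplication with `ξ_i`. -/
def shift (i : Fin n) : Symbol n A →ₗ[A] Symbol n A := Finsupp.lmapDomain A A (i ::ₘ ·)

/-- The multiplication with `ξ_i` as a real linear operator. -/
def shiftEnd (i : Fin n) : Module.End ℝ (Symbol n A) := (shift i).restrictScalars ℝ

/-- A linear operator acting on the coefficients. -/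
def coeffEnd (D : Module.End ℝ A) : Module.End ℝ (Symbol n A) := Finsupp.mapRange.linearMap D

@[simp] theorem shiftEnd_single (i : Fin n) (J : Multiset (Fin n)) (a : A) :
    shiftEnd i (Finsupp.single J a) = Finsupp.single (i ::ₘ J) a := by
  simp [shiftEnd, shift, Finsupp.lmapDomain_apply]

theorem shiftEnd_smul (i : Fin n) (a : A) (p : Symbol n A) :
    shiftEnd i (a • p) = a • shiftEnd i p := (shift i).map_smul a p

@[simp] theorem coeffEnd_single (D : Module.End ℝ A) (J : Multiset (Fin n)) (a : A) :
    coeffEnd D (Finsupp.single J a) = Finsupp.single J (D a) := by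
  simp [coeffEnd]

@[simp] theorem coeffEnd_apply (D : Module.End ℝ A) (p : Symbol n A) (J : Multiset (Fin n)) :
    coeffEnd D p J = D (p J) := by
  simp [coeffEnd]

theorem coeffEnd_smul (D : Derivation ℝ A A) (a : A) (p : Symbol n A) :
    coeffEnd (D : Module.End ℝ A) (a • p) = D a • p + a • coeffEnd (D : Module.End ℝ A) p := by
  ext J
  simp only [coeffEnd_apply, Finsupp.smul_apply, Finsupp.add_apply, smul_eq_mul,
    Derivation.coeFn_coe, Derivation.leibniz]
  ring

theorem end_ext {φ χ : Module.End ℝ (Symbol n A)}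
    (h : ∀ J a, φ (Finsupp.single J a) = χ (Finsupp.single J a)) : φ = χ :=
  Finsupp.lhom_ext h

theorem commute_shiftEnd (i j : Fin n) :
    Commute (shiftEnd i : Module.End ℝ (Symbol n A)) (shiftEnd j) :=
  end_ext fun J a => by simp [Multiset.cons_swap]

theorem commute_shiftEnd_coeffEnd (i : Fin n) (D : Module.End ℝ A) :
    Commute (shiftEnd i : Module.End ℝ (Symbol n A)) (coeffEnd D) :=
  end_ext fun J a => by simp

theorem commute_coeffEnd {D D' : Module.End ℝ A} (h : Commute D D') :
    Commute (coeffEnd D : Module.End ℝ (Symbol n A)) (coeffEnd D') :=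
  end_ext fun J a => by
    simp only [Module.End.mul_apply, coeffEnd_single]
    exact congrArg _ (LinearMap.congr_fun h a)

/-- The operators underlying a family of derivations. -/
def ends (d : Fin n → Derivation ℝ A A) (i : Fin n) : Module.End ℝ A := (d i : A →ₗ[ℝ] A)

@[simp] theorem ends_apply (d : Fin n → Derivation ℝ A A) (i : Fin n) (a : A) :
    ends d i a = d i a := rfl

theorem commute_ends {d : Fin n → Derivation ℝ A A} (hd : ∀ i j a, d i (d j a) = d j (d i a))
    (i j : Fin n) : Commute (ends d i) (ends d j) :=
  LinearMap.ext fun a => hd i j a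

/-- The operator `ξ_i - d_i`. -/
def adj (d : Fin n → Derivation ℝ A A) (i : Fin n) : Module.End ℝ (Symbol n A) :=
  shiftEnd i - coeffEnd (ends d i)

/-- The operator `d_i + ξ_i`. -/
def nabla (d : Fin n → Derivation ℝ A A) (i : Fin n) : Module.End ℝ (Symbol n A) :=
  coeffEnd (ends d i) + shiftEnd i

/-- In terms of left symbols `nabla d i` is the composition with `d i` from the left, hence a
Leibniz rule. -/
theorem nabla_smul (d : Fin n → Derivation ℝ A A) (i : Fin n) (a : A) (p : Symbol n A) :
    nabla d i (a • p) = d i a • p + a • nabla d i p := by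
  simp only [nabla, LinearMap.add_apply, shiftEnd_smul, smul_add, ends]
  rw [coeffEnd_smul]
  abel

theorem nabla_single (d : Fin n → Derivation ℝ A A) (i : Fin n) (J : Multiset (Fin n)) (a : A) :
    nabla d i (Finsupp.single J a) =
      Finsupp.single J (d i a) + Finsupp.single (i ::ₘ J) a := by
  simp [nabla]

variable {d : Fin n → Derivation ℝ A A}

theorem commute_coeffEnd_adj (hd : ∀ i j a, d i (d j a) = d j (d i a)) (i j : Fin n) :
    Commute (coeffEnd (ends d i) : Module.End ℝ (Symbol n A)) (adj d j) := by
  unfold adj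
  refine Commute.sub_right (R := Module.End ℝ (Symbol n A)) ?_ ?_
  · exact (commute_shiftEnd_coeffEnd j _).symm
  · exact commute_coeffEnd (commute_ends hd i j)

theorem commute_shiftEnd_adj (d : Fin n → Derivation ℝ A A) (i j : Fin n) :
    Commute (shiftEnd i : Module.End ℝ (Symbol n A)) (adj d j) := by
  unfold adj
  refine Commute.sub_right (R := Module.End ℝ (Symbol n A)) ?_ ?_
  · exact commute_shiftEnd i j
  · exact commute_shiftEnd_coeffEnd i _

theorem commute_adj (hd : ∀ i j a, d i (d j a) = d j (d i a)) (i j : Fin n) :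
    Commute (adj d i) (adj d j) := by
  have h := (commute_shiftEnd_adj d i j).symm
  have h' := (commute_coeffEnd_adj hd i j).symm
  exact (Commute.sub_right (R := Module.End ℝ (Symbol n A)) h h').symm

theorem commute_nabla (hd : ∀ i j a, d i (d j a) = d j (d i a)) (i j : Fin n) :
    Commute (nabla d i) (nabla d j) := by
  unfold nabla
  exact ((commute_coeffEnd (commute_ends hd i j)).add_right
    (commute_shiftEnd_coeffEnd j _).symm).add_left
      ((commute_shiftEnd_coeffEnd i _).add_right (commute_shiftEnd i j))

/-- The transition from the left symbol `∑ P^J ξ_J` of a differential operator `∑ P^J d_J` to the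
symbol `∑ S^J ξ_J` with `∑ P^J d_J = ∑ d_J ∘ S^J`. -/
def transpose (d : Fin n → Derivation ℝ A A) : Symbol n A →ₗ[ℝ] Symbol n A :=
  Finsupp.lsum ℝ fun J => (iter (adj d) J).comp (Finsupp.lsingle 0)

theorem transpose_single (J : Multiset (Fin n)) (a : A) :
    transpose d (Finsupp.single J a) = iter (adj d) J (Finsupp.single 0 a) := by
  simp [transpose]

theorem transpose_single_zero (a : A) :
    transpose d (Finsupp.single 0 a) = Finsupp.single 0 a := by
  simp [transpose_single]

/-- Multiplying a left symbol by `ξ_i` composes the operator with `d_i` from the right; in `∑ d_J ∘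
S^J ∘ d_i` the last factor is moved past the coefficient by `S ∘ d_i = d_i ∘ S - (d_i S)`. -/
theorem transpose_shiftEnd (hd : ∀ i j a, d i (d j a) = d j (d i a)) (i : Fin n)
    (p : Symbol n A) : transpose d (shiftEnd i p) = adj d i (transpose d p) := by
  have h : (transpose d).comp (shiftEnd i) = (adj d i).comp (transpose d) :=
    end_ext fun J a => by
      simp [transpose_single, iter_cons (commute_adj hd)]
  exact LinearMap.congr_fun h p

theorem transpose_coeffEnd (hd : ∀ i j a, d i (d j a) = d j (d i a)) (i : Fin n)
    (p : Symbol n A) :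
    transpose d (coeffEnd (ends d i) p) = coeffEnd (ends d i) (transpose d p) := by
  have h : (transpose d).comp (coeffEnd (ends d i)) = (coeffEnd (ends d i)).comp (transpose d) :=
    end_ext fun J a => by
      have := LinearMap.congr_fun (commute_iter (commute_coeffEnd_adj hd i) J) (Finsupp.single 0 a)
      simp only [Module.End.mul_apply, coeffEnd_single] at this
      simp only [LinearMap.comp_apply, coeffEnd_single, transpose_single, this]
  exact LinearMap.congr_fun h p

/-- Composition with `d_i` from the left is already in transposed form. Thus a divergence
contributes nothing to the coefficient of order zero. -/
theorem transpose_nabla (hd : ∀ i j a, d i (d j a) = d j (d i a)) (i : Fin n)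
    (p : Symbol n A) : transpose d (nabla d i p) = shiftEnd i (transpose d p) := by
  simp only [nabla, LinearMap.add_apply, map_add, transpose_shiftEnd hd, transpose_coeffEnd hd,
    adj, LinearMap.sub_apply]
  abel

/-- The transpose of `a · d_J` after the substitution of `y` for the argument. -/
theorem transpose_smul_iter_nabla (hd : ∀ i j a, d i (d j a) = d j (d i a)) (a y : A)
    (J : Multiset (Fin n)) :
    transpose d (a • iter (nabla d) J (Finsupp.single 0 y)) =
      y • transpose d (Finsupp.single J a) := by
  induction J using Multiset.induction_on generalizing a with
  | empty =>
    rw [iter_zero, Module.End.one_apply, Finsupp.smul_single, transpose_single_zero,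
      transpose_single_zero, Finsupp.smul_single, smul_eq_mul, smul_eq_mul, mul_comm]
  | cons i J ih =>
    -- The coefficient is brought inside the outermost `nabla`, at the price of a term with `d i a`;
    -- the induction hypothesis is used for the coefficients `a` and `d i a`.
    have h : a • nabla d i (iter (nabla d) J (Finsupp.single 0 y)) =
        nabla d i (a • iter (nabla d) J (Finsupp.single 0 y)) -
          d i a • iter (nabla d) J (Finsupp.single 0 y) := by
      rw [nabla_smul]; abel
    rw [iter_cons (commute_nabla hd), Module.End.mul_apply, h, map_sub, transpose_nabla hd, ih, ih,
      ← shiftEnd_single, transpose_shiftEnd hd, shiftEnd_smul, adj, LinearMap.sub_apply, smul_sub,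
      ← transpose_coeffEnd hd, coeffEnd_single, ends_apply]

/-! ### The Lie–Euler sum -/

/-- `∑_l ∑_{j₁,…,j_l} (-1)^l (|K|+l choose |K|) D_{j₁} ⋯ D_{j_l} P^{K j₁⋯j_l}`. -/
def lieSum (θ : Fin n → Module.End ℝ A) (r : ℕ) (P : Multiset (Fin n) → A)
    (K : Multiset (Fin n)) : A :=
  ∑ l ∈ Finset.range (r - K.card + 1), ∑ j : Fin l → Fin n,
    ((-1 : ℝ) ^ l * ((K.card + l).choose K.card : ℝ)) • iter θ (ms j) (P (K + ms j))

/-- The left side is what a Leibniz expansion of iterated derivatives produces: each multi-index is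
split into derivatives that hit the coefficient and a remainder `p.1`. Collecting the terms with the
same remainder gives the Lie–Euler sums, and their binomial coefficient counts the positions of the
remainder in the sequence. -/
theorem sum_lieSum_smul {M : Type*} [AddCommGroup M] [Module A M] [Module ℝ M]
    [IsScalarTower ℝ A M] (θ : Fin n → Module.End ℝ A) (r : ℕ) (P : Multiset (Fin n) → A)
    (φ : Multiset (Fin n) → M) :
    ∑ N ∈ Finset.range (r + 1), ∑ h : Fin N → Fin n,
        ((ms h).antidiagonal.map fun p =>
          ((-1 : ℝ) ^ p.2.card • iter θ p.2 (P (ms h))) • φ p.1).sum =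
      ∑ k ∈ Finset.range (r + 1), ∑ i : Fin k → Fin n, lieSum θ r P (ms i) • φ (ms i) := by
  have h1 : ∀ (N : ℕ) (h : Fin N → Fin n),
      ((ms h).antidiagonal.map fun p =>
          ((-1 : ℝ) ^ p.2.card • iter θ p.2 (P (ms h))) • φ p.1).sum =
        ((ms h).antidiagonal.map fun p =>
          ((-1 : ℝ) ^ p.2.card • iter θ p.2 (P (p.1 + p.2))) • φ p.1).sum := by
    intro N h
    refine congrArg _ (Multiset.map_congr rfl fun p hp => ?_)
    rw [Multiset.mem_antidiagonal.1 hp]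
  simp_rw [h1]
  simp_rw [sum_antidiagonal_ms fun Q R =>
    ((-1 : ℝ) ^ R.card • iter θ R (P (Q + R))) • φ Q]
  simp_rw [Finset.Nat.sum_antidiagonal_eq_sum_range_succ_mk]
  have h2 := Finset.sum_range_diag_flip (r + 1) fun k l => (k + l).choose k •
    ∑ i : Fin k → Fin n, ∑ j : Fin l → Fin n,
      ((-1 : ℝ) ^ (ms j).card • iter θ (ms j) (P (ms i + ms j))) • φ (ms i)
  refine Eq.trans ?_ (h2.trans ?_)
  · refine Finset.sum_congr rfl fun N _ => Finset.sum_congr rfl fun k hk => ?_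
    rw [Nat.add_sub_cancel' (Nat.lt_succ_iff.1 (Finset.mem_range.1 hk))]
  · refine Finset.sum_congr rfl fun k hk => ?_
    have hk' : r + 1 - k = r - k + 1 := by
      have := Finset.mem_range.1 hk
      omega
    simp_rw [Finset.smul_sum, lieSum, Finset.sum_smul, ms_card, hk']
    rw [Finset.sum_comm]
    refine Finset.sum_congr rfl fun i _ => Finset.sum_congr rfl fun l _ =>
      Finset.sum_congr rfl fun j _ => ?_
    rw [← Nat.cast_smul_eq_nsmul ℝ, ← smul_assoc, smul_smul, mul_comm]

/-- The binomial expansion of the commuting operators `ξ_i - d_i` applied to a coefficient. -/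
theorem iter_adj_single (hd : ∀ i j a, d i (d j a) = d j (d i a)) (J : Multiset (Fin n))
    (a : A) :
    iter (adj d) J (Finsupp.single 0 a) =
      (J.antidiagonal.map fun p => ((-1 : ℝ) ^ p.2.card • iter (ends d) p.2 a) •
        (Finsupp.single p.1 1 : Symbol n A)).sum := by
  induction J using Multiset.induction_on with
  | empty => simp
  | cons i J ih =>
    rw [iter_cons (commute_adj hd), Module.End.mul_apply, ih, map_multiset_sum,
      Multiset.antidiagonal_cons, Multiset.map_add, Multiset.sum_add, Multiset.map_map,
      Multiset.map_map, Multiset.map_map, ← Multiset.sum_map_add]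
    refine congrArg _ (Multiset.map_congr rfl fun p _ => ?_)
    simp only [Function.comp_apply, Prod.map_fst, Prod.map_snd, id_eq, Multiset.card_cons,
      iter_cons (commute_ends hd), adj, LinearMap.sub_apply, shiftEnd_single,
      Finsupp.smul_single, smul_eq_mul, mul_one, coeffEnd_single, LinearMap.map_smul,
      Module.End.mul_apply, ends_apply, pow_succ, mul_neg, neg_smul, Finsupp.single_neg]
    abel

theorem transpose_sum (hd : ∀ i j a, d i (d j a) = d j (d i a)) (r : ℕ)
    (P : Multiset (Fin n) → A) :
    transpose d (∑ N ∈ Finset.range (r + 1), ∑ h : Fin N → Fin n,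
        Finsupp.single (ms h) (P (ms h))) =
      ∑ k ∈ Finset.range (r + 1), ∑ i : Fin k → Fin n,
        lieSum (ends d) r P (ms i) • (Finsupp.single (ms i) 1 : Symbol n A) := by
  rw [← sum_lieSum_smul (ends d) r P fun J => (Finsupp.single J 1 : Symbol n A)]
  simp_rw [map_sum, transpose_single, iter_adj_single hd]

/-- The Lie–Euler sums of `F^J = weight J • f_J` are the coefficients of the transpose. -/
theorem weight_smul_transpose_apply (hd : ∀ i j a, d i (d j a) = d j (d i a)) (r : ℕ)
    (f : Multiset (Fin n) → A) (K : Multiset (Fin n)) (hK : K.card ≤ r) :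
    weight K • transpose d (∑ J : MultiIndex n r, Finsupp.single J.1 (f J.1)) K =
      lieSum (ends d) r (fun J => weight J • f J) K := by
  rw [sum_multiIndex_eq r fun J => (Finsupp.single J (f J) : Symbol n A)]
  simp_rw [Finsupp.smul_single]
  rw [transpose_sum hd r fun J => weight J • f J]
  simp only [Finsupp.finsetSum_apply, Finsupp.smul_apply, smul_eq_mul, Finsupp.single_apply,
    mul_ite, mul_one, mul_zero]
  rw [Finset.sum_eq_single_of_mem K.card (Finset.mem_range.2 (Nat.lt_succ_of_le hK))]
  · exact weight_smul_sum_ite K rfl fun J => lieSum (ends d) r (fun J => weight J • f J) J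
  · intro k _ hk
    refine Finset.sum_eq_zero fun j _ => ?_
    rw [if_neg]
    intro h
    exact hk (by rw [← h, ms_card])

end Symbols

/-! ### Moving frames of derivations -/

section Frames

variable {n : ℕ} {A : Type*} [CommRing A] [Algebra ℝ A]

/-- The derivation `z^j_i d_j`. -/
def frame (d : Fin n → Derivation ℝ A A) (z : Fin n → Fin n → A) (i : Fin n) :
    Derivation ℝ A A :=
  ∑ j, z j i • d j

/-- The operator `z^j_i (d_j + ξ_j)`. -/
def frameNabla (d : Fin n → Derivation ℝ A A) (z : Fin n → Fin n → A) (i : Fin n) :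
    Module.End ℝ (Symbol n A) :=
  ∑ j, z j i • nabla d j

variable {d : Fin n → Derivation ℝ A A} {z : Fin n → Fin n → A}

theorem derivation_sum_apply {ι M : Type*} [AddCommGroup M] [Module A M] [Module ℝ M]
    (t : Finset ι) (D : ι → Derivation ℝ A M) (a : A) : (∑ i ∈ t, D i) a = ∑ i ∈ t, D i a := by
  classical
  induction t using Finset.induction_on with
  | empty => simp
  | insert i t hi ih => rw [Finset.sum_insert hi, Finset.sum_insert hi, Derivation.add_apply, ih]

theorem frame_apply (i : Fin n) (a : A) : frame d z i a = ∑ j, z j i * d j a := by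
  simp [frame, derivation_sum_apply]

theorem frameNabla_apply (i : Fin n) (p : Symbol n A) :
    frameNabla d z i p = ∑ j, z j i • nabla d j p := by
  simp [frameNabla]

theorem frameNabla_smul (i : Fin n) (a : A) (p : Symbol n A) :
    frameNabla d z i (a • p) = frame d z i a • p + a • frameNabla d z i p := by
  simp only [frameNabla_apply, frame_apply, nabla_smul, smul_add, Finset.sum_add_distrib,
    Finset.sum_smul, Finset.smul_sum, smul_smul, mul_comm a]

theorem frameNabla_single (i : Fin n) (J : Multiset (Fin n)) (a : A) :
    frameNabla d z i (Finsupp.single J a) =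
      Finsupp.single J (frame d z i a) +
        ∑ j, Finsupp.single (j ::ₘ J) (z j i * a) := by
  simp only [frameNabla_apply, nabla_single, smul_add, Finset.sum_add_distrib,
    Finsupp.smul_single, smul_eq_mul, frame_apply]
  congr 1
  exact (map_sum (Finsupp.singleAddHom J) _ _).symm

/-- The second-order part of `δ_i δ_l` is symmetric because the `d_j` commute; the first-order
coefficients are `δ_i z^k_l`, whose symmetry is `hz`. -/
theorem frame_comm (hd : ∀ i j a, d i (d j a) = d j (d i a))
    (hz : ∀ i l k, frame d z i (z k l) = frame d z l (z k i)) (i l : Fin n) (a : A) :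
    frame d z i (frame d z l a) = frame d z l (frame d z i a) := by
  have h : ∀ i l, frame d z i (frame d z l a) =
      ∑ k, ∑ j, z k l * (z j i * d j (d k a)) + ∑ k, d k a * frame d z i (z k l) := by
    intro i l
    rw [frame_apply l, map_sum]
    simp only [Derivation.leibniz, smul_eq_mul, Finset.sum_add_distrib]
    congr 1
    refine Finset.sum_congr rfl fun k _ => ?_
    rw [frame_apply, Finset.mul_sum]
  rw [h i l, h l i, Finset.sum_comm]
  congr 1
  · refine Finset.sum_congr rfl fun k _ => Finset.sum_congr rfl fun j _ => ?_
    rw [hd k j]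
    ring
  · refine Finset.sum_congr rfl fun k _ => ?_
    rw [hz]

theorem commute_frameNabla (hd : ∀ i j a, d i (d j a) = d j (d i a))
    (hz : ∀ i l k, frame d z i (z k l) = frame d z l (z k i)) (i l : Fin n) :
    Commute (frameNabla d z i) (frameNabla d z l) := by
  have h : ∀ i l p, frameNabla d z i (frameNabla d z l p) =
      ∑ k, frame d z i (z k l) • nabla d k p +
        ∑ k, ∑ j, (z k l * z j i) • nabla d j (nabla d k p) := by
    intro i l p
    rw [frameNabla_apply l, map_sum]
    simp only [frameNabla_smul, Finset.sum_add_distrib]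
    congr 1
    refine Finset.sum_congr rfl fun k _ => ?_
    rw [frameNabla_apply, Finset.smul_sum]
    simp only [smul_smul]
  refine LinearMap.ext fun p => ?_
  rw [Module.End.mul_apply, Module.End.mul_apply, h i l, h l i, Finset.sum_comm (f := fun k j =>
    (z k l * z j i) • nabla d j (nabla d k p))]
  congr 1
  · refine Finset.sum_congr rfl fun k _ => ?_
    rw [hz]
  · refine Finset.sum_congr rfl fun k _ => Finset.sum_congr rfl fun j _ => ?_
    rw [mul_comm]
    congr 1
    exact LinearMap.congr_fun (commute_nabla hd k j) p

/-- On left symbols the first operator is a composition from the right, the second one from the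
left. -/
theorem commute_shiftEnd_frameNabla (i j : Fin n) :
    Commute (shiftEnd j) (frameNabla d z i) := by
  refine LinearMap.ext fun p => ?_
  simp only [Module.End.mul_apply, frameNabla_apply, map_sum, shiftEnd_smul, nabla,
    LinearMap.add_apply, map_add]
  refine Finset.sum_congr rfl fun k _ => ?_
  congr 2
  · exact LinearMap.congr_fun (commute_shiftEnd_coeffEnd j _) p
  · exact LinearMap.congr_fun (commute_shiftEnd j k) p

/-- The Leibniz formula for the operator `f ↦ δ_J(a f)`, at the level of symbols. -/
theorem iter_frameNabla_smul (hd : ∀ i j a, d i (d j a) = d j (d i a))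
    (hz : ∀ i l k, frame d z i (z k l) = frame d z l (z k i)) (J : Multiset (Fin n)) (a : A)
    (p : Symbol n A) :
    iter (frameNabla d z) J (a • p) =
      (J.antidiagonal.map fun q =>
        iter (ends (frame d z)) q.2 a • iter (frameNabla d z) q.1 p).sum := by
  induction J using Multiset.induction_on with
  | empty => simp
  | cons i J ih =>
    rw [iter_cons (commute_frameNabla hd hz), Module.End.mul_apply, ih, map_multiset_sum,
      Multiset.antidiagonal_cons, Multiset.map_add, Multiset.sum_add, Multiset.map_map,
      Multiset.map_map, Multiset.map_map, ← Multiset.sum_map_add]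
    refine congrArg _ (Multiset.map_congr rfl fun q _ => ?_)
    simp only [Function.comp_apply, Prod.map_fst, Prod.map_snd, id_eq,
      iter_cons (commute_ends (frame_comm hd hz)), iter_cons (commute_frameNabla hd hz),
      Module.End.mul_apply, frameNabla_smul, ends_apply]

/-- The substitution of `-ξ_j` for `ξ_j`. -/
def flip : Symbol n A →ₗ[A] Symbol n A :=
  Finsupp.lsum A fun J => ((-1 : A) ^ J.card) • Finsupp.lsingle J

theorem flip_single (J : Multiset (Fin n)) (a : A) :
    flip (Finsupp.single J a) = Finsupp.single J ((-1) ^ J.card * a) := by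
  simp [flip]

theorem flip_apply (p : Symbol n A) (J : Multiset (Fin n)) :
    flip p J = (-1) ^ J.card * p J := by
  classical
  induction p using Finsupp.induction_linear with
  | zero => simp
  | add p q hp hq => simp [hp, hq, mul_add]
  | single K a =>
    rw [flip_single, Finsupp.single_apply, Finsupp.single_apply]
    split_ifs with h
    · rw [h]
    · rw [mul_zero]

theorem flip_shiftEnd (i : Fin n) (p : Symbol n A) :
    flip (shiftEnd i p) = -shiftEnd i (flip p) := by
  induction p using Finsupp.induction_linear with
  | zero => simp
  | add p q hp hq => simp only [map_add, hp, hq]; abel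
  | single K a =>
    rw [shiftEnd_single, flip_single, flip_single, shiftEnd_single, Multiset.card_cons,
      ← Finsupp.single_neg, pow_succ]
    congr 1
    ring

/-- Integration by parts for the frame `z^j_i d_j` with the density `D`. -/
theorem transpose_smul_iter_frameNabla (hd : ∀ i j a, d i (d j a) = d j (d i a))
    (hz : ∀ i l k, frame d z i (z k l) = frame d z l (z k i)) (D : A)
    (hD : ∀ i, ∑ j, d j (D * z j i) = 0) (J : Multiset (Fin n)) (b : A) :
    transpose d ((D * b) • iter (frameNabla d z) J (Finsupp.single 0 1)) =
      (-1 : A) ^ J.card • D • flip (iter (frameNabla d z) J (Finsupp.single 0 b)) := by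
  induction J using Multiset.induction_on generalizing b with
  | empty =>
    rw [iter_zero, Module.End.one_apply, Module.End.one_apply, Finsupp.smul_single,
      transpose_single_zero, flip_single, Multiset.card_zero, pow_zero, one_mul, one_smul,
      Finsupp.smul_single, smul_eq_mul, smul_eq_mul, mul_one]
  | cons i J ih =>
    have hcomm := commute_frameNabla hd hz
    -- By `hD` the density with the frame is divergence free, so only the derivative of `b`
    -- survives.
    have hD' : ∑ j, d j (D * (z j i * b)) = D * frame d z i b := by
      have : ∀ j, d j (D * (z j i * b)) = b * d j (D * z j i) + D * (z j i * d j b) := by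
        intro j
        rw [← mul_assoc, Derivation.leibniz, smul_eq_mul, smul_eq_mul]
        ring
      simp_rw [this, Finset.sum_add_distrib, ← Finset.mul_sum, hD, mul_zero, zero_add, frame_apply]
    set q := iter (frameNabla d z) J (Finsupp.single 0 1) with hq
    -- The outermost `δ_i` is replaced by a divergence minus a correction in which `δ_i b` takes the
    -- place of `b`. Only `J` is left in both terms, so the induction hypothesis applies to them
    -- with the coefficients `z j i * b` and `δ_i b`.
    have h1 : (D * b) • frameNabla d z i q =
        ∑ j, nabla d j ((D * (z j i * b)) • q) - (D * frame d z i b) • q := by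
      rw [← hD', Finset.sum_smul, ← Finset.sum_sub_distrib, frameNabla_apply, Finset.smul_sum]
      refine Finset.sum_congr rfl fun j _ => ?_
      rw [nabla_smul, add_sub_cancel_left, smul_smul]
      congr 1
      ring
    -- On the other side `δ_i` is moved innermost, where it acts on `b`. The same two kinds of terms
    -- arise, and `flip` supplies the relative sign of the one with `ξ_j`.
    have h2 : iter (frameNabla d z) (i ::ₘ J) (Finsupp.single 0 b) =
        iter (frameNabla d z) J (Finsupp.single 0 (frame d z i b)) +
          ∑ j, shiftEnd j (iter (frameNabla d z) J (Finsupp.single 0 (z j i * b))) := by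
      rw [iter_cons hcomm, (commute_iter (hcomm i) J).eq, Module.End.mul_apply,
        frameNabla_single, map_add, map_sum]
      congr 1
      refine Finset.sum_congr rfl fun j _ => ?_
      rw [← shiftEnd_single]
      exact (LinearMap.congr_fun
        (commute_iter (fun k => commute_shiftEnd_frameNabla (d := d) (z := z) k j) J) _).symm
    rw [h2, iter_cons hcomm, Module.End.mul_apply, h1, map_sub, map_sum]
    simp_rw [transpose_nabla hd, ih, map_add, map_sum, flip_shiftEnd]
    simp only [shiftEnd_smul, Multiset.card_cons, pow_succ, Finset.sum_neg_distrib,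
      ← Finset.smul_sum, shiftEnd_smul, smul_add, smul_neg, mul_neg, mul_one, neg_smul, neg_neg]
    abel

/-- The Lie–Euler sums of a density that is expressed by means of the frame. -/
theorem transpose_sum_frameNabla (hd : ∀ i j a, d i (d j a) = d j (d i a))
    (hz : ∀ i l k, frame d z i (z k l) = frame d z l (z k i)) (D : A)
    (hD : ∀ i, ∑ j, d j (D * z j i) = 0) (r : ℕ) (b : Multiset (Fin n) → A) :
    transpose d (∑ J : MultiIndex n r,
        (D * b J.1) • iter (frameNabla d z) J.1 (Finsupp.single 0 1)) =
      ∑ q ∈ Finset.range (r + 1), ∑ I : Fin q → Fin n,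
        lieSum (ends (frame d z)) r (fun J => weight J • b J) (ms I) •
          (-1 : A) ^ q • D • flip (iter (frameNabla d z) (ms I) (Finsupp.single 0 1)) := by
  have h := sum_lieSum_smul (ends (frame d z)) r (fun J => weight J • b J) fun J =>
    (-1 : A) ^ J.card • D • flip (iter (frameNabla d z) J (Finsupp.single 0 (1 : A)))
  simp only [ms_card] at h
  rw [← h, sum_multiIndex_eq r fun J =>
    (D * b J) • iter (frameNabla d z) J (Finsupp.single 0 (1 : A)), map_sum]
  refine Finset.sum_congr rfl fun N _ => ?_
  rw [map_sum]
  refine Finset.sum_congr rfl fun t _ => ?_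
  have hb : (Finsupp.single 0 (weight (ms t) • b (ms t)) : Symbol n A) =
      (weight (ms t) • b (ms t)) • Finsupp.single 0 (1 : A) := by
    rw [Finsupp.smul_single, smul_eq_mul, mul_one]
  -- Integration by parts yields the operator `f ↦ δ_J(b^J f)`; its Leibniz expansion over the
  -- splittings of `J` agrees term by term with the sum that `h` has put on the right.
  rw [← smul_assoc, ← mul_smul_comm, transpose_smul_iter_frameNabla hd hz D hD, hb,
    iter_frameNabla_smul hd hz, map_multiset_sum, Multiset.smul_sum, Multiset.smul_sum,
    Multiset.map_map, Multiset.map_map, Multiset.map_map]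
  refine congrArg _ (Multiset.map_congr rfl fun p hp => ?_)
  have hN : (ms t).card = p.1.card + p.2.card := by
    rw [← Multiset.card_add, Multiset.mem_antidiagonal.1 hp]
  have hs : ∀ (k : ℕ) (m : A), (-1 : ℝ) ^ k • m = (-1 : A) ^ k * m := by
    intro k m
    rw [Algebra.smul_def, map_pow, map_neg, map_one]
  simp only [Function.comp_apply, map_smul, hs, hN, smul_smul, pow_add]
  congr 1
  ring

end Frames

/-! ### The formula of Faà di Bruno -/

section FaaDiBruno

variable {n : ℕ} {A : Type*} [CommRing A] [Algebra ℝ A] {M : Type*} [AddCommGroup M] [Module A M]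

/-- `∑_p ∑_{(I₁,…,I_p)} b^{j₁}_{I₁} ⋯ b^{j_p}_{I_p} a_{j₁⋯j_p}`. -/
def partitionSum (b : Fin n → Multiset (Fin n) → A) (a : Multiset (Fin n) → M) {q : ℕ}
    (I : Fin q → Fin n) : M :=
  ∑ c : OrderedFinpartition q, ∑ j : Fin c.length → Fin n,
    (∏ l, b (j l) (ms (I ∘ c.emb l))) • a (ms j)

theorem partitionSum_zero (b : Fin n → Multiset (Fin n) → A) (a : Multiset (Fin n) → M)
    (I : Fin 0 → Fin n) : partitionSum b a I = a 0 := by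
  unfold partitionSum
  rw [Fintype.sum_unique]
  change ∑ j : Fin 0 → Fin n, (∏ l : Fin 0, _) • a (ms j) = a 0
  simp

theorem partitionSum_one (b : Fin n → Multiset (Fin n) → A) (a : Multiset (Fin n) → M)
    (I : Fin 1 → Fin n) : partitionSum b a I = ∑ l, b l {I 0} • a {l} := by
  unfold partitionSum
  rw [Fintype.sum_unique]
  change ∑ j : Fin 1 → Fin n, (∏ l : Fin 1, b (j l) (ms (fun _ : Fin 1 => I l))) • a (ms j) = _
  rw [sum_cons]
  refine Finset.sum_congr rfl fun l _ => ?_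
  simp [ms]

theorem derivation_prod {ι : Type*} [DecidableEq ι] (D : Derivation ℝ A A) (t : Finset ι)
    (f : ι → A) : D (∏ i ∈ t, f i) = ∑ k ∈ t, ∏ i ∈ t, if i = k then D (f i) else f i := by
  induction t using Finset.induction_on with
  | empty => simp
  | insert a t ha ih =>
    rw [Finset.prod_insert ha, Derivation.leibniz, ih, Finset.sum_insert ha, Finset.prod_insert ha,
      if_pos rfl, smul_eq_mul, smul_eq_mul, Finset.mul_sum, add_comm]
    congr 1
    · rw [mul_comm]
      congr 1
      refine Finset.prod_congr rfl fun i hi => ?_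
      rw [if_neg]
      rintro rfl
      exact ha hi
    · refine Finset.sum_congr rfl fun k hk => ?_
      rw [Finset.prod_insert ha, if_neg]
      rintro rfl
      exact ha hk

/-- A partition of `q + 1` positions restricts to a unique partition of the last `q`: position `0`
is either a block by itself or has been added to one of the old blocks. The two summands correspond
to these cases of `OrderedFinpartition.extendEquiv`. -/
theorem partitionSum_cons (b : Fin n → Multiset (Fin n) → A) (a : Multiset (Fin n) → M) {q : ℕ}
    (i : Fin n) (I : Fin q → Fin n) :
    partitionSum b a (Fin.cons i I : Fin (q + 1) → Fin n) =
      ∑ c : OrderedFinpartition q, ∑ j : Fin c.length → Fin n,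
        ((∏ l, b (j l) (ms (I ∘ c.emb l))) • ∑ l, b l {i} • a (l ::ₘ ms j) +
          (∑ k, ∏ l, b (j l) (if l = k then i ::ₘ ms (I ∘ c.emb l) else ms (I ∘ c.emb l))) •
            a (ms j)) := by
  unfold partitionSum
  rw [← (OrderedFinpartition.extendEquiv q).sum_comp, Fintype.sum_sigma]
  refine Finset.sum_congr rfl fun c _ => ?_
  rw [Fintype.sum_option, Finset.sum_add_distrib]
  congr 1
  · change ∑ j : Fin (c.length + 1) → Fin n, (∏ l : Fin (c.length + 1), b (j l)
      (ms ((Fin.cons i I : Fin (q + 1) → Fin n) ∘ c.extendLeft.emb l))) • a (ms j) = _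
    rw [sum_cons, Finset.sum_comm]
    refine Finset.sum_congr rfl fun j _ => ?_
    rw [Finset.smul_sum]
    refine Finset.sum_congr rfl fun l _ => ?_
    rw [Fin.prod_univ_succ, ms_cons, smul_smul, mul_comm]
    congr 2
  · simp_rw [Finset.sum_smul]
    rw [Finset.sum_comm]
    refine Finset.sum_congr rfl fun k _ =>
      Finset.sum_congr rfl fun (j : Fin c.length → Fin n) _ => ?_
    change (∏ l : Fin c.length, b (j l)
      (ms ((Fin.cons i I : Fin (q + 1) → Fin n) ∘ (c.extendMiddle k).emb l))) • a (ms j) = _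
    congr 1
    refine Finset.prod_congr rfl fun l _ => ?_
    congr 1
    by_cases hl : l = k
    · subst hl
      rw [if_pos rfl]
      have h1 : (c.extendMiddle l).partSize l = c.partSize l + 1 := by
        simp [OrderedFinpartition.extendMiddle_partSize]
      -- The enlarged block consists of the new position followed by the old block. The block sizes
      -- are transported along `h1` by `finCongr`, which does not affect `ms`.
      have h2 : (Fin.cons i I : Fin (q + 1) → Fin n) ∘ (c.extendMiddle l).emb l =
          (Fin.cons i (I ∘ c.emb l) : Fin (c.partSize l + 1) → Fin n) ∘ finCongr h1 := by
        funext t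
        obtain ⟨t, rfl⟩ := (finCongr h1).symm.surjective t
        simp only [Function.comp_apply, Equiv.apply_symm_apply]
        refine Fin.cases ?_ (fun t => ?_) t <;>
          · simp only [OrderedFinpartition.extendMiddle, dite_true]
            rfl
      rw [h2, ms_comp_equiv, ms_cons]
    · rw [if_neg hl]
      have h1 : (c.extendMiddle k).partSize l = c.partSize l := by
        simp [OrderedFinpartition.extendMiddle_partSize, hl]
      have h2 : (Fin.cons i I : Fin (q + 1) → Fin n) ∘ (c.extendMiddle k).emb l =
          (I ∘ c.emb l) ∘ finCongr h1 := by
        funext t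
        simp only [OrderedFinpartition.extendMiddle, hl, dite_false]
        rfl
      rw [h2, ms_comp_equiv]

/-- Differentiation of a partition sum adds an index. -/
theorem partitionSum_cons_eq (b : Fin n → Multiset (Fin n) → A) (a : Multiset (Fin n) → M)
    (i : Fin n) (D : Derivation ℝ A A) (E : M →+ M)
    (hE : ∀ (f : A) (m : M), E (f • m) = D f • m + f • E m)
    (hb : ∀ j J, J ≠ 0 → D (b j J) = b j (i ::ₘ J))
    {q : ℕ} (ha : ∀ J, (0 < q → J ≠ 0) → E (a J) = ∑ l, b l {i} • a (l ::ₘ J))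
    (I : Fin q → Fin n) :
    partitionSum b a (Fin.cons i I : Fin (q + 1) → Fin n) = E (partitionSum b a I) := by
  rw [partitionSum_cons]
  unfold partitionSum
  simp_rw [map_sum]
  refine Finset.sum_congr rfl fun c _ => Finset.sum_congr rfl fun j _ => ?_
  -- The coefficient `a 0` occurs only for the empty sequence, so for `q > 0` the rule for `E (a J)`
  -- is needed at nonempty `J` alone.
  have hj : 0 < q → ms j ≠ 0 := by
    intro hq h0
    have := congrArg Multiset.card h0
    rw [ms_card, Multiset.card_zero] at this
    exact absurd this (c.length_pos hq).ne'
  rw [hE, ha _ hj, derivation_prod, add_comm]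
  congr 2
  refine Finset.sum_congr rfl fun k _ => Finset.prod_congr rfl fun l _ => ?_
  split_ifs with h
  · rw [hb]
    intro h0
    have := congrArg Multiset.card h0
    rw [ms_card, Multiset.card_zero] at this
    exact absurd this (c.partSize_pos l).ne'
  · rfl

theorem groupMul_eq_partitionSum (a b : Fin n → Multiset (Fin n) → ℝ) (i : Fin n) {q : ℕ}
    (I : Fin q → Fin n) : groupMul a b i I = partitionSum b (a i) I := rfl

/-- The coefficients of the partition sum of a basis are the symmetrized partition sums. -/
theorem zSum_eq (z : Fin n → Multiset (Fin n) → A) (ev : A →ₐ[ℝ] ℝ) {k q : ℕ} (j : Fin k → Fin n)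
    (I : Fin q → Fin n) :
    weight (ms j) * ev (partitionSum z (fun J => (Finsupp.single J 1 : Symbol n A)) I (ms j)) =
      zSum (fun i J => ev (z i J)) j I := by
  unfold partitionSum zSum
  simp only [Finsupp.finsetSum_apply, Finsupp.smul_apply, smul_eq_mul, Finsupp.single_apply,
    mul_ite, mul_one, mul_zero, map_sum]
  rw [Finset.mul_sum]
  refine Finset.sum_congr rfl fun c _ => ?_
  split_ifs with h
  · subst h
    -- The coefficient of `ξ_J` collects all sequences `t` with the multi-index of `j`; weighted,
    -- this is the mean over the permutations of `j`, which is `𝓢⁺`.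
    have := weight_smul_sum_ite_eq_sum_perm j fun t => ∏ l, ev (z (t l) (ms (I ∘ c.emb l)))
    simp only [smul_eq_mul] at this
    simp only [Fin.cast_eq_self]
    refine Eq.trans ?_ this
    congr 1
    refine Finset.sum_congr rfl fun t _ => ?_
    split_ifs <;> simp
  · rw [Finset.sum_eq_zero, mul_zero]
    intro t _
    rw [if_neg, map_zero]
    intro ht
    have := congrArg Multiset.card ht
    rw [ms_card, ms_card] at this
    exact h this

theorem zSum_eq_zero (z : Fin n → Multiset (Fin n) → ℝ) {k q : ℕ} (hq : q < k) (j : Fin k → Fin n)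
    (I : Fin q → Fin n) : zSum z j I = 0 := by
  unfold zSum
  refine Finset.sum_eq_zero fun c _ => ?_
  rw [dif_neg]
  intro h
  have := c.length_le
  omega

end FaaDiBruno

/-! ### Derivations of inverse matrices and of determinants -/

section MatrixDerivations

variable {n : ℕ} {A : Type*} [CommRing A] [Algebra ℝ A]

/-- Differentiation of `x z = 1` gives `D z = -z (D x) z`. Values in a module are allowed so that
the formula applies to the symbol-valued variations too. -/
theorem derivation_inverse {M : Type*} [AddCommGroup M] [Module A M] [Module ℝ M]
    (D : Derivation ℝ A M) (x z : Matrix (Fin n) (Fin n) A) (h : z * x = 1) (k l : Fin n) :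
    D (z k l) = -∑ a, ∑ b, (z k a * z b l) • D (x a b) := by
  have h' : x * z = 1 := mul_eq_one_comm.1 h
  have h1 : ∀ a, ∑ b, x a b • D (z b l) = -∑ b, z b l • D (x a b) := by
    intro a
    have h2 : D ((x * z) a l) = 0 := by
      rw [h', Matrix.one_apply]
      split_ifs <;> simp
    rw [Matrix.mul_apply, map_sum] at h2
    simp only [Derivation.leibniz, Finset.sum_add_distrib] at h2
    exact eq_neg_of_add_eq_zero_left h2
  have h3 : D (z k l) = ∑ b, (z * x) k b • D (z b l) := by
    rw [h]
    simp [Matrix.one_apply, ite_smul]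
  rw [h3]
  simp_rw [Matrix.mul_apply, Finset.sum_smul]
  rw [Finset.sum_comm, ← Finset.sum_neg_distrib]
  refine Finset.sum_congr rfl fun a _ => ?_
  simp_rw [mul_smul, ← Finset.smul_sum, h1, smul_neg]

/-- Jacobi's formula, with the adjugate written as `det x • z`. Expanding the Leibniz formula
differentiates one column at a time, and Cramer's rule evaluates each resulting determinant. -/
theorem derivation_det (D : Derivation ℝ A A) (x z : Matrix (Fin n) (Fin n) A) (h : z * x = 1) :
    D x.det = ∑ a, ∑ b, (x.det * z b a) * D (x a b) := by
  have hadj : x.adjugate = x.det • z := by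
    calc x.adjugate = z * x * x.adjugate := by rw [h, one_mul]
      _ = x.det • z := by rw [mul_assoc, Matrix.mul_adjugate, Matrix.mul_smul, mul_one]
  have h1 : D x.det = ∑ k, (x.updateCol k fun a => D (x a k)).det := by
    simp_rw [Matrix.det_apply]
    rw [map_sum, Finset.sum_comm]
    refine Finset.sum_congr rfl fun σ _ => ?_
    have hs : ∀ p : A, D (Equiv.Perm.sign σ • p) = Equiv.Perm.sign σ • D p := by
      intro p
      rcases Int.units_eq_one_or (Equiv.Perm.sign σ) with h | h <;> simp [h]
    rw [← Finset.smul_sum, hs, derivation_prod]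
    refine congrArg _ (Finset.sum_congr rfl fun k _ => Finset.prod_congr rfl fun i _ => ?_)
    rw [Matrix.updateCol_apply]
    split_ifs with hi
    · rw [hi]
    · rfl
  rw [h1, Finset.sum_comm]
  refine Finset.sum_congr rfl fun k _ => ?_
  rw [← Matrix.cramer_apply, Matrix.cramer_eq_adjugate_mulVec, hadj]
  simp [Matrix.mulVec, dotProduct]

/-- Each coefficient of a symbol-valued derivation is a scalar derivation, to which Jacobi's formula
applies. -/
theorem symbol_derivation_det (D : Derivation ℝ A (Symbol n A)) (x z : Matrix (Fin n) (Fin n) A)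
    (h : z * x = 1) : D x.det = ∑ a, ∑ b, (x.det * z b a) • D (x a b) := by
  ext J
  have := derivation_det ((Finsupp.lapply (R := A) J).compDer D) x z h
  simpa [Finsupp.finsetSum_apply] using this

end MatrixDerivations

/-! ### Algebras of functions of the coordinates of velocities -/

section VelocityAlgebras

/-- An algebra with elements `x^A_J`, `|J| ≤ s`, and with commuting derivations `∂/∂x^A_J`. -/
structure VelocityAlgebra (n N s : ℕ) (A : Type*) [CommRing A] [Algebra ℝ A] where
  coord : Fin N → Multiset (Fin n) → A
  pd : Fin N → Multiset (Fin n) → Derivation ℝ A A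
  coord_eq_zero : ∀ a J, s < J.card → coord a J = 0
  pd_eq_zero : ∀ a J, s < J.card → pd a J = 0
  pd_coord : ∀ a b J K, J.card ≤ s → pd a J (coord b K) = if a = b ∧ J = K then 1 else 0
  pd_comm : ∀ a b J K f, pd a J (pd b K f) = pd b K (pd a J f)

namespace VelocityAlgebra

variable {n N s : ℕ} {A : Type*} [CommRing A] [Algebra ℝ A] (V : VelocityAlgebra n N s A)

/-- The formal derivative. -/
def d (i : Fin n) : Derivation ℝ A A :=
  ∑ a, ∑ J : MultiIndex n s, V.coord a (i ::ₘ J.1) • V.pd a J.1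

theorem d_apply (i : Fin n) (f : A) :
    V.d i f = ∑ a, ∑ J : MultiIndex n s, V.coord a (i ::ₘ J.1) * V.pd a J.1 f := by
  simp [d, derivation_sum_apply]

/-- Because coordinates of order above `s` are zero, the rule holds for all `J` without a bound: at
the top order both sides vanish. -/
theorem d_coord (i : Fin n) (a : Fin N) (J : Multiset (Fin n)) :
    V.d i (V.coord a J) = V.coord a (i ::ₘ J) := by
  by_cases hJ : J.card ≤ s
  · rw [d_apply, Finset.sum_eq_single a, Finset.sum_eq_single (⟨J, hJ⟩ : MultiIndex n s)]
    · rw [V.pd_coord a a J J hJ]; simp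
    · intro K _ hK
      rw [V.pd_coord _ _ _ _ K.2, if_neg, mul_zero]
      rintro ⟨-, h⟩
      exact hK (Subtype.ext h)
    · simp
    · intro b _ hb
      refine Finset.sum_eq_zero fun K _ => ?_
      rw [V.pd_coord _ _ _ _ K.2, if_neg, mul_zero]
      rintro ⟨h, -⟩
      exact hb h
    · simp
  · rw [V.coord_eq_zero a J (not_le.1 hJ), map_zero, V.coord_eq_zero]
    rw [Multiset.card_cons]
    omega

/-- The truncated formal derivatives commute exactly. The first-order coefficients of `d_i d_j` are
`x^A_{ijJ}`, symmetric in `i` and `j` and zero above order `s`; the second-order part is symmetric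
since partial derivatives commute. -/
theorem d_comm (i j : Fin n) (f : A) : V.d i (V.d j f) = V.d j (V.d i f) := by
  have h : ∀ i j, V.d i (V.d j f) =
      ∑ a, ∑ J : MultiIndex n s, V.coord a (i ::ₘ j ::ₘ J.1) * V.pd a J.1 f +
        ∑ a, ∑ J : MultiIndex n s, ∑ b, ∑ K : MultiIndex n s,
          V.coord a (j ::ₘ J.1) * (V.coord b (i ::ₘ K.1) * V.pd b K.1 (V.pd a J.1 f)) := by
    intro i j
    rw [V.d_apply j, map_sum, ← Finset.sum_add_distrib]
    refine Finset.sum_congr rfl fun a _ => ?_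
    rw [map_sum, ← Finset.sum_add_distrib]
    refine Finset.sum_congr rfl fun J _ => ?_
    rw [Derivation.leibniz, smul_eq_mul, smul_eq_mul, d_coord, V.d_apply i (V.pd a J.1 f),
      Finset.mul_sum, add_comm, mul_comm]
    simp_rw [Finset.mul_sum]
  rw [h i j, h j i]
  congr 1
  · simp_rw [Multiset.cons_swap i j]
  · simp_rw [Finset.sum_comm (s := (Finset.univ : Finset (MultiIndex n s)))
      (t := (Finset.univ : Finset (Fin N)))]
    rw [Finset.sum_comm]
    refine Finset.sum_congr rfl fun b _ => Finset.sum_congr rfl fun a _ => ?_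
    rw [Finset.sum_comm]
    refine Finset.sum_congr rfl fun K _ => Finset.sum_congr rfl fun J _ => ?_
    rw [V.pd_comm]
    ring

/-- The commutator of `∂/∂x^A_J` with `d_i` comes from differentiating the coefficient `x^A_{iK}`,
which depends on `x^A_J` exactly when `J` is `K` with `i` added. -/
theorem pd_d (a : Fin N) (J : Multiset (Fin n)) (hJ : J.card ≤ s) (i : Fin n) (f : A) :
    V.pd a J (V.d i f) = V.d i (V.pd a J f) + if i ∈ J then V.pd a (J.erase i) f else 0 := by
  rw [V.d_apply i f, V.d_apply i (V.pd a J f), map_sum]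
  simp_rw [map_sum, Derivation.leibniz, smul_eq_mul, Finset.sum_add_distrib]
  congr 1
  · refine Finset.sum_congr rfl fun b _ => Finset.sum_congr rfl fun K _ => ?_
    rw [V.pd_comm]
  · simp_rw [V.pd_coord _ _ _ _ hJ]
    split_ifs with hi
    · have hc : (J.erase i).card ≤ s := by
        rw [Multiset.card_erase_of_mem hi]
        exact (Nat.pred_le _).trans hJ
      rw [Finset.sum_eq_single a, Finset.sum_eq_single (⟨J.erase i, hc⟩ : MultiIndex n s)]
      · rw [if_pos ⟨rfl, (Multiset.cons_erase hi).symm⟩, mul_one]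
      · intro K _ hK
        rw [if_neg, mul_zero]
        rintro ⟨-, rfl⟩
        exact hK (Subtype.ext (by simp))
      · simp
      · intro b _ hb
        refine Finset.sum_eq_zero fun K _ => ?_
        rw [if_neg, mul_zero]
        rintro ⟨rfl, -⟩
        exact hb rfl
      · simp
    · refine Finset.sum_eq_zero fun b _ => Finset.sum_eq_zero fun K _ => ?_
      rw [if_neg, mul_zero]
      rintro ⟨-, rfl⟩
      exact hi (Multiset.mem_cons_self _ _)

/-- The function does not depend on the coordinates of order higher than `k`. -/
def HasOrder (k : ℕ) (f : A) : Prop := ∀ a J, k < J.card → V.pd a J f = 0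

variable {V}

theorem HasOrder.mono {k l : ℕ} {f : A} (h : V.HasOrder k f) (hkl : k ≤ l) : V.HasOrder l f :=
  fun a J hJ => h a J (hkl.trans_lt hJ)

theorem HasOrder.mul {k : ℕ} {f g : A} (hf : V.HasOrder k f) (hg : V.HasOrder k g) :
    V.HasOrder k (f * g) := fun a J hJ => by
  rw [Derivation.leibniz, hf a J hJ, hg a J hJ, smul_zero, smul_zero, add_zero]

theorem HasOrder.sum {ι : Type*} {t : Finset ι} {k : ℕ} {f : ι → A}
    (hf : ∀ i ∈ t, V.HasOrder k (f i)) : V.HasOrder k (∑ i ∈ t, f i) := fun a J hJ => by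
  rw [map_sum]
  exact Finset.sum_eq_zero fun i hi => hf i hi a J hJ

theorem hasOrder_coord (a : Fin N) (J : Multiset (Fin n)) : V.HasOrder J.card (V.coord a J) :=
  fun b K hK => by
    by_cases h : K.card ≤ s
    · rw [V.pd_coord _ _ _ _ h, if_neg]
      rintro ⟨-, rfl⟩
      exact lt_irrefl _ hK
    · rw [V.pd_eq_zero _ _ (not_le.1 h)]
      rfl

theorem HasOrder.d {k : ℕ} {f : A} (hf : V.HasOrder k f) (i : Fin n) :
    V.HasOrder (k + 1) (V.d i f) := fun a J hJ => by
  by_cases h : J.card ≤ s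
  · rw [V.pd_d _ _ h, hf a J (by omega), map_zero, zero_add]
    split_ifs with hi
    · refine hf a _ ?_
      rw [Multiset.card_erase_of_mem hi]
      exact Nat.lt_pred_of_succ_lt hJ
    · rfl
  · rw [V.pd_eq_zero _ _ (not_le.1 h)]
    rfl

variable (V)

/-- The derivation `∑ ∂/∂x^A_J ⊗ (d + ξ)_J Q^A`: the prolongation of the evolutionary vector field
with the characteristic `Q e^{ξ t}`. -/
def variation (Q : Fin N → A) : Derivation ℝ A (Symbol n A) :=
  ∑ a, ∑ J : MultiIndex n s,
    (LinearMap.toSpanSingleton A (Symbol n A)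
      (iter (nabla V.d) J.1 (Finsupp.single 0 (Q a)))).compDer (V.pd a J.1)

theorem variation_apply (Q : Fin N → A) (f : A) :
    V.variation Q f = ∑ a, ∑ J : MultiIndex n s,
      V.pd a J.1 f • iter (nabla V.d) J.1 (Finsupp.single 0 (Q a)) := by
  simp [variation, derivation_sum_apply]

theorem variation_coord (Q : Fin N → A) (a : Fin N) (J : Multiset (Fin n)) (hJ : J.card ≤ s) :
    V.variation Q (V.coord a J) = iter (nabla V.d) J (Finsupp.single 0 (Q a)) := by
  rw [variation_apply, Finset.sum_eq_single a, Finset.sum_eq_single (⟨J, hJ⟩ : MultiIndex n s)]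
  · rw [V.pd_coord a a J J hJ]; simp
  · intro K _ hK
    rw [V.pd_coord _ _ _ _ K.2, if_neg, zero_smul]
    rintro ⟨-, h⟩
    exact hK (Subtype.ext h)
  · simp
  · intro b _ hb
    refine Finset.sum_eq_zero fun K _ => ?_
    rw [V.pd_coord _ _ _ _ K.2, if_neg, zero_smul]
    rintro ⟨h, -⟩
    exact hb h
  · simp

end VelocityAlgebra

/-- Adding `i` is a bijection from the support of `g` onto the support of the left side; `k + 1 ≤ s`
keeps it within the range of summation. -/
theorem sum_multiIndex_erase {n s k : ℕ} {M : Type*} [AddCommMonoid M] (hk : k + 1 ≤ s)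
    (g : Multiset (Fin n) → M) (hg : ∀ J, k < J.card → g J = 0) (i : Fin n) :
    ∑ J : MultiIndex n s, (if i ∈ J.1 then g (J.1.erase i) else 0) =
      ∑ J : MultiIndex n s, g J.1 := by
  symm
  have hcard : ∀ J : MultiIndex n s, g J.1 ≠ 0 → (i ::ₘ J.1).card ≤ s := by
    intro J hJ
    rw [Multiset.card_cons]
    by_contra h
    exact hJ (hg _ (by omega))
  refine Finset.sum_bij_ne_zero
    (fun J _ h => (⟨i ::ₘ J.1, hcard J h⟩ : MultiIndex n s)) (fun _ _ _ => Finset.mem_univ _)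
    ?_ ?_ ?_
  · intro J _ _ K _ _ h
    exact Subtype.ext (Multiset.cons_inj_right i |>.1 (congrArg Subtype.val h))
  · intro J _ hJ
    by_cases hi : i ∈ J.1
    · rw [if_pos hi] at hJ
      refine ⟨⟨J.1.erase i, (Multiset.card_le_card (Multiset.erase_le _ _)).trans J.2⟩,
        Finset.mem_univ _, hJ, ?_⟩
      exact Subtype.ext (Multiset.cons_erase hi)
    · rw [if_neg hi] at hJ
      exact absurd rfl hJ
  · intro J _ _
    simp

theorem sum_multiIndex_of_le {n r s : ℕ} {M : Type*} [AddCommGroup M] [Module ℝ M] (hrs : r ≤ s)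
    (g : Multiset (Fin n) → M) (hg : ∀ J, r < J.card → g J = 0) :
    ∑ J : MultiIndex n s, g J.1 = ∑ J : MultiIndex n r, g J.1 := by
  rw [sum_multiIndex_eq, sum_multiIndex_eq]
  symm
  refine Finset.sum_subset (Finset.range_mono (by omega)) fun k _ hk => ?_
  refine Finset.sum_eq_zero fun j _ => ?_
  rw [hg, smul_zero]
  rw [ms_card]
  simpa [Nat.lt_succ_iff] using hk

namespace VelocityAlgebra

variable {n N s : ℕ} {A : Type*} [CommRing A] [Algebra ℝ A] (V : VelocityAlgebra n N s A)

/-- A prolonged evolutionary field commutes with total derivatives; the factor `e^{ξt}` in the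
characteristic turns `d_i` into `d_i + ξ_i`. The commutator term of `pd_d` supplies the derivative
of the characteristic, and the bound on the order excludes the effect of truncation at `s`. -/
theorem variation_d (Q : Fin N → A) {k : ℕ} (hk : k + 1 ≤ s) {f : A} (hf : V.HasOrder k f)
    (i : Fin n) : V.variation Q (V.d i f) = nabla V.d i (V.variation Q f) := by
  rw [variation_apply, variation_apply, map_sum]
  refine Finset.sum_congr rfl fun a _ => ?_
  rw [map_sum]
  simp_rw [nabla_smul]
  have h : ∀ J : MultiIndex n s,
      V.pd a J.1 (V.d i f) • iter (nabla V.d) J.1 (Finsupp.single 0 (Q a)) =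
        V.d i (V.pd a J.1 f) • iter (nabla V.d) J.1 (Finsupp.single 0 (Q a)) +
          if i ∈ J.1 then V.pd a (J.1.erase i) f •
            nabla V.d i (iter (nabla V.d) (J.1.erase i) (Finsupp.single 0 (Q a))) else 0 := by
    intro J
    rw [V.pd_d _ _ J.2, add_smul]
    congr 1
    split_ifs with hi
    · rw [← Module.End.mul_apply, ← iter_cons (commute_nabla V.d_comm), Multiset.cons_erase hi]
    · rw [zero_smul]
  simp_rw [h, Finset.sum_add_distrib]
  congr 1
  exact sum_multiIndex_erase hk (fun J => V.pd a J f •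
    nabla V.d i (iter (nabla V.d) J (Finsupp.single 0 (Q a))))
    (fun J hJ => by rw [hf a J hJ, zero_smul]) i

/-- The symbol `∑ ∂f/∂x^A_J ξ_J`. -/
def symbol (a : Fin N) (f : A) : Symbol n A :=
  ∑ J : MultiIndex n s, Finsupp.single J.1 (V.pd a J.1 f)

/-- The variation is the left symbol of `∑ ∂f/∂x^A_J d_J ∘ Q^A`. When the derivatives are moved to
the left of the coefficients, `Q^A` stays on the right as a plain factor. -/
theorem transpose_variation (Q : Fin N → A) (f : A) :
    transpose V.d (V.variation Q f) = ∑ a, Q a • transpose V.d (V.symbol a f) := by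
  rw [variation_apply, map_sum]
  refine Finset.sum_congr rfl fun a _ => ?_
  rw [map_sum, symbol, map_sum, Finset.smul_sum]
  refine Finset.sum_congr rfl fun J _ => ?_
  rw [transpose_smul_iter_nabla V.d_comm]

theorem lieSum_eq {r : ℕ} (hrs : r ≤ s) (a : Fin N) {f : A} (hf : V.HasOrder r f)
    (K : Multiset (Fin n)) (hK : K.card ≤ r) :
    lieSum (ends V.d) r (fun J => weight J • V.pd a J f) K =
      weight K • transpose V.d (V.symbol a f) K := by
  rw [← weight_smul_transpose_apply V.d_comm r (fun J => V.pd a J f) K hK, symbol,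
    sum_multiIndex_of_le hrs fun J => (Finsupp.single J (V.pd a J f) : Symbol n A)]
  intro J hJ
  rw [hf a J hJ, Finsupp.single_zero]

end VelocityAlgebra

end VelocityAlgebras

/-! ### Algebras of functions on regular velocities -/

/-- A velocity algebra in which the matrix `(x^i_j)` is invertible. -/
structure RegularAlgebra (n m s : ℕ) (A : Type*) [CommRing A] [Algebra ℝ A] extends
    VelocityAlgebra n (n + m) s A where
  z : Matrix (Fin n) (Fin n) A
  z_mul : z * Matrix.of (fun i j => coord (Fin.castAdd m i) {j}) = 1

namespace RegularAlgebra

variable {n m s : ℕ} {A : Type*} [CommRing A] [Algebra ℝ A] (V : RegularAlgebra n m s A)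

/-- The matrix `(x^i_j)`. -/
def x : Matrix (Fin n) (Fin n) A := Matrix.of fun i j => V.coord (Fin.castAdd m i) {j}

theorem x_apply (i j : Fin n) : V.x i j = V.coord (Fin.castAdd m i) {j} := rfl

theorem z_mul_x : V.z * V.x = 1 := V.z_mul

theorem x_mul_z : V.x * V.z = 1 := mul_eq_one_comm.1 V.z_mul

/-- The derivation `δ_i = z^j_i d_j`. -/
def δ (i : Fin n) : Derivation ℝ A A := frame V.d V.z i

theorem δ_apply (i : Fin n) (f : A) : V.δ i f = ∑ j, V.z j i * V.d j f := frame_apply i f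

theorem δ_z (i l k : Fin n) : V.δ i (V.z k l) =
    -∑ a, ∑ b, ∑ c, V.z k a * V.z b l * V.z c i * V.coord (Fin.castAdd m a) (c ::ₘ {b}) := by
  rw [derivation_inverse (V.δ i) V.x V.z V.z_mul_x]
  congr 1
  refine Finset.sum_congr rfl fun a _ => Finset.sum_congr rfl fun b _ => ?_
  rw [x_apply, δ_apply, smul_eq_mul, Finset.mul_sum]
  refine Finset.sum_congr rfl fun c _ => ?_
  rw [V.d_coord]
  ring

/-- In `δ_i z^k_l = -z^k_a z^b_l z^c_i x^a_{cb}` the second-order coordinates are symmetric in `b`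
and `c`. This is why the frame commutes. -/
theorem δ_z_comm (i l k : Fin n) : V.δ i (V.z k l) = V.δ l (V.z k i) := by
  rw [δ_z, δ_z]
  congr 1
  refine Finset.sum_congr rfl fun a _ => ?_
  rw [Finset.sum_comm]
  refine Finset.sum_congr rfl fun c _ => Finset.sum_congr rfl fun b _ => ?_
  rw [show c ::ₘ ({b} : Multiset (Fin n)) = b ::ₘ {c} from Multiset.cons_swap c b 0]
  ring

theorem δ_comm (i l : Fin n) (f : A) : V.δ i (V.δ l f) = V.δ l (V.δ i f) :=
  frame_comm V.d_comm V.δ_z_comm i l f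

theorem δ_coord (i j : Fin n) :
    V.δ i (V.coord (Fin.castAdd m j) 0) = if j = i then 1 else 0 := by
  have h := congrFun (congrFun V.x_mul_z j) i
  rw [Matrix.mul_apply, Matrix.one_apply] at h
  rw [δ_apply, ← h]
  refine Finset.sum_congr rfl fun k _ => ?_
  rw [V.d_coord, x_apply, mul_comm]
  rfl

/-- The Piola identity. The derivatives of the determinant and of the inverse combine into an
expression antisymmetric in the two lower indices, contracted with the symmetric `x^a_{jb}`. -/
theorem sum_d_det_mul_z (i : Fin n) : ∑ j, V.d j (V.x.det * V.z j i) = 0 := by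
  have h : ∀ j, V.d j (V.x.det * V.z j i) =
      ∑ a, ∑ b, V.x.det * (V.z j i * V.z b a - V.z j a * V.z b i) *
        V.coord (Fin.castAdd m a) (j ::ₘ {b}) := by
    intro j
    rw [Derivation.leibniz, derivation_inverse (V.d j) V.x V.z V.z_mul_x,
      derivation_det (V.d j) V.x V.z V.z_mul_x, smul_eq_mul, smul_eq_mul, mul_neg,
      Finset.mul_sum, Finset.mul_sum, ← Finset.sum_neg_distrib, ← Finset.sum_add_distrib]
    refine Finset.sum_congr rfl fun a _ => ?_
    rw [Finset.mul_sum, Finset.mul_sum, ← Finset.sum_neg_distrib, ← Finset.sum_add_distrib]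
    refine Finset.sum_congr rfl fun b _ => ?_
    rw [x_apply, V.d_coord, smul_eq_mul]
    ring
  simp_rw [h]
  rw [Finset.sum_comm]
  refine Finset.sum_eq_zero fun a _ => ?_
  simp_rw [mul_sub, sub_mul, Finset.sum_sub_distrib]
  rw [sub_eq_zero, Finset.sum_comm]
  refine Finset.sum_congr rfl fun b _ => Finset.sum_congr rfl fun j _ => ?_
  rw [show j ::ₘ ({b} : Multiset (Fin n)) = b ::ₘ {j} from Multiset.cons_swap j b 0]
  ring

/-- The element `z^j_I` of the inverse of the group element `x`, for a nonempty `I`. -/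
def zz (j : Fin n) (I : Multiset (Fin n)) : A :=
  match I.sort (· ≤ ·) with
  | [] => 0
  | i :: l => iter (ends V.δ) l (V.z j i)

/-- The definition of `zz` gives the smallest index the distinguished place; symmetry of `δ_i z^j_k`
in `i` and `k` permits any other choice. -/
theorem zz_cons (j i : Fin n) (I : Multiset (Fin n)) :
    V.zz j (i ::ₘ I) = iter (ends V.δ) I (V.z j i) := by
  have hc := commute_ends V.δ_comm
  unfold zz
  have hI : (((i ::ₘ I).sort (· ≤ ·) : List (Fin n)) : Multiset (Fin n)) = i ::ₘ I :=
    Multiset.sort_eq _ _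
  revert hI
  -- Only the multiset of the list matters from here on, not its order.
  generalize (i ::ₘ I).sort (· ≤ ·) = l
  intro hI
  match l, hI with
  | [], hI => exact absurd hI.symm (Multiset.cons_ne_zero)
  | k :: l, hI =>
    change iter (ends V.δ) l (V.z j k) = _
    rw [← Multiset.cons_coe, Multiset.cons_eq_cons] at hI
    rcases hI with ⟨rfl, rfl⟩ | ⟨-, K, h1, h2⟩
    · rfl
    · rw [h1, h2, iter_cons hc, iter_cons hc, (commute_iter (hc i) K).eq,
        (commute_iter (hc k) K).eq, Module.End.mul_apply, Module.End.mul_apply, ends_apply,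
        ends_apply, δ_z_comm]

theorem zz_singleton (j i : Fin n) : V.zz j {i} = V.z j i := by
  have := V.zz_cons j i 0
  simpa using this

theorem δ_zz (j i : Fin n) (J : Multiset (Fin n)) (hJ : J ≠ 0) :
    V.δ i (V.zz j J) = V.zz j (i ::ₘ J) := by
  obtain ⟨k, hk⟩ := Multiset.exists_mem_of_ne_zero hJ
  obtain ⟨K, rfl⟩ := Multiset.exists_cons_of_mem hk
  rw [Multiset.cons_swap, zz_cons, zz_cons, iter_cons (commute_ends V.δ_comm)]
  rfl

/-- The operator `z^j_i (d_j + ξ_j)`. -/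
def δξ (i : Fin n) : Module.End ℝ (Symbol n A) := frameNabla V.d V.z i

theorem δξ_apply (i : Fin n) (p : Symbol n A) : V.δξ i p = ∑ j, V.z j i • nabla V.d j p :=
  frameNabla_apply i p

theorem δξ_single (i : Fin n) (J : Multiset (Fin n)) (a : A) :
    V.δξ i (Finsupp.single J a) =
      Finsupp.single J (V.δ i a) + ∑ j, Finsupp.single (j ::ₘ J) (V.z j i * a) :=
  frameNabla_single i J a

theorem commute_δξ (i j : Fin n) : Commute (V.δξ i) (V.δξ j) :=
  commute_frameNabla V.d_comm V.δ_z_comm i j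

/-- Faà di Bruno for the symbol of `δ_I`: a further `δ_i` either differentiates some factor
`z^j_{I_l}`, which enlarges a block, or contributes a new factor `z^j_i ξ_j`, which is a new block.
-/
theorem iter_δξ {q : ℕ} (I : Fin q → Fin n) :
    iter V.δξ (ms I) (Finsupp.single 0 1) =
      partitionSum V.zz (fun J => (Finsupp.single J 1 : Symbol n A)) I := by
  induction q with
  | zero => rw [partitionSum_zero, ms_zero, iter_zero]; rfl
  | succ q ih =>
    rw [← Fin.cons_self_tail I, ms_cons,
      partitionSum_cons_eq V.zz _ _ (V.δ (I 0)) (V.δξ (I 0)).toAddMonoidHom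
        (fun f p => frameNabla_smul _ f p) (fun j J hJ => V.δ_zz j _ J hJ), ← ih,
      iter_cons V.commute_δξ]
    · rfl
    · intro J _
      change V.δξ (I 0) (Finsupp.single J 1) = _
      rw [δξ_single, Derivation.map_one_eq_zero, Finsupp.single_zero, zero_add]
      refine Finset.sum_congr rfl fun l _ => ?_
      rw [zz_singleton, Finsupp.smul_single, smul_eq_mul]

/-- `𝐳 · 𝐱 = e` in the differential group. -/
theorem partitionSum_zz {q : ℕ} (hq : 1 ≤ q) (i : Fin n) (I : Fin q → Fin n) :
    partitionSum (fun j J => V.coord (Fin.castAdd m j) J) (V.zz i) I =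
      if ms I = {i} then 1 else 0 := by
  induction q, hq using Nat.le_induction with
  | base =>
    have h := congrFun (congrFun V.z_mul_x i) (I 0)
    rw [Matrix.mul_apply, Matrix.one_apply] at h
    rw [partitionSum_one]
    refine Eq.trans (Finset.sum_congr rfl fun l _ => ?_) (h.trans ?_)
    · rw [x_apply, mul_comm, zz_singleton]
      rfl
    · refine if_congr ?_ rfl rfl
      simp [ms, eq_comm]
  | succ q hq ih =>
    -- The relation of order `q + 1` is the derivative of the relation of order `q` in the direction
    -- of the first index. The components of the identity are constants, so the derivative is zero,
    -- as is the component of the identity in order `q + 1 ≥ 2`.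
    rw [← Fin.cons_self_tail I,
      partitionSum_cons_eq _ _ _ (V.d (I 0)) (V.d (I 0) : A →ₗ[ℝ] A).toAddMonoidHom, ih]
    · have hne : ¬ ms (Fin.cons (I 0) (Fin.tail I) : Fin (q + 1) → Fin n) = {i} := by
        intro h
        have := congrArg Multiset.card h
        rw [ms_card, Multiset.card_singleton] at this
        omega
      rw [if_neg hne]
      change V.d (I 0) _ = 0
      split_ifs <;> simp
    · intro f a
      change V.d (I 0) (f * a) = _
      rw [Derivation.leibniz, smul_eq_mul, smul_eq_mul, smul_eq_mul, smul_eq_mul, add_comm,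
        mul_comm a]
      rfl
    · intro j J _
      exact V.d_coord _ _ _
    · intro J hJ
      -- The inverse change of frame `d_k = x^l_k δ_l`, which introduces the factor `x^l_k` of the
      -- new block.
      have hx : ∀ f, V.d (I 0) f = ∑ l, V.x l (I 0) * V.δ l f := by
        intro f
        have h : ∀ k, V.d k f = ∑ l, ∑ j, V.x l k * (V.z j l * V.d j f) := by
          intro k
          have h1 : V.d k f = ∑ j, (V.z * V.x) j k * V.d j f := by
            rw [V.z_mul_x]
            simp [Matrix.one_apply]
          rw [h1, Finset.sum_comm]
          refine Finset.sum_congr rfl fun j _ => ?_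
          rw [Matrix.mul_apply, Finset.sum_mul]
          refine Finset.sum_congr rfl fun l _ => ?_
          ring
        rw [h]
        refine Finset.sum_congr rfl fun l _ => ?_
        rw [δ_apply, Finset.mul_sum]
      change V.d (I 0) _ = _
      rw [hx]
      refine Finset.sum_congr rfl fun l _ => ?_
      rw [V.δ_zz _ _ _ (hJ (by omega))]
      rfl

end RegularAlgebra

namespace RegularAlgebra

variable {n m s : ℕ} {A : Type*} [CommRing A] [Algebra ℝ A] (V : RegularAlgebra n m s A)

/-! ### The invariants `y^σ_I` -/

/-- The elements `y^σ_J`. -/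
def y (σ : Fin m) (J : Multiset (Fin n)) : A :=
  iter (ends V.δ) J (V.coord (Fin.natAdd n σ) 0)

theorem y_zero (σ : Fin m) : V.y σ 0 = V.coord (Fin.natAdd n σ) 0 := by
  simp [y]

theorem y_cons (σ : Fin m) (i : Fin n) (J : Multiset (Fin n)) :
    V.y σ (i ::ₘ J) = V.δ i (V.y σ J) := by
  rw [y, iter_cons (commute_ends V.δ_comm)]
  rfl

theorem y_singleton (σ : Fin m) (i : Fin n) :
    V.y σ {i} = V.δ i (V.coord (Fin.natAdd n σ) 0) := by
  rw [← V.y_zero, ← V.y_cons]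
  rfl

theorem hasOrder_z (k l : Fin n) : V.HasOrder 1 (V.z k l) := fun a J hJ => by
  rw [derivation_inverse _ V.x V.z V.z_mul_x, neg_eq_zero]
  refine Finset.sum_eq_zero fun b _ => Finset.sum_eq_zero fun c _ => ?_
  rw [x_apply, VelocityAlgebra.hasOrder_coord _ _ a J (by simpa using hJ), smul_zero]

theorem hasOrder_det : V.HasOrder 1 V.x.det := fun a J hJ => by
  rw [derivation_det _ V.x V.z V.z_mul_x]
  refine Finset.sum_eq_zero fun b _ => Finset.sum_eq_zero fun c _ => ?_
  rw [x_apply, VelocityAlgebra.hasOrder_coord _ _ a J (by simpa using hJ), mul_zero]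

theorem hasOrder_y (σ : Fin m) (J : Multiset (Fin n)) : V.HasOrder J.card (V.y σ J) := by
  induction J using Multiset.induction_on with
  | empty =>
    rw [y_zero]
    exact VelocityAlgebra.hasOrder_coord _ _
  | cons i J ih =>
    rw [y_cons, δ_apply, Multiset.card_cons]
    exact VelocityAlgebra.HasOrder.sum fun j _ =>
      ((V.hasOrder_z j i).mono (by omega)).mul (ih.d j)

/-! ### Vertical variations -/

theorem variation_z (Q : Fin (n + m) → A) (hs : 1 ≤ s) (k l : Fin n) :
    V.variation Q (V.z k l) =
      -∑ a, ∑ b, (V.z k a * V.z b l) •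
        nabla V.d b (Finsupp.single 0 (Q (Fin.castAdd m a))) := by
  rw [derivation_inverse _ V.x V.z V.z_mul_x]
  congr 1
  refine Finset.sum_congr rfl fun a _ => Finset.sum_congr rfl fun b _ => ?_
  rw [x_apply, V.variation_coord _ _ _ (by simpa using hs), ← Multiset.cons_zero,
    iter_cons (commute_nabla V.d_comm), iter_zero, mul_one]

theorem variation_det (Q : Fin (n + m) → A) (hs : 1 ≤ s) :
    V.variation Q V.x.det =
      ∑ a, ∑ b, (V.x.det * V.z b a) •
        nabla V.d b (Finsupp.single 0 (Q (Fin.castAdd m a))) := by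
  rw [symbol_derivation_det _ V.x V.z V.z_mul_x]
  refine Finset.sum_congr rfl fun a _ => Finset.sum_congr rfl fun b _ => ?_
  rw [x_apply, V.variation_coord _ _ _ (by simpa using hs), ← Multiset.cons_zero,
    iter_cons (commute_nabla V.d_comm), iter_zero, mul_one]

/-- The characteristic of the variation of the coordinate `x^σ`. -/
def verticalChar (σ : Fin m) : Fin (n + m) → A := Pi.single (Fin.natAdd n σ) 1

theorem verticalChar_castAdd (σ : Fin m) (i : Fin n) :
    (verticalChar σ : Fin (n + m) → A) (Fin.castAdd m i) = 0 := by
  unfold verticalChar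
  rw [Pi.single_eq_of_ne]
  intro h
  have := congrArg Fin.val h
  simp at this
  omega

theorem verticalChar_natAdd (σ τ : Fin m) :
    (verticalChar σ : Fin (n + m) → A) (Fin.natAdd n τ) = if τ = σ then 1 else 0 := by
  unfold verticalChar
  rw [Pi.single_apply]
  refine if_congr ?_ rfl rfl
  simp

/-- Nothing built from the `x^i_J` varies, so the variation passes through `z` and replaces `δ_i` by
its symbol `z^j_i (d_j + ξ_j)` at each step. -/
theorem variation_vertical_y (hs : 1 ≤ s) (σ τ : Fin m) (J : Multiset (Fin n)) (hJ : J.card ≤ s) :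
    V.variation (verticalChar σ) (V.y τ J) =
      if τ = σ then iter V.δξ J (Finsupp.single 0 1) else 0 := by
  induction J using Multiset.induction_on with
  | empty =>
    rw [y_zero, V.variation_coord _ _ _ (by simp), iter_zero, iter_zero, verticalChar_natAdd]
    split_ifs <;> simp
  | cons i J ih =>
    rw [Multiset.card_cons] at hJ
    have h0 : ∀ j, V.variation (verticalChar σ) (V.z j i) = 0 := by
      intro j
      rw [variation_z _ _ hs]
      simp [verticalChar_castAdd]
    rw [y_cons, δ_apply, map_sum]
    simp_rw [Derivation.leibniz, h0, smul_zero, add_zero,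
      V.variation_d _ hJ (V.hasOrder_y τ J), ih (by omega)]
    rw [← δξ_apply]
    split_ifs
    · rw [iter_cons V.commute_δξ]
      rfl
    · rw [map_zero]

/-! ### Variations of the parameters -/

/-- The characteristic of the variation `ε^j x^A_j` with `ε^j = z^j_p`. -/
def horizontalChar (p : Fin n) : Fin (n + m) → A :=
  fun a => V.δ p (V.coord a 0)

theorem nabla_horizontalChar_castAdd (p a b : Fin n) :
    nabla V.d b (Finsupp.single 0 (V.horizontalChar p (Fin.castAdd m a))) =
      Finsupp.single {b} (if a = p then 1 else 0) := by
  rw [horizontalChar, δ_coord, nabla_single]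
  split_ifs <;> simp

theorem variation_horizontal_z (hs : 1 ≤ s) (p j i : Fin n) :
    V.variation (V.horizontalChar p) (V.z j i) =
      -∑ b, (Finsupp.single {b} (V.z j p * V.z b i) : Symbol n A) := by
  rw [variation_z _ _ hs]
  simp_rw [nabla_horizontalChar_castAdd]
  congr 1
  rw [Finset.sum_comm]
  refine Finset.sum_congr rfl fun b _ => ?_
  rw [Finset.sum_eq_single p]
  · simp
  · intro a _ ha
    simp [ha]
  · simp

theorem variation_horizontal_det (hs : 1 ≤ s) (p : Fin n) :
    V.variation (V.horizontalChar p) V.x.det =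
      ∑ b, (Finsupp.single {b} (V.x.det * V.z b p) : Symbol n A) := by
  rw [variation_det _ _ hs]
  simp_rw [nabla_horizontalChar_castAdd]
  rw [Finset.sum_comm]
  refine Finset.sum_congr rfl fun b _ => ?_
  rw [Finset.sum_eq_single p]
  · simp
  · intro a _ ha
    simp [ha]
  · simp

/-- The invariants do not depend on the parametrization, so a reparametrization only transports them
along `δ_p`, and no `ξ` appears. -/
theorem variation_horizontal_y (hs : 1 ≤ s) (p : Fin n) (τ : Fin m) (J : Multiset (Fin n))
    (hJ : J.card ≤ s) :
    V.variation (V.horizontalChar p) (V.y τ J) = Finsupp.single 0 (V.δ p (V.y τ J)) := by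
  induction J using Multiset.induction_on with
  | empty =>
    rw [y_zero, V.variation_coord _ _ _ (by simp), iter_zero]
    rfl
  | cons i J ih =>
    rw [Multiset.card_cons] at hJ
    rw [y_cons, V.δ_apply i, map_sum]
    simp_rw [Derivation.leibniz, V.variation_d _ hJ (V.hasOrder_y τ J), ih (by omega),
      nabla_single, variation_horizontal_z _ hs, smul_add, Finset.sum_add_distrib]
    have h1 : ∑ j, V.z j i • (Finsupp.single 0 (V.d j (V.δ p (V.y τ J))) : Symbol n A) =
        Finsupp.single 0 (V.δ p (V.δ i (V.y τ J))) := by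
      rw [V.δ_comm, V.δ_apply i, ← Finsupp.singleAddHom_apply, map_sum]
      simp
    -- The terms linear in `ξ` cancel: those from `d_j + ξ_j` against those from the variation of
    -- `z`.
    have h2 : ∑ j, V.z j i • (Finsupp.single (j ::ₘ 0) (V.δ p (V.y τ J)) : Symbol n A) +
        ∑ j, V.d j (V.y τ J) • -∑ b, (Finsupp.single {b} (V.z j p * V.z b i) : Symbol n A) = 0 := by
      simp_rw [smul_neg, Finset.smul_sum, Finsupp.smul_single, smul_eq_mul]
      rw [Finset.sum_neg_distrib, ← sub_eq_add_neg, sub_eq_zero, Finset.sum_comm]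
      refine Finset.sum_congr rfl fun b _ => ?_
      rw [V.δ_apply p, Finset.mul_sum, ← Finsupp.singleAddHom_apply, map_sum]
      refine Finset.sum_congr rfl fun j _ => ?_
      rw [Finsupp.singleAddHom_apply, Multiset.cons_zero]
      congr 1
      ring
    rw [h1, add_assoc, h2, add_zero]
    congr 2
    rw [← V.δ_apply]

/-! ### Functions of the invariants -/

/-- `g` is a function of `x^i` and of `y^σ_J`, `|J| ≤ r`, with the partial derivatives
`gx`, `gy`. -/
def ChainRule (r : ℕ) (g : A) (gx : Fin n → A) (gy : Fin m → Multiset (Fin n) → A) : Prop :=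
  ∀ a J, V.pd a J g = ∑ i, gx i * V.pd a J (V.coord (Fin.castAdd m i) 0) +
    ∑ σ, ∑ K : MultiIndex n r, gy σ K.1 * V.pd a J (V.y σ K.1)

variable {V} {r : ℕ} {g : A} {gx : Fin n → A} {gy : Fin m → Multiset (Fin n) → A}

theorem ChainRule.hasOrder (h : V.ChainRule r g gx gy) : V.HasOrder r g := fun a J hJ => by
  rw [h, Finset.sum_eq_zero, Finset.sum_eq_zero, add_zero]
  · intro σ _
    refine Finset.sum_eq_zero fun K _ => ?_
    rw [V.hasOrder_y σ K.1 a J (K.2.trans_lt hJ), mul_zero]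
  · intro i _
    rw [VelocityAlgebra.hasOrder_coord _ _ a J, mul_zero]
    simpa using (Nat.zero_le r).trans_lt hJ

/-- `ChainRule` speaks of partial derivatives only; it extends to every derivation that is a
combination of them, in particular to the variations and to `δ_i`. -/
theorem ChainRule.map_eq {M : Type*} [AddCommGroup M] [Module A M] [Module ℝ M]
    (h : V.ChainRule r g gx gy) (D : Derivation ℝ A M) (c : Fin (n + m) → MultiIndex n s → M)
    (hD : ∀ f, D f = ∑ a, ∑ J : MultiIndex n s, V.pd a J.1 f • c a J) :
    D g = ∑ i, gx i • D (V.coord (Fin.castAdd m i) 0) +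
      ∑ σ, ∑ K : MultiIndex n r, gy σ K.1 • D (V.y σ K.1) := by
  have h1 : ∀ f, D f = ∑ p : Fin (n + m) × MultiIndex n s, V.pd p.1 p.2.1 f • c p.1 p.2 :=
    fun f => by rw [hD, Fintype.sum_prod_type]
  simp_rw [h1, Finset.smul_sum, smul_smul]
  simp_rw [Finset.sum_comm (t := (Finset.univ : Finset (Fin (n + m) × MultiIndex n s)))]
  rw [← Finset.sum_add_distrib]
  refine Finset.sum_congr rfl fun p _ => ?_
  rw [h]
  simp_rw [add_smul, Finset.sum_smul]

theorem ChainRule.variation (h : V.ChainRule r g gx gy) (Q : Fin (n + m) → A) :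
    V.variation Q g = ∑ i, gx i • V.variation Q (V.coord (Fin.castAdd m i) 0) +
      ∑ σ, ∑ K : MultiIndex n r, gy σ K.1 • V.variation Q (V.y σ K.1) :=
  h.map_eq _ _ (V.variation_apply Q)

theorem ChainRule.δ (h : V.ChainRule r g gx gy) (i : Fin n) :
    V.δ i g = gx i + ∑ σ, ∑ K : MultiIndex n r, gy σ K.1 * V.y σ (i ::ₘ K.1) := by
  have h1 := h.map_eq (V.δ i)
    (fun a J => ∑ j, V.z j i * V.coord a (j ::ₘ J.1)) (fun f => by
      rw [V.δ_apply]
      simp_rw [V.d_apply, Finset.mul_sum, smul_eq_mul, Finset.mul_sum]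
      rw [Finset.sum_comm]
      refine Finset.sum_congr rfl fun a _ => ?_
      rw [Finset.sum_comm]
      refine Finset.sum_congr rfl fun J _ => Finset.sum_congr rfl fun j _ => ?_
      ring)
  rw [h1]
  simp_rw [V.δ_coord, V.y_cons, smul_eq_mul]
  congr 1
  simp

/-- The vertical variation computed in two ways: by `transpose_variation`, and as `det(𝐱) ∑
∂g/∂y^σ_K δ_K` followed by integration by parts. -/
theorem ChainRule.transpose_symbol_natAdd (h : V.ChainRule r g gx gy) (hs : 1 ≤ s) (hrs : r ≤ s)
    (σ : Fin m) :
    transpose V.d (V.symbol (Fin.natAdd n σ) (V.x.det * g)) =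
      ∑ q ∈ Finset.range (r + 1), ∑ I : Fin q → Fin n,
        lieSum (ends V.δ) r (fun J => weight J • gy σ J) (ms I) •
          (-1 : A) ^ q • V.x.det • flip (iter V.δξ (ms I) (Finsupp.single 0 1)) := by
  have h1 := V.transpose_variation (verticalChar σ) (V.x.det * g)
  have h2 : V.variation (verticalChar σ) (V.x.det * g) =
      ∑ K : MultiIndex n r, (V.x.det * gy σ K.1) • iter V.δξ K.1 (Finsupp.single 0 1) := by
    have hdet : V.variation (verticalChar σ) V.x.det = 0 := by
      rw [variation_det _ _ hs]
      simp [verticalChar_castAdd]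
    rw [Derivation.leibniz, hdet, smul_zero, add_zero, h.variation, Finset.sum_eq_zero, zero_add,
      Finset.sum_eq_single σ, Finset.smul_sum]
    · refine Finset.sum_congr rfl fun K _ => ?_
      rw [V.variation_vertical_y hs σ σ _ (K.2.trans hrs), if_pos rfl, smul_smul]
    · intro τ _ hτ
      refine Finset.sum_eq_zero fun K _ => ?_
      rw [V.variation_vertical_y hs σ τ _ (K.2.trans hrs), if_neg hτ, smul_zero]
    · simp
    · intro i _
      rw [V.variation_coord _ _ _ (by simp), verticalChar_castAdd]
      simp
  rw [h2, Finset.sum_eq_single (Fin.natAdd n σ)] at h1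
  · rw [verticalChar_natAdd, if_pos rfl, one_smul] at h1
    rw [← h1]
    exact transpose_sum_frameNabla V.d_comm V.δ_z_comm _ V.sum_d_det_mul_z r (gy σ)
  · intro a _ ha
    rw [verticalChar, Pi.single_eq_of_ne ha, zero_smul]
  · simp

/-- Infinitesimal homogeneity. Under the horizontal variation `det(𝐱) g` changes by a divergence,
and only one of the first `n` components of the characteristic is nonzero, so the expressions for
the index `p` are determined by those for the indices `σ`. -/
theorem ChainRule.transpose_symbol_castAdd (h : V.ChainRule r g gx gy) (hs : 1 ≤ s) (hrs : r ≤ s)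
    (p : Fin n) :
    transpose V.d (V.symbol (Fin.castAdd m p) (V.x.det * g)) =
      ∑ b, Finsupp.single {b} (V.x.det * V.z b p * g) -
        ∑ σ, V.y σ {p} • transpose V.d (V.symbol (Fin.natAdd n σ) (V.x.det * g)) := by
  have h1 := V.transpose_variation (V.horizontalChar p) (V.x.det * g)
  have hg : V.variation (V.horizontalChar p) g = Finsupp.single 0 (V.δ p g) := by
    rw [h.variation, h.δ, Finsupp.single_add]
    congr 1
    · rw [Finset.sum_eq_single p]
      · rw [V.variation_coord _ _ _ (by simp), horizontalChar, δ_coord, if_pos rfl, iter_zero,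
          Module.End.one_apply, Finsupp.smul_single, smul_eq_mul, mul_one]
      · intro i _ hi
        rw [V.variation_coord _ _ _ (by simp), horizontalChar, δ_coord, if_neg hi]
        simp
      · simp
    · rw [← Finsupp.singleAddHom_apply, map_sum]
      refine Finset.sum_congr rfl fun σ _ => ?_
      rw [map_sum]
      refine Finset.sum_congr rfl fun K _ => ?_
      rw [V.variation_horizontal_y hs p σ _ (K.2.trans hrs), Finsupp.smul_single, smul_eq_mul,
        V.y_cons]
      rfl
  -- By the Piola identity the derivatives of `det(𝐱) z^b_p` drop out of the divergence, which
  -- leaves `det(𝐱) δ_p g` and the variation of the determinant.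
  have h2 : V.variation (V.horizontalChar p) (V.x.det * g) =
      ∑ b, nabla V.d b (Finsupp.single 0 (V.x.det * V.z b p * g)) := by
    simp_rw [nabla_single, Finset.sum_add_distrib]
    have hd : ∑ b, V.d b (V.x.det * V.z b p * g) = V.x.det * V.δ p g := by
      simp_rw [Derivation.leibniz (V.d _) _ g, Finset.sum_add_distrib, smul_eq_mul,
        ← Finset.mul_sum, V.sum_d_det_mul_z, V.δ_apply, mul_zero, add_zero, Finset.mul_sum,
        mul_assoc]
    rw [Derivation.leibniz, variation_horizontal_det _ hs, hg, Finsupp.smul_single, smul_eq_mul,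
      ← hd, Finset.smul_sum]
    congr 1
    · rw [← Finsupp.singleAddHom_apply, map_sum]
      rfl
    · refine Finset.sum_congr rfl fun b _ => ?_
      rw [Finsupp.smul_single, smul_eq_mul, mul_comm]
      rfl
  have h3 : ∑ i, V.horizontalChar p (Fin.castAdd m i) •
      transpose V.d (V.symbol (Fin.castAdd m i) (V.x.det * g)) =
        transpose V.d (V.symbol (Fin.castAdd m p) (V.x.det * g)) := by
    simp_rw [horizontalChar, δ_coord]
    simp
  rw [h2, map_sum, Fin.sum_univ_add, h3] at h1
  simp_rw [transpose_nabla V.d_comm, transpose_single_zero, shiftEnd_single,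
    Multiset.cons_zero] at h1
  rw [h1, eq_sub_iff_add_eq]
  congr 1
  refine Finset.sum_congr rfl fun σ _ => ?_
  rw [y_singleton]
  rfl

end RegularAlgebra

/-! ### Cancellation in the differential group -/

section Cancellation

variable {n : ℕ}

/-- Only the partition into singletons has `q` blocks; every other one meets a vanishing
coefficient. -/
theorem partitionSum_of_card_lt (b : Fin n → Multiset (Fin n) → ℝ) (a : Multiset (Fin n) → ℝ)
    {q : ℕ} (ha : ∀ J, J.card < q → a J = 0) (I : Fin q → Fin n) :
    partitionSum b a I = ∑ j : Fin q → Fin n, (∏ l, b (j l) {I l}) * a (ms j) := by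
  induction q generalizing a with
  | zero => simp [partitionSum_zero]
  | succ q ih =>
    rw [← Fin.cons_self_tail I, partitionSum_cons, sum_cons]
    have h : ∀ l, ∑ j : Fin q → Fin n, (∏ k, b (j k) {Fin.tail I k}) * a (l ::ₘ ms j) =
        partitionSum b (fun J => a (l ::ₘ J)) (Fin.tail I) := by
      intro l
      rw [ih _ fun J hJ => ha _ (by rw [Multiset.card_cons]; omega)]
    simp_rw [Fin.prod_univ_succ, Fin.cons_zero, Fin.cons_succ, ms_cons, mul_assoc,
      ← Finset.mul_sum, h]
    unfold partitionSum
    simp_rw [Finset.mul_sum]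
    rw [Finset.sum_comm]
    refine Finset.sum_congr rfl fun c _ => ?_
    rw [Finset.sum_comm]
    refine Finset.sum_congr rfl fun j _ => ?_
    rw [ha (ms j) (by rw [ms_card]; exact Nat.lt_succ_of_le c.length_le), smul_zero, add_zero,
      Finset.smul_sum]
    refine Finset.sum_congr rfl fun l _ => ?_
    simp only [smul_eq_mul]
    ring

/-- The group law is triangular: in order `q` the top coefficients enter through the `q`-th tensor
power of the matrix `x^i_j`, everything else being of lower order. As that matrix is invertible, the
left factor is recovered order by order. -/
theorem eq_of_groupMul_eq {x : Fin n → Multiset (Fin n) → ℝ} {w : Matrix (Fin n) (Fin n) ℝ}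
    (hw : Matrix.of (fun i j => x i {j}) * w = 1) {z z' : Multiset (Fin n) → ℝ} {s : ℕ}
    (h : ∀ (q : ℕ) (I : Fin q → Fin n), 1 ≤ q → q ≤ s → partitionSum x z I = partitionSum x z' I)
    (J : Multiset (Fin n)) (hJ : 1 ≤ J.card) (hJs : J.card ≤ s) : z J = z' J := by
  induction hq : J.card using Nat.strong_induction_on generalizing J with
  | _ q ih =>
    obtain ⟨q', k, rfl⟩ : ∃ (q' : ℕ) (k : Fin q' → Fin n), ms k = J := ⟨_, exists_ms_eq J⟩
    rw [ms_card] at hq hJ hJs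
    subst hq
    -- The difference, cut off where nothing is known about it: in order zero, which no partition of
    -- a nonempty sequence reaches, and above `q'`.
    set a : Multiset (Fin n) → ℝ := fun K => if K.card = 0 then 0 else
      if K.card ≤ q' then z K - z' K else 0 with ha
    have ha0 : ∀ K, K.card < q' → a K = 0 := by
      intro K hK
      simp only [ha]
      split_ifs with h1 h2
      · rfl
      · exact sub_eq_zero.2 (ih _ hK K (by omega) (by omega) rfl)
      · rfl
    have h0 : ∀ I : Fin q' → Fin n,
        ∑ j : Fin q' → Fin n, (∏ l, x (j l) {I l}) * a (ms j) = 0 := by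
      intro I
      rw [← partitionSum_of_card_lt x a ha0 I]
      refine Eq.trans ?_ (sub_eq_zero.2 (h q' I hJ hJs))
      unfold partitionSum
      simp_rw [← Finset.sum_sub_distrib, smul_eq_mul, ← mul_sub]
      refine Finset.sum_congr rfl fun c _ => Finset.sum_congr rfl fun j _ => ?_
      have := c.length_pos hJ
      have := c.length_le
      simp only [ha, ms_card]
      rw [if_neg (by omega), if_pos (by omega)]
    -- Contraction with the tensor power of `w` inverts that of the matrix of `x` and isolates one
    -- coefficient.
    have hsum : ∑ I : Fin q' → Fin n, (∏ l, w (I l) (k l)) *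
        ∑ j : Fin q' → Fin n, (∏ l, x (j l) {I l}) * a (ms j) = a (ms k) := by
      simp_rw [Finset.mul_sum]
      rw [Finset.sum_comm]
      have : ∀ j : Fin q' → Fin n, ∑ I : Fin q' → Fin n,
          (∏ l, w (I l) (k l)) * ((∏ l, x (j l) {I l}) * a (ms j)) =
            if j = k then a (ms j) else 0 := by
        intro j
        have h1 : ∑ I : Fin q' → Fin n, ∏ l, x (j l) {I l} * w (I l) (k l) =
            ∏ l, if j l = k l then 1 else 0 := by
          rw [← Fintype.piFinset_univ, ← Finset.prod_univ_sum (fun _ => Finset.univ)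
            fun l i => x (j l) {i} * w i (k l)]
          refine Finset.prod_congr rfl fun l _ => ?_
          have := congrFun (congrFun hw (j l)) (k l)
          rw [Matrix.mul_apply, Matrix.one_apply] at this
          exact this
        have h2 : ∀ I : Fin q' → Fin n,
            (∏ l, w (I l) (k l)) * ((∏ l, x (j l) {I l}) * a (ms j)) =
              (∏ l, x (j l) {I l} * w (I l) (k l)) * a (ms j) := by
          intro I
          rw [Finset.prod_mul_distrib]
          ring
        simp_rw [h2]
        rw [← Finset.sum_mul, h1]
        by_cases hjk : j = k
        · simp [hjk]
        · obtain ⟨l, hl⟩ := Function.ne_iff.1 hjk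
          rw [if_neg hjk, Finset.prod_eq_zero (Finset.mem_univ l) (if_neg hl), zero_mul]
      simp_rw [this]
      simp
    simp_rw [h0, mul_zero, Finset.sum_const_zero, ha, ms_card] at hsum
    rw [if_neg (by omega), if_pos le_rfl] at hsum
    exact (sub_eq_zero.1 hsum.symm)

end Cancellation

/-! ### The algebra of smooth functions on an open set -/

section SmoothFunctions

variable {E : Type*} [NormedAddCommGroup E] [NormedSpace ℝ E]

/-- The algebra of the smooth real functions on an open set. -/
def smoothFun (W : Opens E) : Subalgebra ℝ (W → ℝ) where
  carrier := {g | ∃ f : E → ℝ, ContDiffOn ℝ ∞ f W ∧ ∀ x : W, g x = f x}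
  mul_mem' := by
    rintro g g' ⟨f, hf, h⟩ ⟨f', hf', h'⟩
    exact ⟨fun x => f x * f' x, hf.mul hf', fun x => by rw [Pi.mul_apply, h, h']⟩
  add_mem' := by
    rintro g g' ⟨f, hf, h⟩ ⟨f', hf', h'⟩
    exact ⟨fun x => f x + f' x, hf.add hf', fun x => by rw [Pi.add_apply, h, h']⟩
  algebraMap_mem' c := ⟨fun _ => c, contDiffOn_const, fun _ => rfl⟩

variable {W : Opens E}

/-- `f` is a smooth function on `W` extended in some way. -/
def IsExtension (f : E → ℝ) (g : smoothFun W) : Prop := ∀ x : W, f x = g.1 x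

/-- The smooth function given by a function that is smooth on `W`. -/
def smoothMk (f : E → ℝ) (hf : ContDiffOn ℝ ∞ f W) : smoothFun W :=
  ⟨fun x => f x, f, hf, fun _ => rfl⟩

theorem isExtension_smoothMk (f : E → ℝ) (hf : ContDiffOn ℝ ∞ f W) :
    IsExtension f (smoothMk f hf) := fun _ => rfl

theorem exists_isExtension (g : smoothFun W) : ∃ f : E → ℝ, IsExtension f g :=
  let ⟨f, _, h⟩ := g.2
  ⟨f, fun x => (h x).symm⟩

theorem IsExtension.contDiffOn {f : E → ℝ} {g : smoothFun W} (h : IsExtension f g) :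
    ContDiffOn ℝ ∞ f W := by
  obtain ⟨f', hf', h'⟩ := g.2
  exact hf'.congr fun x hx => (h ⟨x, hx⟩).trans (h' ⟨x, hx⟩)

theorem IsExtension.contDiffAt {f : E → ℝ} {g : smoothFun W} (h : IsExtension f g) (x : W) :
    ContDiffAt ℝ ∞ f x :=
  h.contDiffOn.contDiffAt (W.isOpen.mem_nhds x.2)

theorem IsExtension.differentiableAt {f : E → ℝ} {g : smoothFun W} (h : IsExtension f g) (x : W) :
    DifferentiableAt ℝ f x :=
  (h.contDiffAt x).differentiableAt (by simp)

/-- Since `W` is open, derivatives at its points do not see the values chosen outside. Hence the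
operators on total functions descend to the algebra on `W`. -/
theorem IsExtension.fderiv_eq {f f' : E → ℝ} {g : smoothFun W} (h : IsExtension f g)
    (h' : IsExtension f' g) (x : W) : fderiv ℝ f x = fderiv ℝ f' x := by
  refine Filter.EventuallyEq.fderiv_eq ?_
  filter_upwards [W.isOpen.mem_nhds x.2] with t ht
  exact (h ⟨t, ht⟩).trans (h' ⟨t, ht⟩).symm

theorem IsExtension.contDiffOn_fderiv {f : E → ℝ} {g : smoothFun W} (h : IsExtension f g) (v : E) :
    ContDiffOn ℝ ∞ (fun x => fderiv ℝ f x v) W :=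
  (h.contDiffOn.fderiv_of_isOpen W.isOpen (by simp)).clm_apply contDiffOn_const

theorem IsExtension.congr {f f' : E → ℝ} {g : smoothFun W} (h : IsExtension f g)
    (hf : ∀ x : W, f' x = f x) : IsExtension f' g := fun x => (hf x).trans (h x)

theorem IsExtension.add {f f' : E → ℝ} {g g' : smoothFun W} (h : IsExtension f g)
    (h' : IsExtension f' g') : IsExtension (fun x => f x + f' x) (g + g') := fun x =>
  congrArg₂ (· + ·) (h x) (h' x)

theorem IsExtension.mul {f f' : E → ℝ} {g g' : smoothFun W} (h : IsExtension f g)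
    (h' : IsExtension f' g') : IsExtension (fun x => f x * f' x) (g * g') := fun x =>
  congrArg₂ (· * ·) (h x) (h' x)

theorem IsExtension.const_smul {f : E → ℝ} {g : smoothFun W} (h : IsExtension f g) (c : ℝ) :
    IsExtension (fun x => c * f x) (c • g) := fun x =>
  congrArg (c * ·) (h x)

theorem IsExtension.sum {ι : Type*} {t : Finset ι} {f : ι → E → ℝ} {g : ι → smoothFun W}
    (h : ∀ i ∈ t, IsExtension (f i) (g i)) :
    IsExtension (fun x => ∑ i ∈ t, f i x) (∑ i ∈ t, g i) := fun x => by
  have : (∑ i ∈ t, g i).1 x = ∑ i ∈ t, (g i).1 x := by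
    simp
  rw [this]
  exact Finset.sum_congr rfl fun i hi => h i hi x

theorem IsExtension.ext {f : E → ℝ} {g g' : smoothFun W} (h : IsExtension f g)
    (h' : IsExtension f g') : g = g' :=
  Subtype.ext (funext fun x => (h x).symm.trans (h' x))

/-- The directional derivative of a smooth function. -/
def directionalFun (v : E) (g : smoothFun W) : smoothFun W :=
  smoothMk (fun x => fderiv ℝ (exists_isExtension g).choose x v)
    ((exists_isExtension g).choose_spec.contDiffOn_fderiv v)

theorem IsExtension.directionalFun {f : E → ℝ} {g : smoothFun W} (h : IsExtension f g) (v : E) :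
    IsExtension (fun x => fderiv ℝ f x v) (directionalFun v g) := fun x =>
  congrArg (fun T : E →L[ℝ] ℝ => T v) (h.fderiv_eq (exists_isExtension g).choose_spec x)

/-- The directional derivative. -/
def directional (v : E) : Derivation ℝ (smoothFun W) (smoothFun W) :=
  Derivation.mk'
    { toFun := directionalFun v
      map_add' := fun g g' => by
        obtain ⟨f, h⟩ := exists_isExtension g
        obtain ⟨f', h'⟩ := exists_isExtension g'
        refine ((h.add h').directionalFun v).ext
          (((h.directionalFun v).add (h'.directionalFun v)).congr fun x => ?_)
        rw [fderiv_fun_add (h.differentiableAt x) (h'.differentiableAt x)]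
        rfl
      map_smul' := fun c g => by
        obtain ⟨f, h⟩ := exists_isExtension g
        refine ((h.const_smul c).directionalFun v).ext
          (((h.directionalFun v).const_smul c).congr fun x => ?_)
        rw [fderiv_const_mul (h.differentiableAt x)]
        rfl }
    fun g g' => by
      obtain ⟨f, h⟩ := exists_isExtension g
      obtain ⟨f', h'⟩ := exists_isExtension g'
      refine ((h.mul h').directionalFun v).ext
        (((h.mul (h'.directionalFun v)).add (h'.mul (h.directionalFun v))).congr fun x => ?_)
      rw [fderiv_fun_mul (h.differentiableAt x) (h'.differentiableAt x)]
      rfl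

theorem IsExtension.directional {f : E → ℝ} {g : smoothFun W} (h : IsExtension f g) (v : E) :
    IsExtension (fun x => fderiv ℝ f x v) (directional v g) := h.directionalFun v

theorem directional_comm (v w : E) (g : smoothFun W) :
    directional v (directional w g) = directional w (directional v g) := by
  obtain ⟨f, hf⟩ := exists_isExtension g
  refine ((hf.directional w).directional v).ext
    (((hf.directional v).directional w).congr fun x => ?_)
  have h2 : (2 : WithTop ℕ∞) ≤ ∞ := WithTop.coe_le_coe.2 (le_top : (2 : ℕ∞) ≤ ⊤)
  have hd : DifferentiableAt ℝ (fderiv ℝ f) x :=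
    ((hf.contDiffAt x).fderiv_right (m := 1) (by exact_mod_cast h2)).differentiableAt (by simp)
  have hsymm : IsSymmSndFDerivAt ℝ f x :=
    (hf.contDiffAt x).isSymmSndFDerivAt (by simpa using h2)
  have h : ∀ v w : E, fderiv ℝ (fun x => fderiv ℝ f x w) (x : E) v =
      fderiv ℝ (fderiv ℝ f) (x : E) v w := by
    intro v w
    rw [fderiv_clm_apply hd (differentiableAt_const w)]
    simp
  change fderiv ℝ (fun x => fderiv ℝ f x w) (x : E) v = fderiv ℝ (fun x => fderiv ℝ f x v) (x : E) w
  rw [h v w, h w v]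
  exact hsymm v w

/-- The evaluation at a point. -/
def evalAt (x : W) : smoothFun W →ₐ[ℝ] ℝ :=
  (Pi.evalAlgHom ℝ (fun _ : W => ℝ) x).comp (smoothFun W).val

theorem evalAt_apply (x : W) (g : smoothFun W) : evalAt x g = g.1 x := rfl

theorem IsExtension.evalAt {f : E → ℝ} {g : smoothFun W} (h : IsExtension f g) (x : W) :
    Grassmann.evalAt x g = f x := (h x).symm

theorem smoothFun_ext {g g' : smoothFun W} (h : ∀ x, evalAt x g = evalAt x g') : g = g' :=
  Subtype.ext (funext h)

theorem exists_mul_eq_one (g : smoothFun W) (hg : ∀ x, evalAt x g ≠ 0) :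
    ∃ g' : smoothFun W, g' * g = 1 := by
  obtain ⟨f, hf⟩ := exists_isExtension g
  have h0 : ∀ x ∈ W, f x ≠ 0 := fun x hx => by
    rw [hf ⟨x, hx⟩]
    exact hg ⟨x, hx⟩
  refine ⟨smoothMk (fun x => (f x)⁻¹) (hf.contDiffOn.inv h0), smoothFun_ext fun x => ?_⟩
  rw [map_mul, map_one, evalAt_apply, evalAt_apply, ← hf x]
  exact inv_mul_cancel₀ (h0 x x.2)

end SmoothFunctions

/-! ### Smooth functions of the coordinates of velocities -/

section Coordinates

variable {N n s : ℕ}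

/-- The coordinate `x^a_J` as a continuous linear form. -/
def getL (a : Fin N) (J : Multiset (Fin n)) : JetSpace N n s →L[ℝ] ℝ :=
  if h : J.card ≤ s then ContinuousLinearMap.proj (a, ⟨J, h⟩) else 0

theorem getL_apply (a : Fin N) (J : Multiset (Fin n)) (x : JetSpace N n s) :
    getL a J x = x.get a J := by
  unfold getL JetSpace.get
  split_ifs <;> rfl

/-- The coordinate vector of the coordinate `x^a_J`. -/
def basisJ (a : Fin N) (J : Multiset (Fin n)) : JetSpace N n s :=
  if h : J.card ≤ s then Pi.single (a, ⟨J, h⟩) 1 else 0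

theorem basisJ_get (a b : Fin N) (J K : Multiset (Fin n)) (hJ : J.card ≤ s) :
    (basisJ a J : JetSpace N n s).get b K = if a = b ∧ J = K then 1 else 0 := by
  unfold basisJ JetSpace.get
  rw [dif_pos hJ]
  split_ifs with h1 h2 h2
  · obtain ⟨rfl, rfl⟩ := h2
    exact Pi.single_eq_same _ _
  · refine Pi.single_eq_of_ne ?_ _
    intro h
    rw [Prod.mk.injEq, Subtype.mk.injEq] at h
    exact h2 ⟨h.1.symm, h.2.symm⟩
  · obtain ⟨rfl, rfl⟩ := h2
    exact absurd hJ h1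
  · rfl

theorem partialJ_eq (a : Fin N) (J : Multiset (Fin n)) (f : JetSpace N n s → ℝ)
    (x : JetSpace N n s) : partialJ a J f x = weight J * fderiv ℝ f x (basisJ a J) := by
  unfold partialJ basisJ
  split_ifs
  · rfl
  · rw [map_zero, mul_zero]

theorem contDiff_get (a : Fin N) (J : Multiset (Fin n)) :
    ContDiff ℝ ∞ fun x : JetSpace N n s => x.get a J := by
  simp_rw [← getL_apply]
  exact (getL a J).contDiff

theorem fderiv_get (a : Fin N) (J : Multiset (Fin n)) (x v : JetSpace N n s) :
    fderiv ℝ (fun x : JetSpace N n s => x.get a J) x v = v.get a J := by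
  simp_rw [← getL_apply]
  rw [ContinuousLinearMap.fderiv]

/-- The velocity algebra of the smooth functions on an open set. -/
def smoothVelocityAlgebra (W : Opens (JetSpace N n s)) : VelocityAlgebra n N s (smoothFun W) where
  coord a J := smoothMk (fun x => x.get a J) (contDiff_get a J).contDiffOn
  pd a J := directional (basisJ a J)
  coord_eq_zero a J hJ := smoothFun_ext fun x => by
    change (x : JetSpace N n s).get a J = 0
    rw [JetSpace.get, dif_neg (not_le.2 hJ)]
  pd_eq_zero a J hJ := by
    ext g : 1
    obtain ⟨f, hf⟩ := exists_isExtension g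
    refine smoothFun_ext fun x => ?_
    rw [(hf.directional _).evalAt x, basisJ, dif_neg (not_le.2 hJ), map_zero]
    rfl
  pd_coord a b J K hJ := smoothFun_ext fun x => by
    rw [((isExtension_smoothMk _ _).directional _).evalAt x, fderiv_get, basisJ_get _ _ _ _ hJ]
    split_ifs <;> simp
  pd_comm a b J K f := directional_comm _ _ f

variable {W : Opens (JetSpace N n s)}

theorem isExtension_coord (a : Fin N) (J : Multiset (Fin n)) :
    IsExtension (fun x => x.get a J) ((smoothVelocityAlgebra W).coord a J) := fun _ => rfl

theorem IsExtension.partialJ {f : JetSpace N n s → ℝ} {g : smoothFun W} (h : IsExtension f g)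
    (a : Fin N) (J : Multiset (Fin n)) :
    IsExtension (partialJ a J f) (weight J • (smoothVelocityAlgebra W).pd a J g) :=
  ((h.directional (basisJ a J)).const_smul (weight J)).congr fun x => partialJ_eq a J f x

theorem IsExtension.formalD {f : JetSpace N n s → ℝ} {g : smoothFun W} (h : IsExtension f g)
    (i : Fin n) : IsExtension (formalD i f) ((smoothVelocityAlgebra W).d i g) := by
  set V := smoothVelocityAlgebra W with hV
  -- The abstract derivation also has summands of order `s`; their coefficients are coordinates of
  -- order `s + 1`, hence zero.
  have h1 : V.d i g = ∑ k ∈ Finset.range s, ∑ j : Fin k → Fin n, ∑ a : Fin N,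
      V.coord a (i ::ₘ ms j) * (weight (ms j) • V.pd a (ms j) g) := by
    rw [V.d_apply, Finset.sum_comm,
      sum_multiIndex_eq s fun J => ∑ a : Fin N, V.coord a (i ::ₘ J) * V.pd a J g,
      Finset.sum_range_succ, Finset.sum_eq_zero (s := (Finset.univ : Finset (Fin s → Fin n))),
      add_zero]
    · simp_rw [Finset.smul_sum, mul_smul_comm]
    · intro j _
      rw [Finset.sum_eq_zero, smul_zero]
      intro a _
      rw [V.coord_eq_zero _ _ (by simp), zero_mul]
  rw [h1]
  exact IsExtension.sum fun k _ => IsExtension.sum fun j _ => IsExtension.sum fun a _ =>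
    (isExtension_coord a _).mul (h.partialJ a _)

theorem IsExtension.formalDs {f : JetSpace N n s → ℝ} {g : smoothFun W} (h : IsExtension f g)
    (l : List (Fin n)) :
    IsExtension (formalDs l f) ((l.map (ends (smoothVelocityAlgebra W).d)).prod g) := by
  induction l with
  | nil => exact h
  | cons i l ih => exact ih.formalD i

theorem IsExtension.lieEuler {f : JetSpace N n s → ℝ} {g : smoothFun W} (h : IsExtension f g)
    (r : ℕ) (a : Fin N) {k : ℕ} (i : Fin k → Fin n) :
    IsExtension (lieEuler r a i f) (lieSum (ends (smoothVelocityAlgebra W).d) r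
      (fun J => weight J • (smoothVelocityAlgebra W).pd a J g) (ms i)) := by
  unfold Grassmann.lieEuler lieSum
  rw [ms_card]
  refine IsExtension.sum fun l _ => IsExtension.sum fun j _ => IsExtension.const_smul ?_ _
  rw [iter_ofFn (commute_ends (smoothVelocityAlgebra W).d_comm)]
  exact (h.partialJ a _).formalDs _

end Coordinates

/-! ### The regular algebra of smooth functions and the group element `𝐳` -/

section Regular

variable {n m s : ℕ}

/-- The reciprocal of the determinant is smooth on `W`, so the adjugate provides an inverse inside
the algebra. -/
theorem exists_inverse_x (W : Opens (JetSpace (n + m) n s))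
    (hW : ∀ x ∈ W, (xMat (m := m) x).det ≠ 0) :
    ∃ z : Matrix (Fin n) (Fin n) (smoothFun W),
      z * Matrix.of (fun i j => (smoothVelocityAlgebra W).coord (Fin.castAdd m i) {j}) = 1 := by
  set X := Matrix.of fun i j => (smoothVelocityAlgebra W).coord (Fin.castAdd m i) {j} with hX
  obtain ⟨d, hd⟩ := exists_mul_eq_one X.det fun x => by
    rw [AlgHom.map_det]
    exact hW x x.2
  refine ⟨d • X.adjugate, ?_⟩
  rw [Matrix.smul_mul, Matrix.adjugate_mul, smul_smul, hd, one_smul]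

/-- The regular algebra of the smooth functions on an open set of regular velocities. -/
def smoothRegularAlgebra (W : Opens (JetSpace (n + m) n s))
    (hW : ∀ x ∈ W, (xMat (m := m) x).det ≠ 0) : RegularAlgebra n m s (smoothFun W) where
  toVelocityAlgebra := smoothVelocityAlgebra W
  z := (exists_inverse_x W hW).choose
  z_mul := (exists_inverse_x W hW).choose_spec

variable {W : Opens (JetSpace (n + m) n s)} {hW : ∀ x ∈ W, (xMat (m := m) x).det ≠ 0}

theorem map_x (x : W) : (smoothRegularAlgebra W hW).x.map (evalAt x) = xMat x.1 := rfl

theorem evalAt_det (x : W) : evalAt x (smoothRegularAlgebra W hW).x.det = (xMat x.1).det := by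
  rw [AlgHom.map_det]
  rfl

theorem map_z (x : W) : (smoothRegularAlgebra W hW).z.map (evalAt x) = (xMat x.1)⁻¹ := by
  refine (Matrix.inv_eq_left_inv ?_).symm
  rw [← map_x (hW := hW) x, ← Matrix.map_mul, RegularAlgebra.z_mul_x]
  simp

theorem evalAt_z (x : W) (i j : Fin n) :
    evalAt x ((smoothRegularAlgebra W hW).z i j) = (xMat x.1)⁻¹ i j :=
  congrFun (congrFun (map_z x) i) j

/-- The element on the right depends on the list through its multiset only; this contains the
symmetry of `y^σ_{i₁⋯iₖ}` on `W`. -/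
theorem isExtension_yFun (σ : Fin m) (l : List (Fin n)) :
    IsExtension (yFun σ l) ((smoothRegularAlgebra W hW).y σ l) := by
  induction l with
  | nil =>
    rw [Multiset.coe_nil, RegularAlgebra.y_zero]
    exact isExtension_coord _ _
  | cons i l ih =>
    rw [← Multiset.cons_coe, RegularAlgebra.y_cons, RegularAlgebra.δ_apply]
    exact IsExtension.sum fun j _ =>
      (IsExtension.mul (f := fun x => (xMat x)⁻¹ j i) (fun x => (evalAt_z x j i).symm)
        (ih.formalD j))

theorem evalAt_y (x : W) (σ : Fin m) (J : Multiset (Fin n)) (hJ : J.card ≤ s) :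
    evalAt x ((smoothRegularAlgebra W hW).y σ J) = (rho x.1).get σ J := by
  unfold GrSpace.get
  rw [dif_pos hJ]
  change _ = yFun σ (J.sort (· ≤ ·)) x.1
  rw [← (isExtension_yFun (hW := hW) σ (J.sort (· ≤ ·))).evalAt x, Multiset.sort_eq]

theorem evalAt_partitionSum {E : Type*} [NormedAddCommGroup E] [NormedSpace ℝ E] {U : Opens E}
    (x : U) (b : Fin n → Multiset (Fin n) → smoothFun U) (a : Multiset (Fin n) → smoothFun U)
    {q : ℕ} (I : Fin q → Fin n) :
    evalAt x (partitionSum b a I) =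
      partitionSum (fun j J => evalAt x (b j J)) (fun J => evalAt x (a J)) I := by
  unfold partitionSum
  simp only [map_sum, smul_eq_mul, map_mul, map_prod]

/-- The values of `zz` witness that a left inverse exists, so the element chosen in `zInv` has the
defining property. -/
theorem zInv_spec (hW : ∀ x ∈ W, (xMat (m := m) x).det ≠ 0) (x : W) (i : Fin n) (q : ℕ)
    (I : Fin q → Fin n) (hq : 1 ≤ q) (hqs : q ≤ s) :
    groupMul (zInv x.1) (fun j J => x.1.get (Fin.castAdd m j) J) i I = groupOne i I := by
  have h : ∃ z : Fin n → Multiset (Fin n) → ℝ,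
      ∀ (i : Fin n) (q : ℕ) (I : Fin q → Fin n), 1 ≤ q → q ≤ s →
        groupMul z (fun j J => x.1.get (Fin.castAdd m j) J) i I = groupOne i I := by
    refine ⟨fun j J => evalAt x ((smoothRegularAlgebra W hW).zz j J), fun i q I hq _ => ?_⟩
    have := congrArg (evalAt x) ((smoothRegularAlgebra W hW).partitionSum_zz hq i I)
    rw [evalAt_partitionSum] at this
    rw [groupMul_eq_partitionSum, groupOne]
    refine Eq.trans this ?_
    split_ifs <;> simp
  exact Classical.epsilon_spec h i q I hq hqs

/-- Both families are left inverses of `𝐱`, and cancellation makes them equal in the orders from `1`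
to `s`. -/
theorem evalAt_zz (x : W) (i : Fin n) (J : Multiset (Fin n)) (hJ : 1 ≤ J.card) (hJs : J.card ≤ s) :
    evalAt x ((smoothRegularAlgebra W hW).zz i J) = zInv x.1 i J := by
  have hw : Matrix.of (fun i j => x.1.get (Fin.castAdd m i) {j}) * (xMat x.1)⁻¹ = 1 :=
    Matrix.mul_nonsing_inv _ (isUnit_iff_ne_zero.2 (hW x x.2))
  refine eq_of_groupMul_eq (x := fun j J => x.1.get (Fin.castAdd m j) J) hw
    (z := fun J => evalAt x ((smoothRegularAlgebra W hW).zz i J)) (z' := zInv x.1 i)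
    (s := s) (fun q I hq hqs => ?_) J hJ hJs
  have h1 := congrArg (evalAt x) ((smoothRegularAlgebra W hW).partitionSum_zz hq i I)
  rw [evalAt_partitionSum] at h1
  have h2 := zInv_spec hW x i q I hq hqs
  rw [groupMul_eq_partitionSum, groupOne] at h2
  rw [h2]
  refine Eq.trans h1 ?_
  split_ifs <;> simp

end Regular

/-! ### Smooth functions of the coordinates `x^i`, `y^σ_J` -/

section GrCoordinates

variable {n m s : ℕ}

/-- The coordinate `y^σ_J` as a continuous linear form. -/
def getYL (σ : Fin m) (J : Multiset (Fin n)) : GrSpace n m s →L[ℝ] ℝ :=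
  if h : J.card ≤ s then ContinuousLinearMap.proj (Sum.inr (σ, ⟨J, h⟩)) else 0

theorem getYL_apply (σ : Fin m) (J : Multiset (Fin n)) (u : GrSpace n m s) :
    getYL σ J u = u.get σ J := by
  unfold getYL GrSpace.get
  split_ifs <;> rfl

/-- The coordinate vector of the coordinate `x^i`. -/
def basisX (i : Fin n) : GrSpace n m s := Pi.single (Sum.inl i) 1

/-- The coordinate vector of the coordinate `y^σ_J`. -/
def basisY (σ : Fin m) (J : Multiset (Fin n)) : GrSpace n m s :=
  if h : J.card ≤ s then Pi.single (Sum.inr (σ, ⟨J, h⟩)) 1 else 0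

theorem basisY_get_eq_zero (σ τ : Fin m) (J K : Multiset (Fin n)) (h : J ≠ K) :
    (basisY σ J : GrSpace n m s).get τ K = 0 := by
  unfold basisY GrSpace.get
  split_ifs with h1 h2
  · refine Pi.single_eq_of_ne ?_ _
    intro h'
    rw [Sum.inr.injEq, Prod.mk.injEq, Subtype.mk.injEq] at h'
    exact h h'.2.symm
  · rfl
  · rfl

theorem deltaJ_eq (σ : Fin m) (J : Multiset (Fin n)) (f : GrSpace n m s → ℝ)
    (u : GrSpace n m s) : deltaJ σ J f u = weight J * fderiv ℝ f u (basisY σ J) := by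
  unfold deltaJ basisY
  split_ifs
  · rfl
  · rw [map_zero, mul_zero]

theorem contDiff_getY (σ : Fin m) (J : Multiset (Fin n)) :
    ContDiff ℝ ∞ fun u : GrSpace n m s => u.get σ J := by
  simp_rw [← getYL_apply]
  exact (getYL σ J).contDiff

variable {V : Opens (GrSpace n m s)}

variable (V) in
/-- The function `y^σ_J`. -/
def coordY (σ : Fin m) (J : Multiset (Fin n)) : smoothFun V :=
  smoothMk (fun u => u.get σ J) (contDiff_getY σ J).contDiffOn

/-- The derivation `∂/∂x^i`. -/
def pdX (i : Fin n) : Derivation ℝ (smoothFun V) (smoothFun V) := directional (basisX i)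

/-- The derivation `∂/∂y^σ_J`. -/
def pdY (σ : Fin m) (J : Multiset (Fin n)) : Derivation ℝ (smoothFun V) (smoothFun V) :=
  directional (basisY σ J)

theorem pdY_coordY_eq_zero (σ τ : Fin m) (J K : Multiset (Fin n)) (h : J ≠ K) :
    pdY σ J (coordY V τ K) = 0 := smoothFun_ext fun u => by
  have h0 : IsExtension (fun u : GrSpace n m s => u.get τ K) (coordY V τ K) := fun _ => rfl
  rw [pdY, (h0.directional _).evalAt u, map_zero]
  simp_rw [← getYL_apply]
  rw [ContinuousLinearMap.fderiv, getYL_apply, basisY_get_eq_zero _ _ _ _ h]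

/-- The total derivative. -/
def totalDer (i : Fin n) : Derivation ℝ (smoothFun V) (smoothFun V) :=
  pdX i + ∑ σ, ∑ J : MultiIndex n s, coordY V σ (i ::ₘ J.1) • pdY σ J.1

theorem totalDer_apply (i : Fin n) (g : smoothFun V) :
    totalDer i g = pdX i g + ∑ σ, ∑ J : MultiIndex n s, coordY V σ (i ::ₘ J.1) * pdY σ J.1 g := by
  simp [totalDer, derivation_sum_apply]

theorem IsExtension.deltaJ {f : GrSpace n m s → ℝ} {g : smoothFun V} (h : IsExtension f g)
    (σ : Fin m) (J : Multiset (Fin n)) :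
    IsExtension (deltaJ σ J f) (weight J • pdY σ J g) :=
  ((h.directional (basisY σ J)).const_smul (weight J)).congr fun x => deltaJ_eq σ J f x

theorem coordY_eq_zero (σ : Fin m) (J : Multiset (Fin n)) (hJ : s < J.card) :
    coordY V σ J = 0 := smoothFun_ext fun u => by
  change (u : GrSpace n m s).get σ J = 0
  rw [GrSpace.get, dif_neg (not_le.2 hJ)]

theorem IsExtension.totalD {f : GrSpace n m s → ℝ} {g : smoothFun V} (h : IsExtension f g)
    (i : Fin n) : IsExtension (totalD i f) (totalDer i g) := by
  have h1 : totalDer i g = pdX i g + ∑ k ∈ Finset.range s, ∑ j : Fin k → Fin n, ∑ σ : Fin m,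
      coordY V σ (i ::ₘ ms j) * (weight (ms j) • pdY σ (ms j) g) := by
    rw [totalDer_apply, Finset.sum_comm,
      sum_multiIndex_eq s fun J => ∑ σ : Fin m, coordY V σ (i ::ₘ J) * pdY σ J g,
      Finset.sum_range_succ, Finset.sum_eq_zero (s := (Finset.univ : Finset (Fin s → Fin n))),
      add_zero]
    · simp_rw [Finset.smul_sum, mul_smul_comm]
    · intro j _
      rw [Finset.sum_eq_zero, smul_zero]
      intro σ _
      rw [coordY_eq_zero _ _ (by simp), zero_mul]
  rw [h1]
  exact (h.directional (basisX i)).add <| IsExtension.sum fun k _ => IsExtension.sum fun j _ =>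
    IsExtension.sum fun σ _ => IsExtension.mul (fun _ => rfl) (h.deltaJ σ _)

theorem IsExtension.totalDs {f : GrSpace n m s → ℝ} {g : smoothFun V} (h : IsExtension f g)
    (l : List (Fin n)) :
    IsExtension (totalDs l f) ((l.map (ends totalDer)).prod g) := by
  induction l with
  | nil => exact h
  | cons i l ih => exact ih.totalD i

/-- The function depends on the coordinates `y^σ_J` with `|J| ≤ k` only. -/
def HasGrOrder (k : ℕ) (g : smoothFun V) : Prop := ∀ σ J, k < J.card → pdY σ J g = 0

theorem HasGrOrder.pdY {k : ℕ} {g : smoothFun V} (h : HasGrOrder k g) (σ : Fin m)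
    (J : Multiset (Fin n)) : HasGrOrder k (pdY σ J g) := fun τ K hK => by
  have := directional_comm (basisY τ K) (basisY σ J) g
  change Grassmann.pdY τ K (Grassmann.pdY σ J g) = Grassmann.pdY σ J (Grassmann.pdY τ K g) at this
  rw [this, h τ K hK, map_zero]

theorem HasGrOrder.totalDer {k : ℕ} {g : smoothFun V} (h : HasGrOrder k g) (i : Fin n) :
    HasGrOrder (k + 1) (totalDer i g) := fun σ J hJ => by
  have h0 := h σ J (by omega)
  have hx := directional_comm (basisY σ J) (basisX i) g
  change Grassmann.pdY σ J (Grassmann.pdX i g) = Grassmann.pdX i (Grassmann.pdY σ J g) at hx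
  rw [totalDer_apply, map_add, hx, h0, map_zero, zero_add, map_sum]
  refine Finset.sum_eq_zero fun τ _ => ?_
  rw [map_sum]
  refine Finset.sum_eq_zero fun K _ => ?_
  rw [Derivation.leibniz, h.pdY τ K.1 σ J (by omega), smul_zero, zero_add]
  by_cases hJK : J = i ::ₘ K.1
  · rw [h τ K.1, zero_smul]
    rw [hJK, Multiset.card_cons] at hJ
    omega
  · rw [pdY_coordY_eq_zero _ _ _ _ hJK, smul_zero]

theorem HasGrOrder.totalDers {k : ℕ} {g : smoothFun V} (h : HasGrOrder k g) (l : List (Fin n)) :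
    HasGrOrder (k + l.length) ((l.map (ends Grassmann.totalDer)).prod g) := by
  induction l with
  | nil => exact h
  | cons i l ih => exact ih.totalDer i

end GrCoordinates

/-! ### The pullback by the projection -/

section Pullback

variable {n m s : ℕ}

theorem contDiffOn_rho {W : Opens (JetSpace (n + m) n s)}
    (hW : ∀ x ∈ W, (xMat (m := m) x).det ≠ 0) :
    ContDiffOn ℝ ∞ (rho : JetSpace (n + m) n s → GrSpace n m s) W := by
  rw [contDiffOn_pi]
  rintro (i | p)
  · exact (contDiff_get _ _).contDiffOn
  · exact (isExtension_yFun (hW := hW) p.1 (p.2.1.sort (· ≤ ·))).contDiffOn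

/-- The pullback of smooth functions. -/
def pullback {E F : Type*} [NormedAddCommGroup E] [NormedSpace ℝ E] [NormedAddCommGroup F]
    [NormedSpace ℝ F] {W : Opens E} {V : Opens F} (φ : E → F) (hφ : ContDiffOn ℝ ∞ φ W)
    (hm : ∀ x ∈ W, φ x ∈ V) : smoothFun V →ₐ[ℝ] smoothFun W where
  toFun g := ⟨fun x => g.1 ⟨φ x, hm x x.2⟩, by
    obtain ⟨f, hf⟩ := exists_isExtension g
    exact ⟨f ∘ φ, hf.contDiffOn.comp hφ hm, fun x => (hf ⟨φ x, hm x x.2⟩).symm⟩⟩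
  map_one' := rfl
  map_mul' _ _ := rfl
  map_zero' := rfl
  map_add' _ _ := rfl
  commutes' _ := rfl

theorem evalAt_pullback {E F : Type*} [NormedAddCommGroup E] [NormedSpace ℝ E]
    [NormedAddCommGroup F] [NormedSpace ℝ F] {W : Opens E} {V : Opens F} {φ : E → F}
    (hφ : ContDiffOn ℝ ∞ φ W) (hm : ∀ x ∈ W, φ x ∈ V) (g : smoothFun V) (x : W) :
    evalAt x (pullback φ hφ hm g) = evalAt ⟨φ x, hm x x.2⟩ g := rfl

theorem IsExtension.pullback {E F : Type*} [NormedAddCommGroup E] [NormedSpace ℝ E]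
    [NormedAddCommGroup F] [NormedSpace ℝ F] {W : Opens E} {V : Opens F} {φ : E → F}
    (hφ : ContDiffOn ℝ ∞ φ W) (hm : ∀ x ∈ W, φ x ∈ V) {f : F → ℝ} {g : smoothFun V}
    (h : IsExtension f g) : IsExtension (fun x => f (φ x)) (pullback φ hφ hm g) := fun x =>
  h ⟨φ x, hm x x.2⟩

/-- The directional derivatives of a pullback. -/
theorem directional_pullback {E F : Type*} [NormedAddCommGroup E] [NormedSpace ℝ E]
    [NormedAddCommGroup F] [NormedSpace ℝ F] {W : Opens E} {V : Opens F} {φ : E → F}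
    (hφ : ContDiffOn ℝ ∞ φ W) (hm : ∀ x ∈ W, φ x ∈ V) {f : F → ℝ} {g : smoothFun V}
    (h : IsExtension f g) (v : E) (x : W) :
    evalAt x (directional v (pullback φ hφ hm g)) = fderiv ℝ f (φ x) (fderiv ℝ φ x v) := by
  have hd : DifferentiableAt ℝ φ x :=
    (hφ.contDiffAt (W.isOpen.mem_nhds x.2)).differentiableAt (by simp)
  rw [((h.pullback hφ hm).directional v).evalAt x]
  change fderiv ℝ (f ∘ φ) (x : E) v = _
  rw [fderiv_comp (x : E) (h.differentiableAt ⟨φ x, hm x x.2⟩) hd]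
  rfl

variable {W : Opens (JetSpace (n + m) n s)} {V : Opens (GrSpace n m s)}
  (hW : ∀ x ∈ W, (xMat (m := m) x).det ≠ 0) (hm : ∀ x ∈ W, rho x ∈ V)

theorem basisY_coe (σ : Fin m) (J : MultiIndex n s) :
    (basisY σ J.1 : GrSpace n m s) = Pi.single (Sum.inr (σ, J)) 1 := by
  rw [basisY, dif_pos J.2]

/-- The components of the differential of `rho` are the partial derivatives of `x^i` and of `y^σ_K`.
-/
theorem chainRule_pullback_rho (g : smoothFun V) :
    (smoothRegularAlgebra W hW).ChainRule s (pullback rho (contDiffOn_rho hW) hm g)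
      (fun i => pullback rho (contDiffOn_rho hW) hm (pdX i g))
      (fun σ J => pullback rho (contDiffOn_rho hW) hm (pdY σ J g)) := by
  intro a J
  obtain ⟨f, hf⟩ := exists_isExtension g
  refine smoothFun_ext fun x => ?_
  set R := smoothRegularAlgebra W hW with hR
  have hρ := contDiffOn_rho hW
  have hd : DifferentiableAt ℝ (rho : JetSpace (n + m) n s → GrSpace n m s) x :=
    (hρ.contDiffAt (W.isOpen.mem_nhds x.2)).differentiableAt (by simp)
  have hcomp : ∀ p, fderiv ℝ (rho : JetSpace (n + m) n s → GrSpace n m s) (x : _) (basisJ a J) p =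
      fderiv ℝ (fun x : JetSpace (n + m) n s => rho x p) x (basisJ a J) := by
    intro p
    rw [fderiv_pi fun p => (differentiableAt_pi.1 hd) p]
    rfl
  have hx : ∀ i, fderiv ℝ (rho : JetSpace (n + m) n s → GrSpace n m s) x (basisJ a J)
      (Sum.inl i) = evalAt x (R.pd a J (R.coord (Fin.castAdd m i) 0)) := by
    intro i
    rw [hcomp]
    exact (((isExtension_coord (W := W) (Fin.castAdd m i) 0).directional
      (basisJ a J)).evalAt x).symm
  have hy : ∀ σ (K : MultiIndex n s), fderiv ℝ (rho : JetSpace (n + m) n s → GrSpace n m s) x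
      (basisJ a J) (Sum.inr (σ, K)) = evalAt x (R.pd a J (R.y σ K.1)) := by
    intro σ K
    rw [hcomp]
    have h := isExtension_yFun (hW := hW) σ (K.1.sort (· ≤ ·))
    rw [Multiset.sort_eq] at h
    exact ((h.directional (basisJ a J)).evalAt x).symm
  have h1 : evalAt x (R.pd a J (pullback rho hρ hm g)) =
      fderiv ℝ f (rho x) (fderiv ℝ rho (x : JetSpace (n + m) n s) (basisJ a J)) :=
    directional_pullback hρ hm hf (basisJ a J) x
  rw [h1, pi_eq_sum_univ' (fderiv ℝ rho (x : JetSpace (n + m) n s) (basisJ a J)), map_sum,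
    Fintype.sum_sum_type, Fintype.sum_prod_type]
  simp only [map_smul, smul_eq_mul, map_add, map_sum, map_mul, hx, hy, evalAt_pullback]
  congr 1
  · refine Finset.sum_congr rfl fun i _ => ?_
    rw [pdX, (hf.directional _).evalAt, mul_comm]
    congr 2
  · refine Finset.sum_congr rfl fun σ _ => Finset.sum_congr rfl fun K _ => ?_
    rw [pdY, (hf.directional _).evalAt, mul_comm, basisY_coe]

theorem chainRule_pullback_rho_of_hasGrOrder {r : ℕ} (hr : r ≤ s) {g : smoothFun V}
    (hg : HasGrOrder r g) :
    (smoothRegularAlgebra W hW).ChainRule r (pullback rho (contDiffOn_rho hW) hm g)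
      (fun i => pullback rho (contDiffOn_rho hW) hm (pdX i g))
      (fun σ J => pullback rho (contDiffOn_rho hW) hm (pdY σ J g)) := by
  intro a J
  rw [chainRule_pullback_rho hW hm g a J]
  congr 1
  refine Finset.sum_congr rfl fun σ _ => ?_
  refine sum_multiIndex_of_le hr (fun K => pullback rho (contDiffOn_rho hW) hm (pdY σ K g) *
    (smoothRegularAlgebra W hW).pd a J ((smoothRegularAlgebra W hW).y σ K)) fun K hK => ?_
  rw [hg σ K hK, map_zero, zero_mul]

/-- The projection intertwines the derivations `δ_i` and `D_i`. -/
theorem δ_pullback_rho {k : ℕ} (hk : k + 1 ≤ s) {g : smoothFun V} (hg : HasGrOrder k g)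
    (i : Fin n) :
    (smoothRegularAlgebra W hW).δ i (pullback rho (contDiffOn_rho hW) hm g) =
      pullback rho (contDiffOn_rho hW) hm (totalDer i g) := by
  rw [(chainRule_pullback_rho hW hm g).δ i, totalDer_apply, map_add, map_sum]
  congr 1
  refine Finset.sum_congr rfl fun σ _ => ?_
  rw [map_sum]
  refine Finset.sum_congr rfl fun K _ => ?_
  -- Above order `k` the function has no derivative. For the remaining `K` the order of `i ::ₘ K` is
  -- at most `s`, so the coordinate of `rho` is not truncated to zero.
  by_cases hK : k < K.1.card
  · rw [hg σ K.1 hK, map_zero, zero_mul, mul_zero, map_zero]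
  · rw [map_mul, mul_comm]
    congr 1
    refine smoothFun_ext fun x => ?_
    rw [evalAt_y _ _ _ (by rw [Multiset.card_cons]; omega)]
    rfl

theorem prod_δ_pullback_rho {k : ℕ} {g : smoothFun V} (hg : HasGrOrder k g) (l : List (Fin n))
    (hl : k + l.length ≤ s) :
    (l.map (ends (smoothRegularAlgebra W hW).δ)).prod (pullback rho (contDiffOn_rho hW) hm g) =
      pullback rho (contDiffOn_rho hW) hm ((l.map (ends totalDer)).prod g) := by
  induction l with
  | nil => rfl
  | cons i l ih =>
    rw [List.length_cons] at hl
    rw [List.map_cons, List.prod_cons, Module.End.mul_apply, ih (by omega), ends_apply,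
      δ_pullback_rho hW hm (k := k + l.length) (by omega) (hg.totalDers l)]
    rfl

/-- Repeated use of `δ_i ∘ ρ* = ρ* ∘ D_i`. Each total derivative may raise the order by one,
starting from `r`; the at most `r` derivatives are the reason for `2 * r ≤ s`. -/
theorem grLieEuler_rho {r : ℕ} (hrs : 2 * r ≤ s) {f : GrSpace n m s → ℝ} {g : smoothFun V}
    (hf : IsExtension f g) (hg : HasGrOrder r g) (σ : Fin m) {k : ℕ} (i : Fin k → Fin n)
    (x : W) :
    grLieEuler r σ i f (rho x.1) =
      evalAt x (lieSum (ends (smoothRegularAlgebra W hW).δ) r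
        (fun J => weight J • pullback rho (contDiffOn_rho hW) hm (pdY σ J g)) (ms i)) := by
  unfold grLieEuler lieSum
  rw [ms_card, map_sum]
  refine Finset.sum_congr rfl fun l hl => ?_
  rw [map_sum]
  refine Finset.sum_congr rfl fun j _ => ?_
  rw [map_smul, smul_eq_mul, iter_ofFn (commute_ends (smoothRegularAlgebra W hW).δ_comm)]
  beta_reduce
  rw [← map_smul, prod_δ_pullback_rho hW hm (k := r), evalAt_pullback]
  · exact congrArg _ (((hf.deltaJ σ _).totalDs _).evalAt ⟨rho x.1, hm x x.2⟩).symm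
  · intro τ K hK
    rw [Derivation.map_smul, hg.pdY σ _ τ K hK, smul_zero]
  -- The summation range gives `l ≤ r - k`, so `r + l ≤ 2 * r ≤ s`.
  · rw [List.length_ofFn]
    have := Finset.mem_range.1 hl
    omega

end Pullback

/-! ### The truncation of jets -/

section Truncation

variable {N n m r s : ℕ}

/-- The projection of velocities of order `s` onto velocities of order `r` as a linear map. -/
def truncL (r : ℕ) : JetSpace N n s →L[ℝ] JetSpace N n r :=
  ContinuousLinearMap.pi fun p => getL p.1 p.2.1

theorem truncL_apply (x : JetSpace N n s) : truncL r x = x.trunc r :=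
  funext fun p => getL_apply p.1 p.2.1 x

theorem trunc_eq_truncL : (JetSpace.trunc r : JetSpace N n s → JetSpace N n r) = truncL r :=
  funext fun x => (truncL_apply x).symm

theorem trunc_get (x : JetSpace N n s) (a : Fin N) (J : Multiset (Fin n))
    (hJ : J.card ≤ r) : (x.trunc r).get a J = x.get a J := by
  rw [JetSpace.get, dif_pos hJ]
  rfl

theorem truncL_basisJ (hrs : r ≤ s) (a : Fin N) (J : Multiset (Fin n)) :
    truncL r (basisJ a J : JetSpace N n s) = basisJ a J := by
  by_cases hJ : J.card ≤ s
  · funext p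
    rw [truncL_apply]
    change (basisJ a J : JetSpace N n s).get p.1 p.2.1 = _
    rw [basisJ_get _ _ _ _ hJ]
    unfold basisJ
    split_ifs with h1 h2 h2
    · obtain ⟨rfl, rfl⟩ := h1
      exact (Pi.single_eq_same (M := fun _ => ℝ) p 1).symm
    · exact absurd (h1.2 ▸ p.2.2) h2
    · refine (Pi.single_eq_of_ne (M := fun _ => ℝ) ?_ _).symm
      rintro rfl
      exact h1 ⟨rfl, rfl⟩
    · rfl
  · rw [basisJ, dif_neg hJ, map_zero, basisJ, dif_neg fun h => hJ (h.trans hrs)]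

theorem contDiff_trunc : ContDiff ℝ ∞ (JetSpace.trunc r : JetSpace N n s → JetSpace N n r) := by
  rw [trunc_eq_truncL]
  exact (truncL r).contDiff

theorem xMat_trunc (hr : 1 ≤ r) (x : JetSpace (n + m) n s) :
    xMat (m := m) (x.trunc r) = xMat x := by
  ext i j
  exact trunc_get x _ _ (by simpa using hr)

section

variable {W : Opens (JetSpace N n s)} {U : Opens (JetSpace N n r)}
  (hm : ∀ x ∈ W, x.trunc r ∈ U)

theorem pd_pullback_trunc (hrs : r ≤ s) (a : Fin N) (J : Multiset (Fin n)) (f : smoothFun U) :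
    (smoothVelocityAlgebra W).pd a J (pullback _ contDiff_trunc.contDiffOn hm f) =
      pullback _ contDiff_trunc.contDiffOn hm ((smoothVelocityAlgebra U).pd a J f) := by
  obtain ⟨F, hF⟩ := exists_isExtension f
  refine smoothFun_ext fun x => ?_
  refine (directional_pullback contDiff_trunc.contDiffOn hm hF (basisJ a J) x).trans ?_
  have h : fderiv ℝ (JetSpace.trunc r) x.1 (basisJ a J) = basisJ a J := by
    rw [trunc_eq_truncL, ContinuousLinearMap.fderiv, truncL_basisJ hrs]
  rw [h]
  exact ((hF.directional (basisJ a J)).evalAt ⟨x.1.trunc r, hm x x.2⟩).symm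

theorem coord_pullback_trunc (a : Fin N) (J : Multiset (Fin n)) (hJ : J.card ≤ r) :
    pullback _ contDiff_trunc.contDiffOn hm ((smoothVelocityAlgebra U).coord a J) =
      (smoothVelocityAlgebra W).coord a J :=
  smoothFun_ext fun x => trunc_get x.1 a J hJ

theorem d_pullback_trunc (hrs : r ≤ s) {k : ℕ} (hk : k + 1 ≤ r) {f : smoothFun U}
    (hf : (smoothVelocityAlgebra U).HasOrder k f) (i : Fin n) :
    (smoothVelocityAlgebra W).d i (pullback _ contDiff_trunc.contDiffOn hm f) =
      pullback _ contDiff_trunc.contDiffOn hm ((smoothVelocityAlgebra U).d i f) := by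
  rw [VelocityAlgebra.d_apply, VelocityAlgebra.d_apply, map_sum]
  refine Finset.sum_congr rfl fun a _ => ?_
  rw [map_sum, sum_multiIndex_of_le hrs (fun J => (smoothVelocityAlgebra W).coord a (i ::ₘ J) *
    (smoothVelocityAlgebra W).pd a J (pullback _ contDiff_trunc.contDiffOn hm f))]
  · refine Finset.sum_congr rfl fun J _ => ?_
    rw [map_mul, pd_pullback_trunc hm hrs]
    by_cases hJ : k < J.1.card
    · rw [hf a J.1 hJ, map_zero, mul_zero, mul_zero]
    · rw [coord_pullback_trunc hm _ _ (by rw [Multiset.card_cons]; omega)]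
  · intro J hJ
    rw [pd_pullback_trunc hm hrs, hf a J (by omega), map_zero, mul_zero]

end

section

variable {W : Opens (JetSpace (n + m) n s)} {U : Opens (JetSpace (n + m) n r)}
  (hW : ∀ x ∈ W, (xMat (m := m) x).det ≠ 0) (hU : ∀ x ∈ U, (xMat (m := m) x).det ≠ 0)
  (hm : ∀ x ∈ W, x.trunc r ∈ U)

theorem y_pullback_trunc (hr : 1 ≤ r) (hrs : r ≤ s) (σ : Fin m) (J : Multiset (Fin n))
    (hJ : J.card ≤ r) :
    pullback _ contDiff_trunc.contDiffOn hm ((smoothRegularAlgebra U hU).y σ J) =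
      (smoothRegularAlgebra W hW).y σ J := by
  induction J using Multiset.induction_on with
  | empty =>
    rw [RegularAlgebra.y_zero, RegularAlgebra.y_zero]
    exact coord_pullback_trunc hm _ _ (by simp)
  | cons i J ih =>
    rw [Multiset.card_cons] at hJ
    rw [RegularAlgebra.y_cons, RegularAlgebra.y_cons, RegularAlgebra.δ_apply,
      RegularAlgebra.δ_apply, map_sum]
    refine Finset.sum_congr rfl fun j _ => ?_
    rw [map_mul, ← ih (by omega)]
    congr 1
    · refine smoothFun_ext fun x => ?_
      rw [evalAt_pullback, evalAt_z, evalAt_z, xMat_trunc hr]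
    · exact (d_pullback_trunc hm hrs hJ ((smoothRegularAlgebra U hU).hasOrder_y σ J) j).symm

/-- The projection commutes with the truncations. -/
theorem rho_trunc (hW : ∀ x ∈ W, (xMat (m := m) x).det ≠ 0)
    (hU : ∀ x ∈ U, (xMat (m := m) x).det ≠ 0) (hm : ∀ x ∈ W, x.trunc r ∈ U) (hr : 1 ≤ r)
    (hrs : r ≤ s) (x : W) : rho (m := m) (x.1.trunc r) = (rho x.1).trunc r := by
  funext p
  rcases p with i | p
  · exact trunc_get x.1 _ _ (by simp)
  · have h1 := evalAt_y (hW := hW) x p.1 p.2.1 (p.2.2.trans hrs)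
    have h2 := evalAt_y (hW := hU) ⟨x.1.trunc r, hm x x.2⟩ p.1 p.2.1 p.2.2
    rw [← y_pullback_trunc hW hU hm hr hrs p.1 p.2.1 p.2.2, evalAt_pullback, h2, GrSpace.get,
      dif_pos p.2.2] at h1
    exact h1

end

end Truncation

/-! ### Symmetrized partition sums -/

section PartitionSums

variable {n : ℕ}

theorem zSum_congr {z z' : Fin n → Multiset (Fin n) → ℝ} {k q : ℕ} (j : Fin k → Fin n)
    (I : Fin q → Fin n) (h : ∀ i J, 1 ≤ J.card → J.card ≤ q → z i J = z' i J) :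
    zSum z j I = zSum z' j I := by
  unfold zSum
  refine Finset.sum_congr rfl fun c _ => ?_
  split_ifs with hc
  · refine congrArg _ (Finset.sum_congr rfl fun π _ => Finset.prod_congr rfl fun l _ => h _ _ ?_ ?_)
    · rw [ms_card]
      exact c.partSize_pos l
    · rw [ms_card]
      exact c.partSize_le l
  · rfl

theorem zSum_of_pos (z : Fin n → Multiset (Fin n) → ℝ) {q : ℕ} (hq : 0 < q) (j : Fin 0 → Fin n)
    (I : Fin q → Fin n) : zSum z j I = 0 := by
  unfold zSum
  refine Finset.sum_eq_zero fun c _ => ?_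
  rw [dif_neg (c.length_pos hq).ne']

theorem zSum_zero (z : Fin n → Multiset (Fin n) → ℝ) (j I : Fin 0 → Fin n) : zSum z j I = 1 := by
  have h := zSum_eq z (AlgHom.id ℝ ℝ) j I
  rw [partitionSum_zero] at h
  refine h.symm.trans ?_
  simp [weight]

end PartitionSums

/-! ### The lowest coefficients of the symbols of `δ_J` -/

namespace RegularAlgebra

variable {n m s : ℕ} {A : Type*} [CommRing A] [Algebra ℝ A] (V : RegularAlgebra n m s A)

theorem δξ_apply_zero (i : Fin n) (p : Symbol n A) : V.δξ i p 0 = V.δ i (p 0) := by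
  classical
  induction p using Finsupp.induction_linear with
  | zero => simp
  | add p q hp hq => simp [hp, hq]
  | single K a =>
    rw [δξ_single, Finsupp.add_apply, Finsupp.finsetSum_apply, Finset.sum_eq_zero, add_zero,
      Finsupp.single_apply, Finsupp.single_apply]
    · split_ifs <;> simp
    · intro j _
      rw [Finsupp.single_apply, if_neg Multiset.cons_ne_zero]

theorem δξ_apply_singleton (i j : Fin n) (p : Symbol n A) :
    V.δξ i p {j} = V.δ i (p {j}) + V.z j i * p 0 := by
  classical
  induction p using Finsupp.induction_linear with
  | zero => simp
  | add p q hp hq =>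
    rw [map_add, Finsupp.add_apply, hp, hq, Finsupp.add_apply, Finsupp.add_apply, map_add]
    ring
  | single K a =>
    rw [δξ_single, Finsupp.add_apply, Finsupp.finsetSum_apply, Finsupp.single_apply,
      Finsupp.single_apply, Finsupp.single_apply]
    congr 1
    · split_ifs <;> simp
    · by_cases hK : K = 0
      · subst hK
        simp [Finsupp.single_apply]
      · rw [if_neg hK, mul_zero]
        refine Finset.sum_eq_zero fun l _ => ?_
        rw [Finsupp.single_apply, if_neg]
        intro h
        have := congrArg Multiset.card h
        rw [Multiset.card_cons, Multiset.card_singleton] at this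
        exact hK (Multiset.card_eq_zero.1 (by omega))

theorem iter_δξ_apply_zero (J : Multiset (Fin n)) (hJ : J ≠ 0) :
    iter V.δξ J (Finsupp.single 0 1) 0 = 0 := by
  induction J using Multiset.induction_on with
  | empty => exact absurd rfl hJ
  | cons i J ih =>
    rw [iter_cons V.commute_δξ, Module.End.mul_apply, δξ_apply_zero]
    by_cases h : J = 0
    · simp [h]
    · rw [ih h, map_zero]

/-- The part of the symbol linear in `ξ` belongs to the partition into a single block. It is
followed here through the recursion: as `δ_J 1 = 0` for nonempty `J`, a new factor `z^j_i` enters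
only at the first step and is differentiated afterwards. -/
theorem iter_δξ_apply_singleton (j : Fin n) (J : Multiset (Fin n)) (hJ : J ≠ 0) :
    iter V.δξ J (Finsupp.single 0 1) {j} = V.zz j J := by
  induction J using Multiset.induction_on with
  | empty => exact absurd rfl hJ
  | cons i J ih =>
    rw [iter_cons V.commute_δξ, Module.End.mul_apply, δξ_apply_singleton]
    by_cases h : J = 0
    · subst h
      have h0 : (0 : Multiset (Fin n)) ≠ {j} := (Multiset.singleton_ne_zero j).symm
      rw [iter_zero, Module.End.one_apply, Finsupp.single_eq_same, mul_one,
        Finsupp.single_eq_of_ne' h0, map_zero, zero_add, Multiset.cons_zero, zz_singleton]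
    · rw [ih h, V.δ_zz j i J h, V.iter_δξ_apply_zero J h, mul_zero, add_zero]

end RegularAlgebra

/-! ### The Lie–Euler expressions in coordinates -/

section LieEuler

variable {n m r s : ℕ} {W : Opens (JetSpace (n + m) n s)} {V : Opens (GrSpace n m s)}
  {hW : ∀ x ∈ W, (xMat (m := m) x).det ≠ 0}

theorem weight_mul_evalAt_iter_δξ (x : W) {k q : ℕ} (hq : q ≤ s) (j : Fin k → Fin n)
    (I : Fin q → Fin n) :
    weight (ms j) * evalAt x (iter (smoothRegularAlgebra W hW).δξ (ms I) (Finsupp.single 0 1)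
      (ms j)) = zSum (zInv x.1) j I := by
  rw [RegularAlgebra.iter_δξ, zSum_eq]
  exact zSum_congr j I fun i J hJ hJq => evalAt_zz x i J hJ (hJq.trans hq)

theorem zSum_singleton (hW : ∀ x ∈ W, (xMat (m := m) x).det ≠ 0) (x : W) {q : ℕ} (hq : 1 ≤ q)
    (hqs : q ≤ s) (j : Fin n) (I : Fin q → Fin n) :
    zSum (zInv x.1) ![j] I = zInv x.1 j (ms I) := by
  have hj : ms ![j] = {j} := by simp [ms]
  have hI : ms I ≠ 0 := by
    rw [Ne, ← Multiset.card_eq_zero, ms_card]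
    omega
  rw [← weight_mul_evalAt_iter_δξ (hW := hW) x hqs, hj, weight_singleton, one_mul,
    RegularAlgebra.iter_δξ_apply_singleton _ _ _ hI,
    evalAt_zz x j _ (by rwa [ms_card]) (by rwa [ms_card])]

variable (hm : ∀ x ∈ W, rho x ∈ V) {F : JetSpace (n + m) n s → ℝ} {f : GrSpace n m s → ℝ}
  {g : smoothFun V}

theorem hasOrder_det_mul_pullback (hr : 1 ≤ r) (hrs : r ≤ s) (hg : HasGrOrder r g) :
    (smoothRegularAlgebra W hW).HasOrder r
      ((smoothRegularAlgebra W hW).x.det * pullback rho (contDiffOn_rho hW) hm g) :=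
  ((smoothRegularAlgebra W hW).hasOrder_det.mono hr).mul
    (chainRule_pullback_rho_of_hasGrOrder hW hm hrs hg).hasOrder

theorem lieEuler_eq (hr : 1 ≤ r) (hrs : r ≤ s) (hg : HasGrOrder r g)
    (hF : IsExtension F
      ((smoothRegularAlgebra W hW).x.det * pullback rho (contDiffOn_rho hW) hm g))
    (a : Fin (n + m)) {k : ℕ} (hk : k ≤ r) (j : Fin k → Fin n) (x : W) :
    lieEuler r a j F x = weight (ms j) * evalAt x (transpose (smoothRegularAlgebra W hW).d
      ((smoothRegularAlgebra W hW).symbol a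
        ((smoothRegularAlgebra W hW).x.det * pullback rho (contDiffOn_rho hW) hm g)) (ms j)) := by
  rw [← (hF.lieEuler r a j).evalAt x]
  have h := (smoothRegularAlgebra W hW).lieSum_eq hrs a
    (hasOrder_det_mul_pullback hm hr hrs hg) (ms j) (by rwa [ms_card])
  refine (congrArg (evalAt x) h).trans ?_
  rw [map_smul, smul_eq_mul]

/-- The evaluation of `ChainRule.transpose_symbol_natAdd` at a point, with the Lie–Euler sums and
the symbols of `δ_I` rewritten by `grLieEuler_rho` and `weight_mul_evalAt_iter_δξ`. -/
theorem lieEuler_natAdd (hr : 1 ≤ r) (hrs : 2 * r ≤ s) (hf : IsExtension f g)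
    (hg : HasGrOrder r g)
    (hF : IsExtension F
      ((smoothRegularAlgebra W hW).x.det * pullback rho (contDiffOn_rho hW) hm g))
    (σ : Fin m) {k : ℕ} (hk : k ≤ r) (j : Fin k → Fin n) (x : W) :
    lieEuler r (Fin.natAdd n σ) j F x = (-1) ^ k * (xMat x.1).det *
      ∑ q ∈ Finset.range (r + 1), (-1) ^ q * ∑ I : Fin q → Fin n,
        zSum (zInv x.1) j I * grLieEuler r σ I f (rho x.1) := by
  rw [lieEuler_eq hm hr (by omega) hg hF _ hk,
    (chainRule_pullback_rho_of_hasGrOrder hW hm (by omega) hg).transpose_symbol_natAdd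
      (by omega) (by omega)]
  simp only [Finsupp.finsetSum_apply, Finsupp.smul_apply, map_sum, smul_eq_mul, map_mul, map_pow,
    map_neg, map_one, evalAt_det, flip_apply, ms_card]
  simp_rw [Finset.mul_sum]
  refine Finset.sum_congr rfl fun q hq => Finset.sum_congr rfl fun I _ => ?_
  have hq' : q ≤ s := by
    have := Finset.mem_range.1 hq
    omega
  -- The sign `(-1)^q` comes from the integration by parts, the sign `(-1)^k` from `flip` at a
  -- coefficient of degree `k`.
  rw [← grLieEuler_rho hW hm hrs hf hg, ← weight_mul_evalAt_iter_δξ (hW := hW) x hq' j I]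
  ring

/-- The evaluation of `ChainRule.transpose_symbol_castAdd`; the divergence term is of degree one in
`ξ`, so it is seen only when `j` has length one. -/
theorem lieEuler_castAdd (hr : 1 ≤ r) (hrs : 2 * r ≤ s) (hf : IsExtension f g)
    (hg : HasGrOrder r g)
    (hF : IsExtension F
      ((smoothRegularAlgebra W hW).x.det * pullback rho (contDiffOn_rho hW) hm g))
    (p : Fin n) {k : ℕ} (hk : k ≤ r) (j : Fin k → Fin n) (x : W) :
    lieEuler r (Fin.castAdd m p) j F x =
      weight (ms j) * (∑ b, if {b} = ms j then
        (xMat x.1).det * zInv x.1 b {p} * f (rho x.1) else 0) -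
      ∑ σ, (rho x.1).get σ {p} * lieEuler r (Fin.natAdd n σ) j F x := by
  classical
  simp_rw [lieEuler_eq hm hr (show r ≤ s by omega) hg hF _ hk]
  rw [(chainRule_pullback_rho_of_hasGrOrder hW hm (show r ≤ s by omega) hg).transpose_symbol_castAdd
      (by omega) (by omega), Finsupp.sub_apply, map_sub, mul_sub, Finsupp.finsetSum_apply,
      Finsupp.finsetSum_apply, map_sum, map_sum,
      Finset.mul_sum (s := (Finset.univ : Finset (Fin m)))]
  congr 1
  · refine congrArg _ (Finset.sum_congr rfl fun b _ => ?_)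
    rw [Finsupp.single_apply, apply_ite (evalAt x), map_zero, map_mul, map_mul, evalAt_det,
      ← RegularAlgebra.zz_singleton, evalAt_zz x b {p} (by simp)
        (by rw [Multiset.card_singleton]; omega),
      (hf.pullback (contDiffOn_rho hW) hm).evalAt]
  · refine Finset.sum_congr rfl fun σ _ => ?_
    rw [Finsupp.smul_apply, smul_eq_mul, map_mul,
      evalAt_y x σ {p} (by rw [Multiset.card_singleton]; omega)]
    ring

end LieEuler

/-! ### The charts of velocities and of contact elements -/

section Charts

variable {n m r s : ℕ} {X : Type*} [TopologicalSpace X]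
  (ψ : OpenPartialHomeomorph X (EuclideanSpace ℝ (Fin (n + m))))

theorem isOpen_chartW (s : ℕ) : IsOpen (chartW (n := n) ψ s) := by
  refine IsOpen.inter (ψ.open_target.preimage ?_) (isOpen_ne.preimage ?_)
  · exact (PiLp.continuous_toLp 2 _).comp (continuous_pi fun A => (contDiff_get A 0).continuous)
  · exact Continuous.matrix_det (continuous_matrix fun i j => (contDiff_get _ _).continuous)

theorem isOpen_chartRhoW (s : ℕ) : IsOpen (chartRhoW (n := n) ψ s) := by
  refine ψ.open_target.preimage ((PiLp.continuous_toLp 2 _).comp (continuous_pi fun A => ?_))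
  refine Fin.addCases (fun i => ?_) (fun σ => ?_) A
  · simp_rw [Fin.append_left]
    exact continuous_apply _
  · simp_rw [Fin.append_right]
    exact (contDiff_getY σ 0).continuous

/-- The open set `Wˢ`. -/
def chartOpens (s : ℕ) : Opens (JetSpace (n + m) n s) := ⟨chartW ψ s, isOpen_chartW ψ s⟩

/-- The open set `ρˢ(Wˢ)`. -/
def chartRhoOpens (s : ℕ) : Opens (GrSpace n m s) := ⟨chartRhoW ψ s, isOpen_chartRhoW ψ s⟩

theorem det_ne_zero_of_mem (x : JetSpace (n + m) n s) (hx : x ∈ chartOpens ψ s) :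
    (xMat x).det ≠ 0 := hx.2

theorem rho_mem (x : JetSpace (n + m) n s) (hx : x ∈ chartOpens ψ s) :
    rho x ∈ chartRhoOpens ψ s := by
  have h : Fin.append (fun i : Fin n => rho x (Sum.inl i)) (fun σ : Fin m => (rho x).get σ 0) =
      fun A => x.get A 0 := by
    funext A
    refine Fin.addCases (fun i => ?_) (fun σ => ?_) A
    · rw [Fin.append_left]
      rfl
    · rw [Fin.append_right, GrSpace.get, dif_pos (by simp)]
      change yFun σ (Multiset.sort 0 (· ≤ ·)) x = _
      rw [Multiset.sort_zero]
      rfl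
  change WithLp.toLp 2 _ ∈ ψ.target
  rw [h]
  exact hx.1

theorem trunc_mem (hr : 1 ≤ r) (x : JetSpace (n + m) n s) (hx : x ∈ chartOpens ψ s) :
    x.trunc r ∈ chartOpens ψ r := by
  refine ⟨?_, ?_⟩
  · simp_rw [trunc_get x _ 0 (by simp)]
    exact hx.1
  · rw [xMat_trunc hr]
    exact hx.2

theorem gr_trunc_get_zero (u : GrSpace n m s) (σ : Fin m) : (u.trunc r).get σ 0 = u.get σ 0 := by
  rw [GrSpace.get, dif_pos (by simp)]
  rfl

theorem gr_trunc_mem (u : GrSpace n m s) (hu : u ∈ chartRhoOpens ψ s) :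
    u.trunc r ∈ chartRhoOpens ψ r := by
  change WithLp.toLp 2 (Fin.append (fun i : Fin n => u.trunc r (Sum.inl i))
    fun σ : Fin m => (u.trunc r).get σ 0) ∈ ψ.target
  simp_rw [gr_trunc_get_zero]
  exact hu

/-- The projection of contact elements of order `s` onto those of order `r` as a linear map. -/
def grTruncL (r : ℕ) : GrSpace n m s →L[ℝ] GrSpace n m r :=
  ContinuousLinearMap.pi fun
    | Sum.inl i => ContinuousLinearMap.proj (Sum.inl i)
    | Sum.inr p => getYL p.1 p.2.1

theorem gr_trunc_eq_grTruncL :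
    (GrSpace.trunc r : GrSpace n m s → GrSpace n m r) = grTruncL r := by
  funext u p
  rcases p with i | p
  · rfl
  · exact (getYL_apply p.1 p.2.1 u).symm

theorem contDiff_gr_trunc :
    ContDiff ℝ ∞ (GrSpace.trunc r : GrSpace n m s → GrSpace n m r) := by
  rw [gr_trunc_eq_grTruncL]
  exact (grTruncL r).contDiff

theorem grTruncL_basisY (σ : Fin m) (J : Multiset (Fin n)) (hJ : r < J.card) :
    grTruncL r (basisY σ J : GrSpace n m s) = 0 := by
  funext p
  rcases p with i | p
  · change (basisY σ J : GrSpace n m s) (Sum.inl i) = 0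
    unfold basisY
    split_ifs
    · exact Pi.single_eq_of_ne (by simp) _
    · rfl
  · change getYL p.1 p.2.1 (basisY σ J : GrSpace n m s) = 0
    rw [getYL_apply, basisY_get_eq_zero]
    rintro rfl
    exact absurd p.2.2 (not_le.2 hJ)

theorem hasGrOrder_pullback_trunc {V : Opens (GrSpace n m s)} {U : Opens (GrSpace n m r)}
    (hm : ∀ u ∈ V, u.trunc r ∈ U) (f : smoothFun U) :
    HasGrOrder r (pullback _ contDiff_gr_trunc.contDiffOn hm f) := fun σ J hJ => by
  obtain ⟨F, hF⟩ := exists_isExtension f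
  refine smoothFun_ext fun u => ?_
  refine (directional_pullback contDiff_gr_trunc.contDiffOn hm hF (basisY σ J) u).trans ?_
  have h : fderiv ℝ (GrSpace.trunc r) u.1 (basisY σ J) = 0 := by
    rw [gr_trunc_eq_grTruncL, ContinuousLinearMap.fderiv, grTruncL_basisY σ J hJ]
  rw [h, map_zero, map_zero]

end Charts

/-! ### Homogeneous and associated Lagrangians -/

section Associated

variable {n m r s : ℕ} {X : Type*} [TopologicalSpace X]
  [ChartedSpace (EuclideanSpace ℝ (Fin (n + m))) X]
  {ψ : OpenPartialHomeomorph X (EuclideanSpace ℝ (Fin (n + m)))}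
  {𝓛 : RegularVelocity n (n + m) X r → ℝ} {L : GrSpace n m r → ℝ}

/-- The non-homogeneous Lagrangian as a smooth function on contact elements of order `s`. -/
def IsAssociated.smoothFun (hL : IsAssociated 𝓛 ψ L) (s : ℕ) :
    Grassmann.smoothFun (chartRhoOpens (n := n) (m := m) ψ s) :=
  pullback _ contDiff_gr_trunc.contDiffOn (gr_trunc_mem ψ)
    (smoothMk (W := chartRhoOpens ψ r) L hL.smooth)

theorem IsAssociated.isExtension (hL : IsAssociated 𝓛 ψ L) :
    IsExtension (fun u => L (u.trunc r)) (hL.smoothFun s) := fun _ => rfl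

/-- Both Lagrangians have order `r` and are pulled back to order `s`; `rho_trunc` shows that the
factorization `𝓛 = det(𝐱) L ∘ ρ` survives the pullback. -/
theorem IsAssociated.isExtension_coordExpr (hL : IsAssociated 𝓛 ψ L) (hr : 1 ≤ r) (hrs : r ≤ s) :
    IsExtension (fun x => coordExpr ψ 𝓛 (x.trunc r))
      ((smoothRegularAlgebra (chartOpens ψ s) (det_ne_zero_of_mem ψ)).x.det *
        pullback rho (contDiffOn_rho (det_ne_zero_of_mem ψ)) (rho_mem ψ) (hL.smoothFun s)) := by
  intro x
  beta_reduce
  rw [hL.eq _ (trunc_mem ψ hr x.1 x.2), xMat_trunc hr,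
    rho_trunc (det_ne_zero_of_mem ψ) (det_ne_zero_of_mem ψ) (trunc_mem ψ hr) hr hrs x]
  rw [← evalAt_det (hW := det_ne_zero_of_mem ψ) x]
  rfl

theorem lagLieEuler_natAdd (hL : IsAssociated 𝓛 ψ L) (hr : 1 ≤ r) (hrs : 2 * r ≤ s) (σ : Fin m)
    {k : ℕ} (hk : k ≤ r) (j : Fin k → Fin n) (x : JetSpace (n + m) n s) (hx : x ∈ chartW ψ s) :
    lagLieEuler ψ 𝓛 (Fin.natAdd n σ) j x = (-1) ^ k * (xMat x).det *
      ∑ q ∈ Finset.Icc k r, (-1) ^ q * ∑ I : Fin q → Fin n,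
        zSum (zInv x) j I * nonhomLieEuler L σ I (rho x) := by
  have h := lieEuler_natAdd (rho_mem ψ) hr hrs hL.isExtension
    (hasGrOrder_pullback_trunc (gr_trunc_mem ψ) _) (hL.isExtension_coordExpr hr (by omega)) σ hk j
    ⟨x, hx⟩
  -- A sequence of length `q < k` has no partition into `k` nonempty blocks, so the sum may start at
  -- `q = k`.
  refine h.trans (congrArg _ (Finset.sum_subset (fun q hq => ?_) fun q _ hq => ?_).symm)
  · have := Finset.mem_Icc.1 hq
    exact Finset.mem_range.2 (by omega)
  · have hqk : q < k := by
      by_contra hqk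
      rename_i hq'
      exact hq (Finset.mem_Icc.2 ⟨by omega, by have := Finset.mem_range.1 hq'; omega⟩)
    simp_rw [zSum_eq_zero _ hqk, zero_mul]
    simp

/-- For `k = 0` only the empty `I` contributes, since a nonempty sequence has no partition into zero
blocks. -/
theorem lagLieEuler_natAdd_zero (hL : IsAssociated 𝓛 ψ L) (hr : 1 ≤ r) (hrs : 2 * r ≤ s)
    (σ : Fin m) (x : JetSpace (n + m) n s) (hx : x ∈ chartW ψ s) :
    lagLieEuler ψ 𝓛 (Fin.natAdd n σ) ![] x =
      (xMat x).det * nonhomLieEuler L σ ![] (rho x) := by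
  rw [lagLieEuler_natAdd hL hr hrs σ (Nat.zero_le r) _ x hx, Finset.sum_eq_single 0]
  · rw [Fintype.sum_unique, zSum_zero, pow_zero, one_mul, one_mul, one_mul,
      Subsingleton.elim default ![]]
  · intro q _ hq
    simp_rw [zSum_of_pos _ (Nat.pos_of_ne_zero hq), zero_mul]
    simp
  · simp

theorem lagLieEuler_castAdd (hL : IsAssociated 𝓛 ψ L) (hr : 1 ≤ r) (hrs : 2 * r ≤ s) (p : Fin n)
    {k : ℕ} (hk : k ≤ r) (j : Fin k → Fin n) (x : JetSpace (n + m) n s) (hx : x ∈ chartW ψ s) :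
    lagLieEuler ψ 𝓛 (Fin.castAdd m p) j x =
      weight (ms j) * (∑ b, if {b} = ms j then
        (xMat x).det * zInv x b {p} * L ((rho x).trunc r) else 0) -
      ∑ σ, (rho x).get σ {p} * lagLieEuler ψ 𝓛 (Fin.natAdd n σ) j x :=
  lieEuler_castAdd (rho_mem ψ) hr hrs hL.isExtension
    (hasGrOrder_pullback_trunc (gr_trunc_mem ψ) _) (hL.isExtension_coordExpr hr (by omega)) p hk j
    ⟨x, hx⟩

/-- Away from order one the divergence term is absent. -/
theorem lagLieEuler_castAdd_of_ne_one (hL : IsAssociated 𝓛 ψ L) (hr : 1 ≤ r) (hrs : 2 * r ≤ s)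
    (p : Fin n) {k : ℕ} (hk : k ≤ r) (hk1 : k ≠ 1) (j : Fin k → Fin n)
    (x : JetSpace (n + m) n s) (hx : x ∈ chartW ψ s) :
    lagLieEuler ψ 𝓛 (Fin.castAdd m p) j x =
      -∑ σ, (rho x).get σ {p} * lagLieEuler ψ 𝓛 (Fin.natAdd n σ) j x := by
  rw [lagLieEuler_castAdd hL hr hrs p hk j x hx, Finset.sum_eq_zero, mul_zero, zero_sub]
  intro b _
  rw [if_neg]
  intro h
  have := congrArg Multiset.card h
  rw [ms_card, Multiset.card_singleton] at this
  exact hk1 this.symm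

end Associated

end Grassmann

end

/-! ### The five transformation formulas -/

theorem mainTheorem1 {n m r s : ℕ} (hn : 1 ≤ n) (hr : 1 ≤ r) (hs : 2 * r ≤ s)
    {X : Type*} [TopologicalSpace X] [ChartedSpace (EuclideanSpace ℝ (Fin (n + m))) X]
    [IsManifold (𝓡 (n + m)) ∞ X]
    (𝓛 : Grassmann.RegularVelocity n (n + m) X r → ℝ)
    (h𝓛 : Grassmann.IsHomogeneousLagrangian 𝓛)
    (ψ : OpenPartialHomeomorph X (EuclideanSpace ℝ (Fin (n + m))))
    (hψ : ψ ∈ IsManifold.maximalAtlas (𝓡 (n + m)) ∞ X)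
    (L : Grassmann.GrSpace n m r → ℝ) (hL : Grassmann.IsAssociated 𝓛 ψ L)
    (x : Grassmann.JetSpace (n + m) n s) (hx : x ∈ Grassmann.chartW ψ s) :
    -- `𝓔_σ(𝓛)`
    (∀ σ : Fin m,
      Grassmann.lagLieEuler ψ 𝓛 (Fin.natAdd n σ) ![] x =
        (Grassmann.xMat x).det * Grassmann.nonhomLieEuler L σ ![] (Grassmann.rho x)) ∧
    -- `𝓔_σ^{j₁⋯jₖ}(𝓛)`, `1 ≤ k ≤ r`
    (∀ (σ : Fin m) (k : ℕ) (j : Fin k → Fin n), 1 ≤ k → k ≤ r →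
      Grassmann.lagLieEuler ψ 𝓛 (Fin.natAdd n σ) j x =
        (-1) ^ k * (Grassmann.xMat x).det *
          ∑ q ∈ Finset.Icc k r, (-1) ^ q * ∑ I : Fin q → Fin n,
            Grassmann.zSum (Grassmann.zInv x) j I *
              Grassmann.nonhomLieEuler L σ I (Grassmann.rho x)) ∧
    -- `𝓔_p(𝓛)`
    (∀ p : Fin n,
      Grassmann.lagLieEuler ψ 𝓛 (Fin.castAdd m p) ![] x =
        -(Grassmann.xMat x).det *
          ∑ σ : Fin m, (Grassmann.rho x).get σ {p} *
            Grassmann.nonhomLieEuler L σ ![] (Grassmann.rho x)) ∧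
    -- `𝓔_p^j(𝓛)`
    (∀ p j : Fin n,
      Grassmann.lagLieEuler ψ 𝓛 (Fin.castAdd m p) ![j] x =
        (Grassmann.xMat x).det *
          (Grassmann.zInv x j {p} * L ((Grassmann.rho x).trunc r) +
            ∑ σ : Fin m, (Grassmann.rho x).get σ {p} *
              ∑ q ∈ Finset.Icc 1 r, (-1) ^ q * ∑ I : Fin q → Fin n,
                Grassmann.zInv x j (Grassmann.ms I) *
                  Grassmann.nonhomLieEuler L σ I (Grassmann.rho x))) ∧
    -- `𝓔_p^{j₁⋯jₖ}(𝓛)`, `2 ≤ k ≤ r`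
    (∀ (p : Fin n) (k : ℕ) (j : Fin k → Fin n), 2 ≤ k → k ≤ r →
      Grassmann.lagLieEuler ψ 𝓛 (Fin.castAdd m p) j x =
        (-1) ^ (k + 1) * (Grassmann.xMat x).det *
          ∑ σ : Fin m, (Grassmann.rho x).get σ {p} *
            ∑ q ∈ Finset.Icc k r, (-1) ^ q * ∑ I : Fin q → Fin n,
              Grassmann.zSum (Grassmann.zInv x) j I *
                Grassmann.nonhomLieEuler L σ I (Grassmann.rho x)) := by
  have hrs : r ≤ s := by omega
  refine ⟨fun σ => ?_, fun σ k j hk hkr => ?_, fun p => ?_, fun p j => ?_, fun p k j hk hkr => ?_⟩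
  · exact Grassmann.lagLieEuler_natAdd_zero hL hr hs σ x hx
  · exact Grassmann.lagLieEuler_natAdd hL hr hs σ hkr j x hx
  · rw [Grassmann.lagLieEuler_castAdd_of_ne_one hL hr hs p (Nat.zero_le r) (by omega) _ x hx,
      neg_mul, Finset.mul_sum]
    refine congrArg _ (Finset.sum_congr rfl fun σ _ => ?_)
    rw [Grassmann.lagLieEuler_natAdd_zero hL hr hs σ x hx]
    ring
  · have hj : Grassmann.ms ![j] = {j} := by simp [Grassmann.ms]
    rw [Grassmann.lagLieEuler_castAdd hL hr hs p hr _ x hx, hj, Grassmann.weight_singleton,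
      one_mul, Finset.sum_eq_single j (fun b _ hb => if_neg (by simpa using hb)) (by simp),
      if_pos rfl, mul_add, sub_eq_add_neg, ← Finset.sum_neg_distrib, Finset.mul_sum]
    congr 1
    · ring
    · refine Finset.sum_congr rfl fun σ _ => ?_
      rw [Grassmann.lagLieEuler_natAdd hL hr hs σ hr _ x hx]
      -- For `k = 1` the only admissible partition has one block, and the partition sum is `z^j_I`
      -- itself.
      have h : ∀ q ∈ Finset.Icc 1 r, (-1 : ℝ) ^ q * ∑ I : Fin q → Fin n,
          Grassmann.zSum (Grassmann.zInv x) ![j] I *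
            Grassmann.nonhomLieEuler L σ I (Grassmann.rho x) =
          (-1) ^ q * ∑ I : Fin q → Fin n, Grassmann.zInv x j (Grassmann.ms I) *
            Grassmann.nonhomLieEuler L σ I (Grassmann.rho x) := by
        intro q hq
        have hq' := Finset.mem_Icc.1 hq
        refine congrArg _ (Finset.sum_congr rfl fun I _ => ?_)
        rw [Grassmann.zSum_singleton (Grassmann.det_ne_zero_of_mem ψ) ⟨x, hx⟩ hq'.1
          (hq'.2.trans hrs) j I]
      rw [Finset.sum_congr rfl h]
      ring
  · rw [Grassmann.lagLieEuler_castAdd_of_ne_one hL hr hs p hkr (by omega) _ x hx,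
      ← Finset.sum_neg_distrib, Finset.mul_sum]
    refine Finset.sum_congr rfl fun σ _ => ?_
    rw [Grassmann.lagLieEuler_natAdd hL hr hs σ hkr j x hx]
    ring
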